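/- **Definitions.** Let $N\ge 2$ be an integer. For finite sets $\mathcal D,\mathcal L\subset\mathbb Z$ with $\mathcal D\neq\emptyset$, the triple $(N,\mathcal D,\mathcal L)$ is a *Hadamard triple* if the matrix $\frac{1}{\sqrt{\#\mathcal D}}\left(e^{2\pi i d\ell/N}\right)_{d\in\mathcal D,\,\ell\in\mathcal L}$ is unitary. The notation $A_a\oplus\cdots\oplus A_b$ denotes the set of all sums $x_a+\cdots+x_b$ with $x_j\in A_j$, and its use includes the assertion that all these sums are distinct. Let $k\ge 0$, let $\mathcal D\subset\mathbb Z$ be finite and let $\mathcal L_0,\dots,\mathcal L_k\subset\mathbb Z$ be finite. We say that $(N,\mathcal D,\mathcal L_0\oplus\cdots\oplus\mathcal L_k)$ is a *$k$-stage product-form Hadamard triple* if there are positive integers $\ell_1,\dots,\ell_k$, a finite set $\mathcal E_0\subset\mathbb Z$ and finite sets $\mathcal E_j(d)\subset\mathbb Z$ ($1\le j\le k$, $d\in\mathcal D^{(j-1)}$) such that, with $$\mathcal D^{(0)}=\mathcal E_0,\qquad \mathcal D^{(j)}=\bigcup_{d\in\mathcal D^{(j-1)}}\left(d+N^{\ell_1+\cdots+\ell_j}\mathcal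 E_j(d)\right)\quad(1\le j\le k),$$ one has $\mathcal D=\mathcal D^{(k)}$ and 1. $(N,\mathcal E_0,\mathcal L_0)$ and $(N,\mathcal E_j(d),\mathcal L_j)$ are Hadamard triples for all $1\le j\le k$ and $d\in\mathcal D^{(j-1)}$; 2. for every $1\le m\le k$ and every (independent) choice of $d_j\in\mathcal D^{(j)}$, $0\le j\le k-1$, both $$\left(N,\ \mathcal E_0\oplus\mathcal E_1(d_0)\oplus\cdots\oplus\mathcal E_m(d_{m-1}),\ \mathcal L_0\oplus\cdots\oplus\mathcal L_m\right)$$ and $$\left(N,\ \mathcal E_m(d_{m-1})\oplus\cdots\oplus\mathcal E_k(d_{k-1}),\ \mathcal L_m\oplus\cdots\oplus\mathcal L_k\right)$$ are Hadamard triples (all the sums being direct). The *self-similar measure* $\mu_{N,\mathcal D}$ is the unique Borel probability measure $\mu$ on $\mathbb R$ with $$\mu(B)=\sum_{d\in\mathcal D}\frac{1}{\#\mathcal D}\,\mu(\phi_d^{-1}(B))\quad\text{for all Borel } B\subset\mathbb R,\qquad \phi_d(x)=\frac{x+d}{N}.$$ A Borel probability measure $\mu$ on $\mathbb R$ is *spectral*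 if there is a countable set $\Lambda\subset\mathbb R$ such that $\{e^{2\pi i\lambda x}:\lambda\in\Lambda\}$ is an orthonormal basis of $L^2(\mu)$. **Theorem.** Let $N\ge 2$ be an integer and let $(N,\mathcal D,\mathcal L_0\oplus\cdots\oplus\mathcal L_k)$ be a $k$-stage product-form Hadamard triple. Then the self-similar measure $\mu_{N,\mathcal D}$ is a spectral measure. -/

import Mathlib

open MeasureTheory
open scoped Matrix Pointwise ENNReal

/-- A Borel probability measure `μ` on `ℝ` is spectral if for some countable `Λ ⊆ ℝ` the exponentials
`x ↦ exp (2 π i t x)`, `t ∈ Λ`, form an orthonormal (Hilbert) basis of `L²(μ)`. -/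
def IsSpectralMeasure (μ : Measure ℝ) : Prop :=
  IsProbabilityMeasure μ ∧ ∃ Λ : Set ℝ, Λ.Countable ∧
    ∃ b : HilbertBasis Λ ℂ (Lp ℂ 2 μ), ∀ t : Λ,
      (b t : ℝ → ℂ) =ᵐ[μ] fun x => Complex.exp (2 * Real.pi * Complex.I * ((t : ℝ) * x : ℝ))

/-- The matrix `(#D)^(-1/2) (exp (2 π i d l / N))`, with rows `d ∈ D` and columns `l ∈ L`. -/
noncomputable def hadamardMatrix (N : ℕ) (D L : Finset ℤ) : Matrix D L ℂ :=
  Matrix.of fun d l =>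
    ((Real.sqrt (D.card : ℝ))⁻¹ : ℝ) *
      Complex.exp (2 * Real.pi * Complex.I * (((d : ℤ) * (l : ℤ) : ℤ) : ℂ) / (N : ℂ))

/-- `(N, D, L)` is an (integral) Hadamard triple: `D` and `L` are sets of integers, `D` is non-empty,
and the matrix above is unitary. -/
structure IsHadamardTriple (N : ℕ) (D L : Finset ℤ) : Prop where
  nonempty : D.Nonempty
  mul_conjTranspose : hadamardMatrix N D L * (hadamardMatrix N D L)ᴴ = 1
  conjTranspose_mul : (hadamardMatrix N D L)ᴴ * hadamardMatrix N D L = 1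

/-- The sum of the sets `A j`, `j ∈ s`, is direct: all the sums `∑ x j` with `x j ∈ A j` are
distinct. -/
def IsDirectSum (s : Finset ℕ) (A : ℕ → Finset ℤ) : Prop :=
  ∀ x y : ℕ → ℤ, (∀ j ∈ s, x j ∈ A j) → (∀ j ∈ s, y j ∈ A j) →
    ∑ j ∈ s, x j = ∑ j ∈ s, y j → ∀ j ∈ s, x j = y j

/-- `(N, ⨁_{j ∈ s} A j, ⨁_{j ∈ s} L j)` is a Hadamard triple, both sums being direct. -/
def IsDirectSumHadamardTriple (N : ℕ) (s : Finset ℕ) (A L : ℕ → Finset ℤ) : Prop :=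
  IsDirectSum s A ∧ IsDirectSum s L ∧ IsHadamardTriple N (∑ j ∈ s, A j) (∑ j ∈ s, L j)

/-- The digit sets `D⁽ʲ⁾`: `D⁽⁰⁾ = E₀` and
`D⁽ʲ⁺¹⁾ = ⋃_{d ∈ D⁽ʲ⁾} (d + N ^ (ℓ 1 + ⋯ + ℓ (j + 1)) E (j + 1) d)`. -/
def stageDigits (N : ℕ) (ℓ : ℕ → ℕ) (E₀ : Finset ℤ) (E : ℕ → ℤ → Finset ℤ) : ℕ → Finset ℤ
  | 0 => E₀
  | j + 1 => (stageDigits N ℓ E₀ E j).biUnion fun d =>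
      (E (j + 1) d).image fun e => d + (N : ℤ) ^ (∑ i ∈ Finset.Icc 1 (j + 1), ℓ i) * e

/-- The summands `E₀, E 1 (d 0), E 2 (d 1), …` selected by a sequence `d` of digits. -/
def stageSummand (E₀ : Finset ℤ) (E : ℕ → ℤ → Finset ℤ) (d : ℕ → ℤ) : ℕ → Finset ℤ
  | 0 => E₀
  | j + 1 => E (j + 1) (d j)

/-- `(N, D, L 0 ⊕ ⋯ ⊕ L k)` is a `k`-stage product-form Hadamard triple. Only the values
`L 0, …, L k`, `ℓ 1, …, ℓ k` and `E j d` with `1 ≤ j ≤ k`, `d ∈ D⁽ʲ⁻¹⁾` matter. The digits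
`d 0, …, d (k - 1)` in the last condition are chosen independently of one another. -/
def IsProductFormHadamardTriple (N k : ℕ) (D : Finset ℤ) (L : ℕ → Finset ℤ) : Prop :=
  ∃ (ℓ : ℕ → ℕ) (E₀ : Finset ℤ) (E : ℕ → ℤ → Finset ℤ),
    (∀ j ∈ Finset.Icc 1 k, 0 < ℓ j) ∧
    D = stageDigits N ℓ E₀ E k ∧
    IsHadamardTriple N E₀ (L 0) ∧
    (∀ j < k, ∀ d ∈ stageDigits N ℓ E₀ E j, IsHadamardTriple N (E (j + 1) d) (L (j + 1))) ∧
    (∀ d : ℕ → ℤ, (∀ j < k, d j ∈ stageDigits N ℓ E₀ E j) → ∀ m ∈ Finset.Icc 1 k,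
      IsDirectSumHadamardTriple N (Finset.Icc 0 m) (stageSummand E₀ E d) L ∧
      IsDirectSumHadamardTriple N (Finset.Icc m k) (stageSummand E₀ E d) L)

/-- `μ` is the equal-weight self-similar measure of the maps `x ↦ (x + d) / N`, `d ∈ D`. -/
structure IsSelfSimilarMeasure (N : ℕ) (D : Finset ℤ) (μ : Measure ℝ) : Prop where
  isProbabilityMeasure : IsProbabilityMeasure μ
  apply_eq : ∀ B : Set ℝ, MeasurableSet B →
    μ B = ∑ d ∈ D, (D.card : ℝ≥0∞)⁻¹ * μ ((fun x : ℝ => (x + (d : ℝ)) / (N : ℝ)) ⁻¹' B)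

theorem IsSelfSimilarMeasure.charFun_eq {N : ℕ} {D : Finset ℤ} {μ : Measure ℝ}
    (h : IsSelfSimilarMeasure N D μ) (t : ℝ) :
    charFun μ t = ((D.card : ℂ)⁻¹ * ∑ d ∈ D, Complex.exp (((d : ℝ) * (t / N) : ℝ) * Complex.I)) *
      charFun μ (t / N) := by
  have := h.isProbabilityMeasure
  have hm : ∀ d : ℤ, Measurable (fun x : ℝ => (x + (d : ℝ)) / (N : ℝ)) := fun d => by fun_prop
  have hμ : μ = ∑ d ∈ D, (D.card : ℝ≥0∞)⁻¹ • μ.map (fun x : ℝ => (x + (d : ℝ)) / (N : ℝ)) := by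
    ext B hB
    rw [h.apply_eq B hB]
    simp [Measure.finsetSum_apply, Measure.map_apply (hm _) hB]
  conv_lhs => rw [hμ]
  rw [charFun_apply, integral_finsetSum_measure]
  · rw [Finset.mul_sum, Finset.sum_mul]
    refine Finset.sum_congr rfl fun d _ => ?_
    rw [integral_smul_measure, ← charFun_apply]
    have : (fun x : ℝ => (x + (d : ℝ)) / (N : ℝ)) = ((N : ℝ)⁻¹ * ·) ∘ (· + (d : ℝ)) := by
      ext x; simp [div_eq_inv_mul]
    rw [this, ← Measure.map_map (by fun_prop) (by fun_prop), charFun_map_mul,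
      charFun_map_add_const]
    simp [div_eq_inv_mul, mul_assoc, mul_comm, mul_left_comm]
  · intro d hd
    have := Measure.isProbabilityMeasure_map (μ := μ) (hm d).aemeasurable
    refine Integrable.smul_measure ?_ (by simp [Finset.ne_empty_of_mem hd])
    refine (integrable_const (1 : ℝ)).mono' (by fun_prop) (Filter.Eventually.of_forall fun x => ?_)
    exact (Complex.norm_exp_ofReal_mul_I _).le

/-- There is exactly one such measure. -/
theorem existsUnique_isSelfSimilarMeasure {N : ℕ} (hN : 2 ≤ N) {D : Finset ℤ} (hD : D.Nonempty) :
    ∃! μ : Measure ℝ, IsSelfSimilarMeasure N D μ := by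
  have hN1 : (1 : ℝ) < N := by exact_mod_cast hN
  have hN0 : (0 : ℝ) < N := by linarith
  refine existsUnique_of_exists_of_unique ?_ ?_
  · have : Nonempty D := hD.to_subtype
    let ν : Measure D := (PMF.uniformOfFintype D).toMeasure
    let P : Measure (ℕ → D) := Measure.infinitePi fun _ => ν
    let X : (ℕ → D) → ℝ := fun ω => ∑' n, ((ω n : ℤ) : ℝ) / (N : ℝ) ^ (n + 1)
    let c : D × (ℕ → D) → (ℕ → D) := fun p n => Nat.casesOn n p.1 p.2
    have hc : Measurable c := by
      refine measurable_pi_lambda _ fun n => ?_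
      cases n with
      | zero => exact measurable_fst
      | succ n => exact (measurable_pi_apply n).comp measurable_snd
    have hsum : ∀ ω : ℕ → D, Summable fun n => ((ω n : ℤ) : ℝ) / (N : ℝ) ^ (n + 1) := by
      intro ω
      obtain ⟨C, hC⟩ : ∃ C : ℝ, ∀ d : D, ‖((d : ℤ) : ℝ)‖ ≤ C := by
        obtain ⟨C, hC⟩ := (Set.finite_range fun d : D => ‖((d : ℤ) : ℝ)‖).bddAbove
        exact ⟨C, fun d => hC ⟨d, rfl⟩⟩
      have hg : Summable fun n : ℕ => C * ((N : ℝ)⁻¹) ^ (n + 1) :=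
        ((summable_nat_add_iff 1).2 (summable_geometric_of_lt_one (by positivity)
          (inv_lt_one_of_one_lt₀ hN1))).mul_left C
      refine Summable.of_norm_bounded hg fun n => ?_
      rw [norm_div, norm_pow, Real.norm_of_nonneg hN0.le, div_eq_mul_inv, inv_pow]
      exact mul_le_mul_of_nonneg_right (hC _) (by positivity)
    have hX : Measurable X := by
      refine measurable_of_tendsto_metrizable (f := fun n ω =>
        ∑ i ∈ Finset.range n, ((ω i : ℤ) : ℝ) / (N : ℝ) ^ (i + 1)) (fun n => ?_) ?_
      · refine Finset.measurable_fun_sum _ fun i _ => ?_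
        exact (measurable_of_finite (fun d : D => ((d : ℤ) : ℝ) / (N : ℝ) ^ (i + 1))).comp
          (measurable_pi_apply i)
      · exact tendsto_pi_nhds.2 fun ω => (hsum ω).hasSum.tendsto_sum_nat
    have hXc : ∀ p, X (c p) = (X p.2 + ((p.1 : ℤ) : ℝ)) / N := by
      intro p
      simp only [X]
      rw [(hsum (c p)).tsum_eq_zero_add, add_div, add_comm, ← tsum_div_const]
      simp [c, pow_succ, div_div]
    have hP : P = (ν.prod P).map c := by
      symm
      refine Measure.eq_infinitePi _ fun s t ht => ?_
      have hpre : c ⁻¹' (Set.pi s t) = (if 0 ∈ s then t 0 else Set.univ) ×ˢ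
          Set.pi ((s.filter (0 < ·)).image Nat.pred : Finset ℕ) (fun n => t (n + 1)) := by
        ext ⟨d, ω⟩
        simp only [Set.mem_preimage, Set.mem_pi, Set.mem_prod, Finset.mem_coe, Finset.mem_image,
          Finset.mem_filter]
        constructor
        · intro h
          refine ⟨?_, ?_⟩
          · split_ifs with h0
            · exact h 0 h0
            · trivial
          · rintro n ⟨m, ⟨hm, hm0⟩, rfl⟩
            obtain ⟨m, rfl⟩ := Nat.exists_eq_succ_of_ne_zero hm0.ne'
            exact h _ hm
        · rintro ⟨h1, h2⟩ n hn
          cases n with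
          | zero => rw [if_pos hn] at h1; exact h1
          | succ n => exact h2 n ⟨n + 1, ⟨hn, n.succ_pos⟩, rfl⟩
      rw [Measure.map_apply hc (MeasurableSet.pi s.countable_toSet fun i _ => ht i), hpre,
        Measure.prod_prod, Measure.infinitePi_pi _ (fun i _ => ht _), Finset.prod_image]
      · have h2 : ∏ x ∈ s.filter (0 < ·), ν (t (Nat.pred x + 1)) =
            ∏ x ∈ s.filter (0 < ·), ν (t x) := by
          refine Finset.prod_congr rfl fun x hx => ?_
          rw [← Nat.succ_eq_add_one, Nat.succ_pred_eq_of_pos (Finset.mem_filter.1 hx).2]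
        rw [h2]
        by_cases h0 : 0 ∈ s
        · have : s.filter (0 < ·) = s.erase 0 := by
            ext x; simp [Nat.pos_iff_ne_zero, and_comm]
          rw [if_pos h0, this, Finset.mul_prod_erase s (fun x => ν (t x)) h0]
        · have : s.filter (0 < ·) = s := by
            refine Finset.filter_true_of_mem fun x hx => Nat.pos_of_ne_zero ?_
            rintro rfl; exact h0 hx
          rw [if_neg h0, this, measure_univ, one_mul]
      · intro a ha b hb hab
        simp only [Finset.coe_filter, Set.mem_ofPred_eq] at ha hb
        exact Nat.pred_inj ha.2 hb.2 hab
    refine ⟨P.map X, Measure.isProbabilityMeasure_map hX.aemeasurable, fun B hB => ?_⟩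
    have hm : ∀ d : ℤ, Measurable (fun x : ℝ => (x + (d : ℝ)) / (N : ℝ)) := fun d => by fun_prop
    conv_lhs => rw [hP]
    rw [Measure.map_apply hX hB, Measure.map_apply hc (hX hB),
      Measure.prod_apply (hc (hX hB)), lintegral_fintype, ← Finset.sum_coe_sort D]
    refine Finset.sum_congr rfl fun d _ => ?_
    rw [Measure.map_apply hX (hm d hB), mul_comm]
    congr 1
    · simp [ν]
    · congr 1
      ext ω
      simp [hXc]
  · intro μ₁ μ₂ h₁ h₂
    have := h₁.isProbabilityMeasure
    have := h₂.isProbabilityMeasure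
    refine Measure.ext_of_charFun (funext fun t => ?_)
    have hstep : ∀ s : ℝ, ‖charFun μ₁ s - charFun μ₂ s‖ ≤
        ‖charFun μ₁ (s / N) - charFun μ₂ (s / N)‖ := by
      intro s
      rw [h₁.charFun_eq s, h₂.charFun_eq s, ← mul_sub, norm_mul]
      refine mul_le_of_le_one_left (norm_nonneg _) ?_
      rw [norm_mul, norm_inv, Complex.norm_natCast]
      have hcard : (0 : ℝ) < D.card := by exact_mod_cast hD.card_pos
      rw [inv_mul_le_iff₀ hcard, mul_one]
      refine (norm_sum_le _ _).trans ?_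
      simp [Complex.norm_exp_ofReal_mul_I, -Complex.ofReal_mul]
    have hiter : ∀ n : ℕ, ‖charFun μ₁ t - charFun μ₂ t‖ ≤
        ‖charFun μ₁ (t / (N : ℝ) ^ n) - charFun μ₂ (t / (N : ℝ) ^ n)‖ := by
      intro n
      induction n with
      | zero => simp
      | succ n ih =>
        refine ih.trans ((hstep _).trans_eq ?_)
        rw [div_div, ← pow_succ]
    have hcont : ∀ μ : Measure ℝ, IsProbabilityMeasure μ → Continuous (charFun μ) := by
      intro μ _
      exact continuous_charFun
    have hlim : Filter.Tendsto (fun n : ℕ => t / (N : ℝ) ^ n) Filter.atTop (nhds 0) :=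
      Filter.Tendsto.div_atTop tendsto_const_nhds (tendsto_pow_atTop_atTop_of_one_lt hN1)
    have hl : Filter.Tendsto (fun n : ℕ =>
        ‖charFun μ₁ (t / (N : ℝ) ^ n) - charFun μ₂ (t / (N : ℝ) ^ n)‖) Filter.atTop (nhds 0) := by
      have h := ((((hcont μ₁ ‹_›).sub (hcont μ₂ ‹_›)).norm.tendsto 0).comp hlim)
      simpa [Function.comp_def] using h
    exact sub_eq_zero.1 (norm_le_zero_iff.1 (ge_of_tendsto' hl hiter))

/-! Let χ be the Fourier transform of μ and m that of the uniform measure on the digits, so that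
χ(t) = m(t/N) χ(t/N). The core of the proof concerns digits o(a) + N F(a, b) in only two layers, the
second depending on the first (`TwoLayer`). The frequencies α(a), β(b) are orthogonal on each layer
and on the superposition of the layers.

Reduction to two layers. Let s_j = ℓ_1 + ⋯ + ℓ_j and unroll the self-similarity r > s_k times. A
digit in base N^r is then a sum of r columns, and the stage-j digit of column p sits at position p +
s_j < 2r. Positions below r form the first layer, the others the second. A label is weighted by the
power of N dual to its position modulo r. On each level the low places occupy an initial segment of
the stages and the high places a final one, and these are the segments on which Hadamard triples are
assumed. Since the digits d_j are chosen independently, the stage at which an exponential sum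
vanishes can be taken independent of the preceding digits (`IsDigitLabelling.stageSystem`). From
this follow `StageSystem.exists_pivot` and `StageSystem.twoLayer`.

Lower bound. The transforms of the second layer over the points a form a vector `layerMask F x`.
After an affine normalisation making the digits primitive, some integer l satisfies |χ(x + l)|² ≥ c
· `meanSq (layerMask F x)`, with c > 0 independent of x (`TwoLayer.exists_lower_bound`). A failure
would propagate to descendants; as it can occur at only finitely many points modulo 1, each failing
point has a single failing child, and the energy identity `TwoLayer.sum_weightedMask` then leaves no
loss of energy. This contradicts primitivity.

Spectrum. A tree of frequencies is built with integer shifts supplied by the lower bound;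
orthogonality does not depend on the shifts. The n-th generation satisfies a lower frame bound,
uniform in n, on functions of the first n digits (`TwoLayer.exists_frequencies`). A function f
orthogonal to all frequencies therefore stays at distance at least a fixed multiple of ‖f‖ from such
functions (`norm_le_of_frame`). Since f is approximated by them (`exists_digit_approx`), f = 0. -/

/-! ### Characters and Parseval's identity for square systems. -/

/-- The character `t ↦ exp (2 π i t)`. -/
noncomputable def cis (t : ℝ) : ℂ := Complex.exp ((2 * Real.pi * t : ℝ) * Complex.I)

theorem cis_add (s t : ℝ) : cis (s + t) = cis s * cis t := by
  simp only [cis, ← Complex.exp_add]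
  congr 1; push_cast; ring

theorem cis_zero : cis 0 = 1 := by simp [cis]

theorem cis_sum {ι : Type} (S : Finset ι) (f : ι → ℝ) :
    cis (∑ i ∈ S, f i) = ∏ i ∈ S, cis (f i) := by
  classical
  induction S using Finset.induction_on with
  | empty => simp [cis]
  | insert i S hi ih => rw [Finset.sum_insert hi, Finset.prod_insert hi, cis_add, ih]

theorem norm_cis (t : ℝ) : ‖cis t‖ = 1 := Complex.norm_exp_ofReal_mul_I _

theorem cis_ne_zero (t : ℝ) : cis t ≠ 0 := Complex.exp_ne_zero _

theorem conj_cis (t : ℝ) : (starRingEnd ℂ) (cis t) = cis (-t) := by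
  simp only [cis, ← Complex.exp_conj, map_mul, Complex.conj_ofReal, Complex.conj_I]
  congr 1; push_cast; ring

theorem cis_mul_cis_neg (t : ℝ) : cis t * cis (-t) = 1 := by
  rw [← cis_add, add_neg_cancel, cis_zero]

theorem cis_sub (s t : ℝ) : cis (s - t) = cis s * (starRingEnd ℂ) (cis t) := by
  rw [conj_cis, ← cis_add, sub_eq_add_neg]

theorem cis_intCast (n : ℤ) : cis n = 1 := by
  simp only [cis]
  rw [Complex.exp_eq_one_iff]
  exact ⟨n, by push_cast; ring⟩

theorem cis_eq_one_iff (t : ℝ) : cis t = 1 ↔ ∃ n : ℤ, t = n := by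
  constructor
  · intro h
    simp only [cis, Complex.exp_eq_one_iff] at h
    obtain ⟨n, hn⟩ := h
    refine ⟨n, ?_⟩
    have h1 : ((2 * Real.pi : ℝ) : ℂ) * Complex.I * ((t : ℂ) - n) = 0 := by
      push_cast at hn ⊢; linear_combination hn
    have h2 : (t : ℂ) - n = 0 := by
      rcases mul_eq_zero.1 h1 with h | h
      · exact absurd h (mul_ne_zero (by exact_mod_cast Real.two_pi_pos.ne') Complex.I_ne_zero)
      · exact h
    exact_mod_cast sub_eq_zero.1 h2
  · rintro ⟨n, rfl⟩; exact cis_intCast n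

theorem cis_add_intCast (t : ℝ) (n : ℤ) : cis (t + n) = cis t := by
  rw [cis_add, cis_intCast, mul_one]

theorem cis_nat_mul (n : ℕ) (t : ℝ) : cis (n * t) = cis t ^ n := by
  simp only [cis, ← Complex.exp_nat_mul]
  congr 1; push_cast; ring

@[fun_prop]
theorem continuous_cis : Continuous cis := by unfold cis; fun_prop

/-- A square system of unimodular vectors with orthogonal columns satisfies Parseval's identity. -/
theorem sum_norm_sq_of_orthogonal {ι κ : Type*} [Fintype ι] [Fintype κ]
    (hcard : Fintype.card ι = Fintype.card κ) (U : ι → κ → ℂ) (hn : ∀ i k, ‖U i k‖ = 1)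
    (hU : ∀ k k', k ≠ k' → ∑ i, U i k * (starRingEnd ℂ) (U i k') = 0) (u : ι → ℂ) :
    ∑ k, ‖∑ i, u i * U i k‖ ^ 2 = Fintype.card ι * ∑ i, ‖u i‖ ^ 2 := by
  classical
  rcases isEmpty_or_nonempty ι with hι | hι
  · simp
  have hc : (Fintype.card ι : ℂ) ≠ 0 := by exact_mod_cast Fintype.card_ne_zero
  let M : Matrix ι κ ℂ := Matrix.of fun i k => U i k
  have h1 : Mᵀ * ((Fintype.card ι : ℂ)⁻¹ • M.map (starRingEnd ℂ)) = 1 := by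
    ext k k'
    rw [Matrix.mul_smul, Matrix.smul_apply, Matrix.mul_apply, Matrix.one_apply]
    split_ifs with h
    · subst h
      have : ∀ i, U i k * (starRingEnd ℂ) (U i k) = 1 := fun i => by
        rw [Complex.mul_conj, Complex.normSq_eq_norm_sq, hn]; simp
      simp [M, this, hc]
    · simp [M, hU k k' h]
  -- Squareness turns orthogonality of the columns into orthogonality of the rows.
  have h2 := (Matrix.mul_eq_one_comm_of_card_eq _ _ _ hcard.symm).1 h1
  have h3 : ∀ i i', ∑ k, (starRingEnd ℂ) (U i k) * U i' k =
      if i = i' then (Fintype.card ι : ℂ) else 0 := by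
    intro i i'
    have := congrFun (congrFun h2 i) i'
    rw [Matrix.smul_mul, Matrix.smul_apply, Matrix.mul_apply, Matrix.one_apply] at this
    simp only [M, Matrix.map_apply, Matrix.of_apply, Matrix.transpose_apply, smul_eq_mul] at this
    rw [inv_mul_eq_iff_eq_mul₀ hc] at this
    rw [this]; split_ifs <;> simp
  have h4 : ((∑ k, ‖∑ i, u i * U i k‖ ^ 2 : ℝ) : ℂ) =
      ((Fintype.card ι * ∑ i, ‖u i‖ ^ 2 : ℝ) : ℂ) := by
    push_cast
    have : ∀ k, ((‖∑ i, u i * U i k‖ : ℝ) : ℂ) ^ 2 =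
        ∑ i, ∑ i', (starRingEnd ℂ) (u i) * u i' * ((starRingEnd ℂ) (U i k) * U i' k) := by
      intro k
      rw [← Complex.conj_mul', map_sum, Finset.sum_mul_sum]
      refine Finset.sum_congr rfl fun i _ => Finset.sum_congr rfl fun i' _ => ?_
      rw [map_mul]; ring
    simp_rw [this]
    rw [Finset.sum_comm, Finset.mul_sum]
    refine Finset.sum_congr rfl fun i _ => ?_
    rw [Finset.sum_comm]
    simp_rw [← Finset.mul_sum, h3]
    simp only [mul_ite, mul_zero, Finset.sum_ite_eq, Finset.mem_univ, if_true]
    rw [Complex.conj_mul', mul_comm]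
  exact_mod_cast h4

theorem norm_sum_sq_le_card_mul {ι : Type*} [Fintype ι] (u z : ι → ℂ) (hz : ∀ i, ‖z i‖ = 1) :
    ‖∑ i, u i * z i‖ ^ 2 ≤ Fintype.card ι * ∑ i, ‖u i‖ ^ 2 := by
  have h1 : ‖∑ i, u i * z i‖ ≤ ∑ i, ‖u i‖ := by
    refine (norm_sum_le _ _).trans (Finset.sum_le_sum fun i _ => ?_)
    rw [norm_mul, hz, mul_one]
  calc _ ≤ (∑ i, ‖u i‖) ^ 2 := by gcongr
    _ ≤ _ := by simpa using sq_sum_le_card_mul_sum_sq (s := Finset.univ) (f := fun i => ‖u i‖)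

/-- If the average of unimodular numbers is unimodular, they all agree. -/
theorem eq_of_norm_sum_eq_card {ι : Type*} [Fintype ι] [Nonempty ι] (z : ι → ℂ)
    (hz : ∀ i, ‖z i‖ = 1) (h : ‖∑ i, z i‖ = Fintype.card ι) (i j : ι) : z i = z j := by
  set n : ℝ := (Fintype.card ι : ℝ) with hn
  have hn0 : 0 < n := by rw [hn]; exact_mod_cast Fintype.card_pos
  set S := ∑ i, z i with hS
  have hn' : (n : ℂ) ≠ 0 := by exact_mod_cast hn0.ne'
  -- The variance of the z i is 1 - |S/n|², which is zero here.
  have key : ∑ i, ‖z i - S / n‖ ^ 2 = 0 := by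
    have : ((∑ i, ‖z i - S / n‖ ^ 2 : ℝ) : ℂ) = 0 := by
      push_cast
      have : ∀ i, ((‖z i - S / n‖ : ℝ) : ℂ) ^ 2 =
          2 - (starRingEnd ℂ) S / n * z i - (S / n) * (starRingEnd ℂ) (z i) := by
        intro i
        rw [← Complex.conj_mul']
        have h1 : (starRingEnd ℂ) (z i) * z i = 1 := by rw [Complex.conj_mul', hz]; simp
        have h2 : (starRingEnd ℂ) S * S = n ^ 2 := by rw [Complex.conj_mul', h]
        simp only [map_sub, map_div₀, Complex.conj_ofReal]
        have h3 : (starRingEnd ℂ) S / n * (S / n) = 1 := by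
          rw [div_mul_div_comm, h2]; field_simp
        linear_combination h1 + h3
      simp_rw [this]
      rw [Finset.sum_sub_distrib, Finset.sum_sub_distrib, ← Finset.mul_sum, ← Finset.mul_sum,
        ← map_sum, ← hS]
      have h2 : (starRingEnd ℂ) S * S = n ^ 2 := by rw [Complex.conj_mul', h]
      simp only [Finset.sum_const, Finset.card_univ, nsmul_eq_mul]
      have : ((Fintype.card ι : ℕ) : ℂ) = (n : ℂ) := by rw [hn]; simp
      rw [this]
      have e1 : (starRingEnd ℂ) S / n * S = n := by
        rw [div_mul_eq_mul_div, h2]; field_simp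
      have e2 : S / n * (starRingEnd ℂ) S = n := by
        rw [div_mul_eq_mul_div, mul_comm S, h2]; field_simp
      rw [e1, e2]; ring
    exact_mod_cast this
  have h0 : ∀ i, z i = S / n := fun i => by
    have := (Finset.sum_eq_zero_iff_of_nonneg (fun i _ => sq_nonneg _)).1 key i (Finset.mem_univ i)
    exact sub_eq_zero.1 (norm_eq_zero.1 (pow_eq_zero_iff two_ne_zero |>.1 this))
  rw [h0 i, h0 j]

/-! ### Two-layer digit systems and their energy identities. -/

section TwoLayer

variable {A B : Type*} [Fintype A] [Fintype B]

/-- Digits `o a + N F a b` in two layers, and frequencies `α a`, `β b`, such that the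
exponentials of the frequencies are orthogonal on each layer and on the superposition of the
layers. -/
structure TwoLayer (N : ℕ) (o : A → ℤ) (F : A → B → ℤ) (α : A → ℤ) (β : B → ℤ) : Prop where
  orth_fst : ∀ a a', a ≠ a' → ∑ x, cis (((α a - α a' : ℤ) : ℝ) / N * o x) = 0
  orth_snd : ∀ b b', b ≠ b' → ∀ x, ∑ y, cis (((β b - β b' : ℤ) : ℝ) / N * F x y) = 0
  orth : ∀ p p' : A × B, p ≠ p' →
    ∑ x, cis (((α p.1 + β p.2 - (α p'.1 + β p'.2) : ℤ) : ℝ) / N * o x) = 0 ∨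
    ∀ x, ∑ y, cis (((α p.1 + β p.2 - (α p'.1 + β p'.2) : ℤ) : ℝ) / N * F x y) = 0

/-- The Fourier transform of the uniform measure on the second layer over `a`. -/
noncomputable def layerMask {A B : Type*} [Fintype B] (F : A → B → ℤ) (x : ℝ) (a : A) : ℂ :=
  (Fintype.card B : ℂ)⁻¹ * ∑ b, cis (x * F a b)

/-- The Fourier transform of the density `u` on the first layer. -/
noncomputable def weightedMask {A : Type*} [Fintype A] (o : A → ℤ) (u : A → ℂ) (y : ℝ) : ℂ :=
  (Fintype.card A : ℂ)⁻¹ * ∑ a, u a * cis (y * o a)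

/-- The normalised square norm. -/
noncomputable def meanSq {A : Type*} [Fintype A] (u : A → ℂ) : ℝ := (Fintype.card A : ℝ)⁻¹ * ∑ a, ‖u a‖ ^ 2

/-- The Fourier transform of the uniform measure on the digits. -/
noncomputable def digitMask (N : ℕ) (o : A → ℤ) (F : A → B → ℤ) (t : ℝ) : ℂ :=
  weightedMask o (layerMask F (N * t)) t

theorem weightedMask_add_int {A : Type*} [Fintype A] (o : A → ℤ) (u : A → ℂ) (y : ℝ) (z : ℤ) :
    weightedMask o u (y + z) = weightedMask o u y := by
  unfold weightedMask
  congr 1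
  refine Finset.sum_congr rfl fun a _ => ?_
  rw [add_mul, ← Int.cast_mul, cis_add_intCast]

theorem layerMask_add_int {A B : Type*} [Fintype B] (F : A → B → ℤ) (x : ℝ) (z : ℤ) :
    layerMask F (x + z) = layerMask F x := by
  ext a
  unfold layerMask
  congr 1
  refine Finset.sum_congr rfl fun b _ => ?_
  rw [add_mul, ← Int.cast_mul, cis_add_intCast]

theorem digitMask_add_int (N : ℕ) (o : A → ℤ) (F : A → B → ℤ) (t : ℝ) (z : ℤ) :
    digitMask N o F (t + z) = digitMask N o F t := by
  unfold digitMask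
  rw [weightedMask_add_int, mul_add]
  have := layerMask_add_int F (N * t) (N * z)
  push_cast at this
  rw [this]

theorem norm_weightedMask_sq_le {A : Type*} [Fintype A] (o : A → ℤ) (u : A → ℂ) (y : ℝ) :
    ‖weightedMask o u y‖ ^ 2 ≤ meanSq u := by
  unfold weightedMask meanSq
  rcases isEmpty_or_nonempty A with hA | hA
  · simp
  have h := norm_sum_sq_le_card_mul u (fun a => cis (y * o a)) fun a => norm_cis _
  have hc : (0 : ℝ) < Fintype.card A := by exact_mod_cast Fintype.card_pos
  rw [norm_mul, mul_pow, norm_inv, Complex.norm_natCast]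
  calc _ ≤ ((Fintype.card A : ℝ)⁻¹) ^ 2 * (Fintype.card A * ∑ i, ‖u i‖ ^ 2) := by gcongr
    _ = _ := by field_simp

theorem norm_layerMask_le {A B : Type*} [Fintype B] (F : A → B → ℤ) (x : ℝ) (a : A) : ‖layerMask F x a‖ ≤ 1 := by
  unfold layerMask
  rcases isEmpty_or_nonempty B with hB | hB
  · simp
  have hc : (0 : ℝ) < Fintype.card B := by exact_mod_cast Fintype.card_pos
  rw [norm_mul, norm_inv, Complex.norm_natCast, inv_mul_le_iff₀ hc, mul_one]
  refine (norm_sum_le _ _).trans ?_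
  simp [norm_cis]

theorem meanSq_nonneg {A : Type*} [Fintype A] (u : A → ℂ) : 0 ≤ meanSq u := by
  unfold meanSq; positivity

theorem meanSq_layerMask_le (F : A → B → ℤ) (x : ℝ) : meanSq (layerMask F x) ≤ 1 := by
  unfold meanSq
  rcases isEmpty_or_nonempty A with hA | hA
  · simp
  have hc : (0 : ℝ) < Fintype.card A := by exact_mod_cast Fintype.card_pos
  rw [inv_mul_le_iff₀ hc, mul_one]
  calc ∑ a, ‖layerMask F x a‖ ^ 2 ≤ ∑ a : A, (1 : ℝ) :=
        Finset.sum_le_sum fun a _ => pow_le_one₀ (norm_nonneg _) (norm_layerMask_le F x a)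
    _ = _ := by simp

theorem meanSq_eq_zero_iff {A : Type*} [Fintype A] (u : A → ℂ) : meanSq u = 0 ↔ u = 0 := by
  unfold meanSq
  rcases isEmpty_or_nonempty A with hA | hA
  · simp [Subsingleton.elim u 0]
  rw [mul_eq_zero, or_iff_right (by simp), Finset.sum_eq_zero_iff_of_nonneg fun _ _ => sq_nonneg _]
  simp [funext_iff]

theorem digitMask_eq (N : ℕ) (o : A → ℤ) (F : A → B → ℤ) (t : ℝ) :
    digitMask N o F t = (Fintype.card (A × B) : ℂ)⁻¹ *
      ∑ p : A × B, cis (t * (o p.1 + N * F p.1 p.2 : ℤ)) := by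
  unfold digitMask weightedMask layerMask
  rw [Fintype.sum_prod_type, Fintype.card_prod, Finset.mul_sum, Finset.mul_sum]
  refine Finset.sum_congr rfl fun a _ => ?_
  rw [Nat.cast_mul, mul_inv, Finset.mul_sum, Finset.mul_sum, Finset.sum_mul, Finset.mul_sum]
  refine Finset.sum_congr rfl fun b _ => ?_
  have : cis (t * (o a + N * F a b : ℤ)) = cis (N * t * F a b) * cis (t * o a) := by
    rw [← cis_add]; congr 1; push_cast; ring
  rw [this]; ring

theorem digitMask_eq_zero_of_layerMask (N : ℕ) (o : A → ℤ) (F : A → B → ℤ) (t : ℝ)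
    (h : layerMask F (N * t) = 0) : digitMask N o F t = 0 := by
  simp [digitMask, h, weightedMask]

namespace TwoLayer

variable {N : ℕ} {o : A → ℤ} {F : A → B → ℤ} {α : A → ℤ} {β : B → ℤ}

/-- By `orth_fst` the translates by α form a square orthogonal system on the first layer, so this is
Parseval. -/
theorem sum_weightedMask_fst (h : TwoLayer N o F α β) (u : A → ℂ) (x : ℝ) :
    ∑ a, ‖weightedMask o u ((x + α a) / N)‖ ^ 2 = meanSq u := by
  have key := sum_norm_sq_of_orthogonal (ι := A) (κ := A) rfl
    (fun i k => cis ((x + α k) / N * o i)) (fun _ _ => norm_cis _) (fun k k' hk => by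
      rw [← h.orth_fst k k' hk]
      refine Finset.sum_congr rfl fun i _ => ?_
      rw [← cis_sub]; congr 1; push_cast; ring) u
  unfold weightedMask meanSq
  simp_rw [norm_mul, mul_pow, ← Finset.mul_sum]
  rw [key, norm_inv, Complex.norm_natCast]
  rcases isEmpty_or_nonempty A with hA | hA
  · simp
  have hc : (0 : ℝ) < Fintype.card A := by exact_mod_cast Fintype.card_pos
  field_simp

/-- Fix a' and superpose the layers as o a + F a' b, without the factor N. By `orth` the frequencies
α + β are orthogonal on these points, and the transform of the density u(a) there is a product of a
weighted mask and one entry of the layer mask. Parseval for each a', averaged over a', gives the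
identity. -/
theorem sum_weightedMask (h : TwoLayer N o F α β) [Nonempty B] (u : A → ℂ) (x : ℝ) :
    ∑ p : A × B, ‖weightedMask o u ((x + (α p.1 + β p.2 : ℤ)) / N)‖ ^ 2 *
      meanSq (layerMask F ((x + (α p.1 + β p.2 : ℤ)) / N)) = meanSq u := by
  rcases isEmpty_or_nonempty A with hA | hA
  · simp [meanSq]
  have hA : (0 : ℝ) < Fintype.card A := by exact_mod_cast Fintype.card_pos
  have hB : (0 : ℝ) < Fintype.card B := by exact_mod_cast Fintype.card_pos
  have key : ∀ a', ∑ p : A × B, ‖weightedMask o u ((x + (α p.1 + β p.2 : ℤ)) / N)‖ ^ 2 *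
      ‖layerMask F ((x + (α p.1 + β p.2 : ℤ)) / N) a'‖ ^ 2 = meanSq u := by
    intro a'
    have key := sum_norm_sq_of_orthogonal (ι := A × B) (κ := A × B) rfl
      (fun i k => cis ((x + (α k.1 + β k.2 : ℤ)) / N * (o i.1 + F a' i.2)))
      (fun _ _ => norm_cis _) (fun k k' hk => by
        have : ∀ i : A × B, cis ((x + (α k.1 + β k.2 : ℤ)) / N * (o i.1 + F a' i.2)) *
            (starRingEnd ℂ) (cis ((x + (α k'.1 + β k'.2 : ℤ)) / N * (o i.1 + F a' i.2))) =
            cis (((α k.1 + β k.2 - (α k'.1 + β k'.2) : ℤ) : ℝ) / N * o i.1) *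
            cis (((α k.1 + β k.2 - (α k'.1 + β k'.2) : ℤ) : ℝ) / N * F a' i.2) := fun i => by
          rw [← cis_sub, ← cis_add]; congr 1; push_cast; ring
        simp_rw [this]
        rw [Fintype.sum_prod_type]
        simp_rw [← Finset.mul_sum, ← Finset.sum_mul]
        rcases h.orth k k' hk with h1 | h1
        · rw [h1, zero_mul]
        · rw [h1 a', mul_zero]) (fun i => u i.1)
    have e : ∀ p : A × B, ‖weightedMask o u ((x + (α p.1 + β p.2 : ℤ)) / N)‖ ^ 2 *
        ‖layerMask F ((x + (α p.1 + β p.2 : ℤ)) / N) a'‖ ^ 2 =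
        ((Fintype.card A : ℝ)⁻¹ * (Fintype.card B : ℝ)⁻¹) ^ 2 *
        ‖∑ i : A × B, u i.1 * cis ((x + (α p.1 + β p.2 : ℤ)) / N * (o i.1 + F a' i.2))‖ ^ 2 := by
      intro p
      rw [← mul_pow, ← mul_pow, ← norm_mul]
      unfold weightedMask layerMask
      have : ∑ i : A × B, u i.1 * cis ((x + (α p.1 + β p.2 : ℤ)) / N * (o i.1 + F a' i.2)) =
          (∑ a, u a * cis ((x + (α p.1 + β p.2 : ℤ)) / N * o a)) *
          ∑ b, cis ((x + (α p.1 + β p.2 : ℤ)) / N * F a' b) := by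
        rw [Fintype.sum_prod_type, Finset.sum_mul_sum]
        refine Finset.sum_congr rfl fun a _ => Finset.sum_congr rfl fun b _ => ?_
        rw [mul_add, cis_add, mul_assoc]
      rw [this]
      simp only [norm_mul, norm_inv, Complex.norm_natCast]
      ring
    simp_rw [e]
    rw [← Finset.mul_sum, key, Fintype.sum_prod_type, Fintype.card_prod]
    simp only [Finset.sum_const, Finset.card_univ, nsmul_eq_mul, meanSq, ← Finset.mul_sum]
    push_cast
    field_simp
  have : ∀ p : A × B, ‖weightedMask o u ((x + (α p.1 + β p.2 : ℤ)) / N)‖ ^ 2 *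
      meanSq (layerMask F ((x + (α p.1 + β p.2 : ℤ)) / N)) = (Fintype.card A : ℝ)⁻¹ *
      ∑ a', ‖weightedMask o u ((x + (α p.1 + β p.2 : ℤ)) / N)‖ ^ 2 *
      ‖layerMask F ((x + (α p.1 + β p.2 : ℤ)) / N) a'‖ ^ 2 := by
    intro p
    rw [← Finset.mul_sum]
    conv_lhs => rw [meanSq]
    ring
  simp_rw [this]
  rw [← Finset.mul_sum, Finset.sum_comm]
  simp_rw [key]
  simp only [Finset.sum_const, Finset.card_univ, nsmul_eq_mul]
  field_simp

/-- If the two points agreed modulo 1, every phase in `orth` would equal 1, and neither sum could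
vanish. -/
theorem cis_ne_cis (h : TwoLayer N o F α β) [Nonempty A] [Nonempty B] (x : ℝ) {p p' : A × B}
    (hp : p ≠ p') :
    cis ((x + (α p.1 + β p.2 : ℤ)) / N) ≠ cis ((x + (α p'.1 + β p'.2 : ℤ)) / N) := by
  intro he
  have h1 : cis (((α p.1 + β p.2 - (α p'.1 + β p'.2) : ℤ) : ℝ) / N) = 1 := by
    have : (((α p.1 + β p.2 - (α p'.1 + β p'.2) : ℤ) : ℝ) / N) =
      (x + (α p.1 + β p.2 : ℤ)) / N - (x + (α p'.1 + β p'.2 : ℤ)) / N := by push_cast; ring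
    rw [this, cis_sub, he, conj_cis, cis_mul_cis_neg]
  obtain ⟨n, hn⟩ := (cis_eq_one_iff _).1 h1
  have h2 : ∀ z : ℤ, cis (((α p.1 + β p.2 - (α p'.1 + β p'.2) : ℤ) : ℝ) / N * z) = 1 := by
    intro z; rw [hn, ← Int.cast_mul, cis_intCast]
  rcases h.orth p p' hp with h3 | h3
  · simp_rw [h2] at h3
    simp at h3
  · have := h3 (Classical.arbitrary A)
    simp_rw [h2] at this
    simp at this

end TwoLayer

end TwoLayer

/-! ### Nonvanishing of χ along integer translates. -/

section Nonvanishing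

variable {A B : Type*} [Fintype A] [Fintype B] {N : ℕ} {o : A → ℤ} {F : A → B → ℤ}

theorem exists_digitMask_eq_zero {χ : ℝ → ℂ}
    (hχ : ∀ t, χ t = digitMask N o F (t / N) * χ (t / N)) {t : ℝ} (ht : χ t = 0) (n : ℕ)
    (hn : χ (t / N ^ n) ≠ 0) : ∃ i < n, digitMask N o F (t / N ^ (i + 1)) = 0 := by
  induction n with
  | zero => simp at hn; exact absurd ht hn
  | succ n ih =>
    by_cases h : χ (t / N ^ n) = 0
    · rw [hχ, div_div, ← pow_succ] at h
      exact ⟨n, n.lt_succ_self, (mul_eq_zero.1 h).resolve_right hn⟩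
    · obtain ⟨i, hi, h⟩ := ih h
      exact ⟨i, hi.trans n.lt_succ_self, h⟩

/-- Up to a unimodular factor and a constant, the mask is a polynomial in ζ = `cis t`; it is nonzero
because its value at 1 is the number of digits. -/
theorem finite_digitMask_zeros [Nonempty A] [Nonempty B] (N : ℕ) (o : A → ℤ) (F : A → B → ℤ) :
    {ζ : ℂ | ∃ t, ζ = cis t ∧ digitMask N o F t = 0}.Finite := by
  classical
  let d : A × B → ℤ := fun p => o p.1 + N * F p.1 p.2
  let K : ℤ := ∑ p, |d p|
  have hK : ∀ p, 0 ≤ d p + K := fun p => by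
    have : |d p| ≤ K := Finset.single_le_sum (f := fun p => |d p|) (fun _ _ => abs_nonneg _)
      (Finset.mem_univ p)
    have := neg_abs_le (d p)
    omega
  let P : Polynomial ℂ := ∑ p, Polynomial.X ^ (d p + K).toNat
  have hP : P ≠ 0 := by
    intro h
    have := congrArg (Polynomial.eval 1) h
    simp [P, Polynomial.eval_finsetSum] at this
  refine (P.roots.toFinset.finite_toSet).subset ?_
  rintro _ ⟨t, rfl, ht⟩
  rw [Finset.mem_coe, Multiset.mem_toFinset, Polynomial.mem_roots hP, Polynomial.IsRoot]
  rw [digitMask_eq, mul_eq_zero, or_iff_right (by simp)] at ht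
  have : ∀ p, cis t ^ (d p + K).toNat = cis (t * K) * cis (t * (o p.1 + N * F p.1 p.2 : ℤ)) := by
    intro p
    rw [← cis_nat_mul, ← cis_add]
    congr 1
    have : (((d p + K).toNat : ℤ) : ℝ) = d p + K := by rw [Int.toNat_of_nonneg (hK p)]; push_cast; rfl
    rw [Int.cast_natCast] at this
    rw [this]; simp only [d]; ring
  simp only [P, Polynomial.eval_finsetSum, Polynomial.eval_pow, Polynomial.eval_X]
  simp_rw [this]
  rw [← Finset.mul_sum, ht, mul_zero]

/-- Vanishing on y + ℤ implies vanishing at the fractional part of y. As χ ≠ 0 near 0, one of a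
bounded number of mask factors vanishes there, and each mask has finitely many zeros modulo 1. -/
theorem finite_periodic_zeros [Nonempty A] [Nonempty B] (hN : 2 ≤ N) {χ : ℝ → ℂ}
    (hc : Continuous χ) (h0 : χ 0 = 1) (hχ : ∀ t, χ t = digitMask N o F (t / N) * χ (t / N)) :
    {ζ : ℂ | ∃ y, ζ = cis y ∧ ∀ z : ℤ, χ (y + z) = 0}.Finite := by
  have hN1 : (1 : ℝ) < N := by exact_mod_cast hN
  have hN0 : (0 : ℝ) < N := by linarith
  obtain ⟨δ, hδ, hδ'⟩ := Metric.eventually_nhds_iff.1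
    (hc.continuousAt.eventually_ne (show χ 0 ≠ 0 by rw [h0]; exact one_ne_zero))
  obtain ⟨n, hn⟩ := exists_pow_lt_of_lt_one hδ (inv_lt_one_of_one_lt₀ hN1)
  refine (Set.Finite.biUnion (Finset.range n).finite_toSet fun i _ =>
    (finite_digitMask_zeros N o F).image (· ^ N ^ (i + 1))).subset ?_
  rintro _ ⟨y, rfl, hy⟩
  have hy' : χ (Int.fract y) = 0 := by
    have := hy (-⌊y⌋)
    rwa [Int.cast_neg, ← sub_eq_add_neg] at this
  have hlt : χ (Int.fract y / N ^ n) ≠ 0 := by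
    apply hδ'
    rw [Real.dist_eq, sub_zero, abs_of_nonneg (div_nonneg (Int.fract_nonneg y) (by positivity))]
    calc Int.fract y / N ^ n ≤ 1 / N ^ n := by gcongr; exact (Int.fract_lt_one y).le
      _ = (N : ℝ)⁻¹ ^ n := by rw [one_div, inv_pow]
      _ < δ := hn
  obtain ⟨i, hi, h⟩ := exists_digitMask_eq_zero hχ hy' n hlt
  rw [Set.mem_iUnion₂]
  refine ⟨i, by simpa using hi, cis (Int.fract y / N ^ (i + 1)), ⟨_, rfl, h⟩, ?_⟩
  simp only
  rw [← cis_nat_mul]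
  have : ((N ^ (i + 1) : ℕ) : ℝ) * (Int.fract y / N ^ (i + 1)) = Int.fract y := by
    push_cast; field_simp
  rw [this]
  conv_rhs => rw [← Int.fract_add_floor y, cis_add_intCast]

/-- If the two-layer digits are primitive, then no vector of weights on the first layer makes the
corresponding part of `χ` vanish along a whole coset of the integers. -/
theorem TwoLayer.exists_weightedMask_mul_ne_zero {α : A → ℤ} {β : B → ℤ}
    [Nonempty A] [Nonempty B] (h : TwoLayer N o F α β)
    (hN : 2 ≤ N) {χ : ℝ → ℂ} (hc : Continuous χ) (h0 : χ 0 = 1)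
    (hχ : ∀ t, χ t = digitMask N o F (t / N) * χ (t / N)) (b₀ : B) (hb₀ : ∀ a, F a b₀ = 0)
    (hprim : ∀ y, (∀ a b, cis (y * F a b) = 1) → (∀ a a', cis (y * o a) = cis (y * o a')) →
      ∃ z : ℤ, χ (y + z) ≠ 0) {u : A → ℂ} (hu : u ≠ 0) (x : ℝ) :
    ∃ l : ℤ, weightedMask o u ((x + l) / N) * χ ((x + l) / N) ≠ 0 := by
  classical
  have hN0 : (N : ℝ) ≠ 0 := by positivity
  have hA : (0 : ℝ) < Fintype.card A := by exact_mod_cast Fintype.card_pos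
  have hB : (0 : ℝ) < Fintype.card B := by exact_mod_cast Fintype.card_pos
  -- The counterexamples; S collects their base points modulo 1, and y x p is the p-th child of x.
  let bad : (A → ℂ) → ℝ → Prop := fun u x => u ≠ 0 ∧
    ∀ l : ℤ, weightedMask o u ((x + l) / N) * χ ((x + l) / N) = 0
  let y : ℝ → A × B → ℝ := fun x p => (x + (α p.1 + β p.2 : ℤ)) / N
  let S : Set ℂ := {ζ | ∃ x u, ζ = cis x ∧ bad u x}
  have hpow : ∀ x p, cis (y x p) ^ N = cis x := by
    intro x p
    rw [← cis_nat_mul, mul_div_cancel₀ _ hN0, cis_add_intCast]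
  have hzero : ∀ u x, bad u x → ∀ p, weightedMask o u (y x p) ≠ 0 →
      ∀ z : ℤ, χ (y x p + z) = 0 := by
    intro u x hb p hp z
    have h1 := hb.2 (α p.1 + β p.2 + N * z)
    have h2 : (x + ((α p.1 + β p.2 + N * z : ℤ) : ℝ)) / N = y x p + z := by
      simp only [y]; push_cast; field_simp; ring
    rw [h2, weightedMask_add_int] at h1
    exact (mul_eq_zero.1 h1).resolve_left hp
  -- Badness is inherited: χ vanishes on the coset of the child, and the refinement equation
  -- rewrites this with the layer mask as the new weight.
  have hnext : ∀ u x, bad u x → ∀ p, weightedMask o u (y x p) ≠ 0 →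
      layerMask F (y x p) ≠ 0 → bad (layerMask F (y x p)) (y x p) := by
    intro u x hb p hp hm
    refine ⟨hm, fun l => ?_⟩
    have h1 := hzero u x hb p hp l
    rw [hχ, digitMask, mul_div_cancel₀ _ hN0, layerMask_add_int] at h1
    exact h1
  -- Otherwise every term of the energy identity would vanish, forcing u = 0.
  have hex : ∀ u x, bad u x → ∃ p, weightedMask o u (y x p) ≠ 0 ∧ layerMask F (y x p) ≠ 0 := by
    intro u x hb
    by_contra! hcon
    have h1 := h.sum_weightedMask u x
    rw [Finset.sum_eq_zero] at h1
    · exact hb.1 ((meanSq_eq_zero_iff u).1 h1.symm)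
    · intro p _
      by_cases hp : weightedMask o u (y x p) = 0
      · simp only [y] at hp
        rw [hp, norm_zero, zero_pow two_ne_zero, zero_mul]
      · have := hcon p hp
        simp only [y] at this
        rw [this, (meanSq_eq_zero_iff _).2 rfl, mul_zero]
  have hfin : S.Finite := by
    refine ((finite_periodic_zeros hN hc h0 hχ).image (· ^ N)).subset ?_
    rintro _ ⟨x, u, rfl, hb⟩
    obtain ⟨p, hp, -⟩ := hex u x hb
    exact ⟨cis (y x p), ⟨_, rfl, hzero u x hb p hp⟩, hpow x p⟩
  -- Each point of S is the N-th power of a bad child in S; a finite set covered by its own image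
  -- under a map is mapped injectively.
  have hinj : Set.InjOn (· ^ N) S := by
    have hsub : S ⊆ (· ^ N) '' S := by
      rintro _ ⟨x, u, rfl, hb⟩
      obtain ⟨p, hp, hm⟩ := hex u x hb
      exact ⟨cis (y x p), ⟨_, _, rfl, hnext u x hb p hp hm⟩, hpow x p⟩
    have hsub' : hfin.toFinset ⊆ hfin.toFinset.image (· ^ N) := by
      intro ζ hζ
      obtain ⟨ζ', h1, h2⟩ := hsub (hfin.mem_toFinset.1 hζ)
      exact Finset.mem_image.2 ⟨ζ', hfin.mem_toFinset.2 h1, h2⟩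
    have := Finset.card_image_iff.1
      (le_antisymm Finset.card_image_le (Finset.card_le_card hsub'))
    rwa [hfin.coe_toFinset] at this
  -- Distinct bad children would be distinct points of S with the same N-th power. So the energy
  -- identity has a single nonzero term, and both of its factors must attain their upper bounds.
  have hone : ∀ u x, bad u x → ∃ p, weightedMask o u (y x p) ≠ 0 ∧ layerMask F (y x p) ≠ 0 ∧
      meanSq (layerMask F (y x p)) = 1 ∧ ‖weightedMask o u (y x p)‖ ^ 2 = meanSq u := by
    intro u x hb
    obtain ⟨p, hp, hm⟩ := hex u x hb
    have h1 := h.sum_weightedMask u x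
    rw [Finset.sum_eq_single p] at h1
    · have h2 := norm_weightedMask_sq_le o u (y x p)
      have h3 := meanSq_layerMask_le F (y x p)
      have h4 : 0 < ‖weightedMask o u (y x p)‖ ^ 2 := by positivity
      change ‖weightedMask o u (y x p)‖ ^ 2 * meanSq (layerMask F (y x p)) = meanSq u at h1
      have h5 : meanSq (layerMask F (y x p)) = 1 := by
        by_contra hne
        have := lt_of_le_of_ne h3 hne
        nlinarith
      exact ⟨p, hp, hm, h5, by rw [← h1, h5, mul_one]⟩
    · intro p' _ hne
      by_contra hcon
      have hp' : weightedMask o u (y x p') ≠ 0 := by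
        intro h0
        simp only [y] at h0
        rw [h0, norm_zero, zero_pow two_ne_zero, zero_mul] at hcon
        exact hcon rfl
      have hm' : layerMask F (y x p') ≠ 0 := by
        intro h0; simp only [y] at h0
        rw [h0, (meanSq_eq_zero_iff _).2 rfl, mul_zero] at hcon
        exact hcon rfl
      have he := hinj ⟨_, _, rfl, hnext u x hb p hp hm⟩ ⟨_, _, rfl, hnext u x hb p' hp' hm'⟩
        (by simp only [hpow])
      exact h.cis_ne_cis x hne.symm he
    · simp
  -- Modulus one over each a makes the phases agree in b; the normalisation F a b₀ = 0 makes the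
  -- common value 1.
  have hlayer : ∀ t, meanSq (layerMask F t) = 1 → (∀ a b, cis (t * F a b) = 1) := by
    intro t ht a b
    have h1 : ‖layerMask F t a‖ = 1 := by
      by_contra hne
      have hlt := lt_of_le_of_ne (norm_layerMask_le F t a) hne
      have : ∑ a, ‖layerMask F t a‖ ^ 2 < ∑ a : A, (1 : ℝ) := by
        refine Finset.sum_lt_sum (fun a _ =>
          pow_le_one₀ (norm_nonneg _) (norm_layerMask_le F t a)) ⟨a, Finset.mem_univ a, ?_⟩
        exact pow_lt_one₀ (norm_nonneg _) hlt two_ne_zero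
      rw [meanSq, inv_mul_eq_iff_eq_mul₀ hA.ne'] at ht
      simp [ht] at this
    have h2 := eq_of_norm_sum_eq_card (fun b => cis (t * F a b)) (fun _ => norm_cis _) (by
      unfold layerMask at h1
      rw [norm_mul, norm_inv, Complex.norm_natCast, inv_mul_eq_iff_eq_mul₀ hB.ne', mul_one] at h1
      exact h1) b b₀
    rw [h2, hb₀]; simp [cis_zero]
  have hconst : ∀ t, (∀ a b, cis (t * F a b) = 1) → layerMask F t = fun _ => 1 := by
    intro t ht
    ext a
    simp [layerMask, ht]
  by_contra! hcon
  -- Two generations are needed: the first makes the weight constant, so that extremality in the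
  -- second also aligns the phases of o. Primitivity then contradicts the vanishing on the coset.
  obtain ⟨p, hp, hm, hp1, -⟩ := hone u x ⟨hu, hcon⟩
  have hb1 := hnext u x ⟨hu, hcon⟩ p hp hm
  obtain ⟨p', hp', hm', hp1', hs⟩ := hone _ _ hb1
  have hz := hzero _ _ hb1 p' hp'
  rw [hconst _ (hlayer _ hp1)] at hs
  obtain ⟨z, hz'⟩ := hprim _ (hlayer _ hp1') (fun a a' => by
    refine eq_of_norm_sum_eq_card (fun a => cis (y (y x p) p' * o a)) (fun _ => norm_cis _) ?_ a a'
    have h1 : meanSq (fun _ : A => (1 : ℂ)) = 1 := by simp [meanSq]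
    rw [h1, pow_eq_one_iff_of_nonneg (norm_nonneg _) two_ne_zero] at hs
    unfold weightedMask at hs
    rw [norm_mul, norm_inv, Complex.norm_natCast, inv_mul_eq_iff_eq_mul₀ hA.ne', mul_one] at hs
    simpa using hs)
  exact hz' (hz z)

theorem meanSq_smul {A : Type*} [Fintype A] (c : ℂ) (u : A → ℂ) :
    meanSq (c • u) = ‖c‖ ^ 2 * meanSq u := by
  unfold meanSq
  simp only [Pi.smul_apply, norm_smul, mul_pow, ← Finset.mul_sum]
  ring

theorem weightedMask_smul {A : Type*} [Fintype A] (o : A → ℤ) (c : ℂ) (u : A → ℂ) (y : ℝ) :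
    weightedMask o (c • u) y = c * weightedMask o u y := by
  unfold weightedMask
  simp only [Pi.smul_apply, smul_eq_mul, mul_assoc, ← Finset.mul_sum]
  ring

theorem isCompact_meanSq_eq_one {A : Type*} [Fintype A] [Nonempty A] :
    IsCompact {u : A → ℂ | meanSq u = 1} := by
  refine Metric.isCompact_of_isClosed_isBounded
    (isClosed_eq (by unfold meanSq; fun_prop) continuous_const) ?_
  refine (Metric.isBounded_closedBall (x := (0 : A → ℂ)) (r := Fintype.card A)).subset fun u hu => ?_
  have hA : (1 : ℝ) ≤ Fintype.card A := by exact_mod_cast Fintype.card_pos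
  rw [mem_closedBall_zero_iff, pi_norm_le_iff_of_nonneg (by positivity)]
  intro a
  rw [Set.mem_ofPred_eq, meanSq, inv_mul_eq_iff_eq_mul₀ (by positivity), mul_one] at hu
  have h1 : ‖u a‖ ^ 2 ≤ Fintype.card A := by
    rw [← hu]
    exact Finset.single_le_sum (f := fun a => ‖u a‖ ^ 2) (fun _ _ => sq_nonneg _)
      (Finset.mem_univ a)
  nlinarith [norm_nonneg (u a)]

/-- Nonvanishing becomes uniform by compactness of the unit sphere of weights times [0, 1]. The
bound is then applied with the normalised layer mask as weight, and the refinement equation turns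
weighted mask times χ into χ itself. -/
theorem TwoLayer.exists_lower_bound {α : A → ℤ} {β : B → ℤ}
    [Nonempty A] [Nonempty B] (h : TwoLayer N o F α β)
    (hN : 2 ≤ N) {χ : ℝ → ℂ} (hc : Continuous χ) (h0 : χ 0 = 1)
    (hχ : ∀ t, χ t = digitMask N o F (t / N) * χ (t / N)) (b₀ : B) (hb₀ : ∀ a, F a b₀ = 0)
    (hprim : ∀ y, (∀ a b, cis (y * F a b) = 1) → (∀ a a', cis (y * o a) = cis (y * o a')) →
      ∃ z : ℤ, χ (y + z) ≠ 0) :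
    ∃ c > 0, ∀ x : ℝ, ∃ l : ℤ, c * meanSq (layerMask F x) ≤ ‖χ (x + l)‖ ^ 2 := by
  have hN0 : (N : ℝ) ≠ 0 := by positivity
  let Φ : ℤ → (A → ℂ) × ℝ → ℝ := fun l q =>
    ‖weightedMask o q.1 ((q.2 + l) / N) * χ ((q.2 + l) / N)‖ ^ 2
  have hΦ : ∀ l, Continuous (Φ l) := by
    intro l
    simp only [Φ, weightedMask]
    fun_prop
  -- An increasing open cover indexed by the size of the lower bound; one member covers the compact
  -- set.
  let U : ℕ → Set ((A → ℂ) × ℝ) := fun k => ⋃ l : ℤ, {q | 1 / ((k : ℝ) + 1) < Φ l q}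
  have hU : ∀ k, IsOpen (U k) := fun k =>
    isOpen_iUnion fun l => isOpen_lt continuous_const (hΦ l)
  have hmono : Monotone U := by
    intro k k' hk
    refine Set.iUnion_mono fun l q hq => ?_
    rw [Set.mem_ofPred_eq] at hq ⊢
    exact lt_of_le_of_lt (Nat.one_div_le_one_div hk) hq
  have hcover : ({u : A → ℂ | meanSq u = 1} ×ˢ Set.Icc (0 : ℝ) 1) ⊆ ⋃ k, U k := by
    rintro ⟨u, x⟩ ⟨hu, -⟩
    have hu0 : u ≠ 0 := by
      rintro rfl
      simp [meanSq] at hu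
    obtain ⟨l, hl⟩ := h.exists_weightedMask_mul_ne_zero hN hc h0 hχ b₀ hb₀ hprim hu0 x
    have hpos : 0 < Φ l (u, x) := by simp only [Φ]; positivity
    obtain ⟨k, hk⟩ := exists_nat_one_div_lt hpos
    exact Set.mem_iUnion.2 ⟨k, Set.mem_iUnion.2 ⟨l, hk⟩⟩
  obtain ⟨k, hk⟩ := (isCompact_meanSq_eq_one.prod isCompact_Icc).elim_directed_cover U hU hcover
    hmono.directed_le
  refine ⟨1 / ((k : ℝ) + 1), by positivity, fun x => ?_⟩
  have hper : layerMask F x = layerMask F (Int.fract x) := by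
    conv_lhs => rw [← Int.fract_add_floor x, layerMask_add_int]
  by_cases hz : meanSq (layerMask F x) = 0
  · exact ⟨0, by rw [hz, mul_zero]; positivity⟩
  have hpos : 0 < meanSq (layerMask F x) := lt_of_le_of_ne (meanSq_nonneg _) (Ne.symm hz)
  set M := meanSq (layerMask F x) with hM
  let c : ℂ := ((Real.sqrt M)⁻¹ : ℝ)
  have hcn : ‖c‖ ^ 2 = M⁻¹ := by
    simp only [c]
    rw [Complex.norm_real, Real.norm_of_nonneg (by positivity), inv_pow, Real.sq_sqrt hpos.le]
  have hu : meanSq (c • layerMask F x) = 1 := by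
    rw [meanSq_smul, hcn, ← hM, inv_mul_cancel₀ hz]
  obtain ⟨l, hl⟩ := Set.mem_iUnion.1 (hk (show (c • layerMask F x, Int.fract x) ∈ _ from
    ⟨hu, Int.fract_nonneg x, (Int.fract_lt_one x).le⟩))
  simp only [Set.mem_ofPred_eq, Φ, weightedMask_smul, mul_assoc] at hl
  rw [norm_mul, mul_pow, hcn] at hl
  refine ⟨l - ⌊x⌋, ?_⟩
  have e1 : x + ((l - ⌊x⌋ : ℤ) : ℝ) = Int.fract x + l := by
    push_cast; rw [← Int.self_sub_floor]; ring
  rw [e1, hχ, digitMask, mul_div_cancel₀ _ hN0, layerMask_add_int, ← hper]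
  rw [inv_mul_eq_div, lt_div_iff₀ hpos] at hl
  exact hl.le

end Nonvanishing

/-! ### The tree of frequencies. -/

/-- Words of length `n` over the alphabet `C`, preceded by a letter of `S`. -/
def RootedWord (S C : Type) : ℕ → Type
  | 0 => S
  | n + 1 => RootedWord S C n × C

noncomputable instance RootedWord.fintype (S C : Type) [Fintype S] [Fintype C] :
    ∀ n, Fintype (RootedWord S C n)
  | 0 => inferInstanceAs (Fintype S)
  | n + 1 =>
    haveI := RootedWord.fintype S C n
    inferInstanceAs (Fintype (RootedWord S C n × C))

theorem RootedWord.card (S C : Type) [Fintype S] [Fintype C] (n : ℕ) :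
    Fintype.card (RootedWord S C n) = Fintype.card S * Fintype.card C ^ n := by
  induction n with
  | zero =>
    rw [pow_zero, mul_one]
    exact rfl
  | succ n ih =>
    change Fintype.card (RootedWord S C n × C) = _
    rw [Fintype.card_prod, ih, pow_succ, mul_assoc]

theorem RootedWord.sum_succ {S C : Type} {M : Type*} [Fintype S] [Fintype C] [AddCommMonoid M] (n : ℕ)
    (f : RootedWord S C (n + 1) → M) :
    ∑ w, f w = ∑ w : RootedWord S C n, ∑ c : C, f (w, c) :=
  Fintype.sum_prod_type (α₁ := RootedWord S C n) (α₂ := C) f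

/-- The point `∑ d i / N ^ i` with digits given by a word. -/
noncomputable def wordPoint {S C : Type} (N : ℕ) (d : C → ℤ) : ∀ n, RootedWord S C n → ℝ
  | 0, _ => 0
  | n + 1, w => wordPoint N d n w.1 + d w.2 / (N : ℝ) ^ (n + 1)

theorem exists_wordPoint_eq {S C : Type} {N : ℕ} (hN : 2 ≤ N) (d : C → ℤ) (n : ℕ)
    (w : RootedWord S C n) : ∃ z : ℤ, (N : ℝ) ^ n * wordPoint N d n w = z := by
  have hN0 : (N : ℝ) ≠ 0 := by positivity
  induction n with
  | zero => exact ⟨0, by simp [wordPoint]⟩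
  | succ n ih =>
    obtain ⟨z, hz⟩ := ih w.1
    refine ⟨N * z + d w.2, ?_⟩
    rw [wordPoint, mul_add, pow_succ, mul_right_comm, hz]
    push_cast
    field_simp

/-- A tree of positions: every node carries a position `x` and an integer shift `f`, and its child
along `c` sits at `(x + f + v c) / N`. -/
noncomputable def treeNode {S C : Type} (N : ℕ) (v : C → ℤ) (base : S → ℝ) (r₀ : ℝ → ℤ)
    (r : C → ℝ → ℤ) : ∀ n, RootedWord S C n → ℝ × ℤ
  | 0, b => (base b, r₀ (base b))
  | n + 1, w =>
    let ν := treeNode N v base r₀ r n w.1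
    ((ν.1 + (ν.2 + v w.2 : ℤ)) / N, r w.2 ((ν.1 + (ν.2 + v w.2 : ℤ)) / N))

section Tree

variable {A B : Type} [Fintype A] [Fintype B] {N : ℕ} {o : A → ℤ} {F : A → B → ℤ}

/-- The digits of a two-layer system. -/
def layerDigit (N : ℕ) (o : A → ℤ) (F : A → B → ℤ) (p : A × B) : ℤ := o p.1 + N * F p.1 p.2

theorem sum_cis_layerDigit [Nonempty A] [Nonempty B] (N : ℕ) (o : A → ℤ) (F : A → B → ℤ) (t : ℝ) :
    ∑ p, cis (t * layerDigit N o F p) = Fintype.card (A × B) * digitMask N o F t := by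
  rw [digitMask_eq, mul_inv_cancel_left₀ (by exact_mod_cast Fintype.card_ne_zero)]
  rfl

theorem sum_cis_wordPoint [Nonempty A] [Nonempty B] (N : ℕ) (o : A → ℤ) (F : A → B → ℤ) (t : ℝ)
    (n : ℕ) : ∑ w : RootedWord Unit (A × B) n, cis (t * wordPoint N (layerDigit N o F) n w) =
      Fintype.card (A × B) ^ n * ∏ i ∈ Finset.range n, digitMask N o F (t / N ^ (i + 1)) := by
  induction n with
  | zero =>
    change ∑ w : Unit, cis (t * 0) = _
    simp [cis_zero]
  | succ n ih =>
    rw [RootedWord.sum_succ]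
    simp only [wordPoint, mul_add, cis_add]
    simp_rw [← Finset.mul_sum]
    have : ∀ p, t * (layerDigit N o F p / (N : ℝ) ^ (n + 1)) =
        t / (N : ℝ) ^ (n + 1) * layerDigit N o F p := fun p => by ring
    simp_rw [this, sum_cis_layerDigit]
    rw [← Finset.sum_mul, ih, Finset.prod_range_succ]
    ring

theorem eq_prod_digitMask_mul {χ : ℝ → ℂ} (hχ : ∀ t, χ t = digitMask N o F (t / N) * χ (t / N))
    (n : ℕ) (t : ℝ) :
    χ t = (∏ i ∈ Finset.range n, digitMask N o F (t / N ^ (i + 1))) * χ (t / N ^ n) := by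
  induction n with
  | zero => simp
  | succ n ih => rw [ih, Finset.prod_range_succ, hχ (t / N ^ n), div_div, ← pow_succ, mul_assoc]

/-- A condition on the difference `t` of two frequencies which persists under `t ↦ t + N ^ n z`
and forces orthogonality. -/
def Separated (N : ℕ) (o : A → ℤ) (F : A → B → ℤ) (n : ℕ) (t : ℝ) : Prop :=
  (∃ i < n, digitMask N o F (t / N ^ (i + 1)) = 0) ∨ layerMask F (t / N ^ n) = 0

theorem Separated.add_int (hN : 2 ≤ N) {n : ℕ} {t : ℝ} (h : Separated N o F n t) (z : ℤ) :
    Separated N o F n (t + N ^ n * z) := by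
  have hN0 : (N : ℝ) ≠ 0 := by positivity
  rcases h with ⟨i, hi, h⟩ | h
  · refine Or.inl ⟨i, hi, ?_⟩
    have : (t + N ^ n * z) / (N : ℝ) ^ (i + 1) =
        t / N ^ (i + 1) + ((N : ℤ) ^ (n - (i + 1)) * z : ℤ) := by
      obtain ⟨m, rfl⟩ : ∃ m, n = m + (i + 1) := ⟨n - (i + 1), by omega⟩
      rw [Nat.add_sub_cancel]
      push_cast
      rw [pow_add _ m]
      field_simp
    rw [this, digitMask_add_int, h]
  · refine Or.inr ?_
    rw [add_div, mul_div_cancel_left₀ _ (pow_ne_zero n hN0), layerMask_add_int, h]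

theorem Separated.exists_digitMask (hN : 2 ≤ N) {n : ℕ} {t : ℝ} (h : Separated N o F n t) :
    ∃ i < n + 1, digitMask N o F (t / N ^ (i + 1)) = 0 := by
  have hN0 : (N : ℝ) ≠ 0 := by positivity
  rcases h with ⟨i, hi, h⟩ | h
  · exact ⟨i, hi.trans n.lt_succ_self, h⟩
  · refine ⟨n, n.lt_succ_self, digitMask_eq_zero_of_layerMask _ _ _ _ ?_⟩
    have : (N : ℝ) * (t / N ^ (n + 1)) = t / N ^ n := by rw [pow_succ]; field_simp
    rw [this, h]

theorem Separated.eq_zero (hN : 2 ≤ N) {χ : ℝ → ℂ}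
    (hχ : ∀ t, χ t = digitMask N o F (t / N) * χ (t / N)) {n : ℕ} {t : ℝ}
    (h : Separated N o F n t) : χ t = 0 := by
  obtain ⟨i, hi, h⟩ := h.exists_digitMask hN
  rw [eq_prod_digitMask_mul hχ (n + 1), Finset.prod_eq_zero (Finset.mem_range.2 hi) h, zero_mul]

theorem layerMask_eq_zero {A B : Type*} [Fintype B] {F : A → B → ℤ} {t : ℝ} (h : ∀ a, ∑ b, cis (t * F a b) = 0) :
    layerMask F t = 0 := by
  ext a; simp [layerMask, h]

/-- At h/N the layer mask is evaluated at an integer, where it is constant, so only the first-layer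
sum remains. -/
theorem digitMask_eq_zero_of_fst (hN : 2 ≤ N) {h : ℤ} (ho : ∑ x, cis ((h : ℝ) / N * o x) = 0) :
    digitMask N o F (h / N) = 0 := by
  have hN0 : (N : ℝ) ≠ 0 := by positivity
  rw [digitMask, mul_div_cancel₀ _ hN0]
  have : layerMask F (h : ℝ) = layerMask F 0 := by
    have := layerMask_add_int F 0 h
    rwa [zero_add] at this
  rw [this, weightedMask]
  have hc : ∀ a, layerMask F 0 a = (Fintype.card B : ℂ)⁻¹ * Fintype.card B := by
    intro a; simp [layerMask, cis_zero]
  simp_rw [hc, ← Finset.mul_sum, ho, mul_zero]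

variable {α : A → ℤ} {β : B → ℤ}

/-- The roots are separated by the second layer alone. Siblings are separated by `orth`; for nodes
with different parents, separation is inherited, as shifts and labels change the difference by a
multiple of N ^ n. -/
theorem TwoLayer.separated_treeNode (h : TwoLayer N o F α β) (hN : 2 ≤ N) (e : ℤ) (r₀ : ℝ → ℤ)
    (r : A × B → ℝ → ℤ) (n : ℕ) (w w' : RootedWord B (A × B) n) (hw : w ≠ w') :
    Separated N o F n
      (N ^ n * (treeNode N (fun p => α p.1 + β p.2 - e) (fun b => (β b : ℝ) / N) r₀ r n w).1 -
       N ^ n * (treeNode N (fun p => α p.1 + β p.2 - e) (fun b => (β b : ℝ) / N) r₀ r n w').1) := by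
  have hN0 : (N : ℝ) ≠ 0 := by positivity
  induction n with
  | zero =>
    refine Or.inr (layerMask_eq_zero fun a => ?_)
    rw [← h.orth_snd w w' hw a]
    refine Finset.sum_congr rfl fun b _ => ?_
    simp only [treeNode]
    congr 1; push_cast; ring
  | succ n ih =>
    obtain ⟨w, p⟩ := w
    obtain ⟨w', p'⟩ := w'
    simp only [treeNode]
    set ν := treeNode N (fun p => α p.1 + β p.2 - e) (fun b => (β b : ℝ) / N) r₀ r n w with hν
    set ν' := treeNode N (fun p => α p.1 + β p.2 - e) (fun b => (β b : ℝ) / N) r₀ r n w' with hν'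
    by_cases hww : w = w'
    · have hp : p ≠ p' := by rintro rfl; exact hw (by rw [hww])
      have hνν : ν = ν' := by rw [hν, hν', hww]
      have e1 : (N : ℝ) ^ (n + 1) * ((ν.1 + (ν.2 + (α p.1 + β p.2 - e) : ℤ)) / N) -
          N ^ (n + 1) * ((ν'.1 + (ν'.2 + (α p'.1 + β p'.2 - e) : ℤ)) / N) =
          N ^ (n + 1) * (((α p.1 + β p.2 - (α p'.1 + β p'.2) : ℤ) : ℝ) / N) := by
        rw [hνν]; push_cast; ring
      rw [e1]
      rcases h.orth p p' hp with h1 | h1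
      · refine Or.inl ⟨n, n.lt_succ_self, ?_⟩
        rw [mul_div_cancel_left₀ _ (pow_ne_zero _ hN0)]
        exact digitMask_eq_zero_of_fst hN h1
      · refine Or.inr (layerMask_eq_zero ?_)
        rwa [mul_div_cancel_left₀ _ (pow_ne_zero _ hN0)]
    · refine Or.inl ?_
      have e1 : (N : ℝ) ^ (n + 1) * ((ν.1 + (ν.2 + (α p.1 + β p.2 - e) : ℤ)) / N) -
          N ^ (n + 1) * ((ν'.1 + (ν'.2 + (α p'.1 + β p'.2 - e) : ℤ)) / N) =
          (N ^ n * ν.1 - N ^ n * ν'.1) + N ^ n * ((ν.2 + (α p.1 + β p.2 - e) -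
            (ν'.2 + (α p'.1 + β p'.2 - e)) : ℤ) : ℝ) := by
        rw [pow_succ]; push_cast; field_simp; ring
      rw [e1]
      exact ((ih w w' hww).add_int hN _).exists_digitMask hN

/-- Attaching α a to each node gives as many frequencies as there are words of length n + 1, and
they are orthogonal on those words. Parseval is applied to g as a function of the first n letters;
the last letter contributes a weighted mask, and summing over a by `sum_weightedMask_fst` leaves
`meanSq` of the layer mask. -/
theorem TwoLayer.sum_treeNode (h : TwoLayer N o F α β) [Nonempty A] [Nonempty B] (hN : 2 ≤ N)
    (e : ℤ) (r₀ : ℝ → ℤ) (r : A × B → ℝ → ℤ) (n : ℕ) (g : RootedWord Unit (A × B) n → ℂ) :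
    let x : RootedWord B (A × B) n → ℝ := fun ν =>
      (treeNode N (fun p => α p.1 + β p.2 - e) (fun b => (β b : ℝ) / N) r₀ r n ν).1
    ∑ ν, ‖∑ w, g w * cis (N ^ n * x ν * wordPoint N (layerDigit N o F) n w)‖ ^ 2 *
      meanSq (layerMask F (x ν)) = Fintype.card (A × B) ^ n * ∑ w, ‖g w‖ ^ 2 := by
  intro x
  have hN0 : (N : ℝ) ≠ 0 := by positivity
  have hC : (Fintype.card (A × B) : ℝ) ≠ 0 := by exact_mod_cast Fintype.card_ne_zero
  have hcard : Fintype.card (RootedWord Unit (A × B) (n + 1)) =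
      Fintype.card (RootedWord B (A × B) n × A) := by
    rw [Fintype.card_prod, RootedWord.card, RootedWord.card, Fintype.card_prod, Fintype.card_unit]
    ring
  have key := sum_norm_sq_of_orthogonal hcard (fun w k =>
      cis (N ^ n * (x k.1 + α k.2) * wordPoint N (layerDigit N o F) (n + 1) w))
    (fun _ _ => norm_cis _) (fun k k' hk => by
      simp_rw [← cis_sub, ← sub_mul]
      rw [sum_cis_wordPoint]
      have hex : ∃ i < n + 1,
          digitMask N o F ((N ^ n * (x k.1 + α k.2) - N ^ n * (x k'.1 + α k'.2)) / N ^ (i + 1)) =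
            0 := by
        by_cases h1 : k.1 = k'.1
        · have h2 : k.2 ≠ k'.2 := fun h2 => hk (Prod.ext h1 h2)
          refine ⟨n, n.lt_succ_self, ?_⟩
          have e1 : ((N : ℝ) ^ n * (x k.1 + α k.2) - N ^ n * (x k'.1 + α k'.2)) / N ^ (n + 1) =
              ((α k.2 - α k'.2 : ℤ) : ℝ) / N := by
            rw [h1, pow_succ]; push_cast; field_simp; ring
          rw [e1]
          exact digitMask_eq_zero_of_fst hN (h.orth_fst _ _ h2)
        · have e1 : (N : ℝ) ^ n * (x k.1 + α k.2) - N ^ n * (x k'.1 + α k'.2) =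
              (N ^ n * x k.1 - N ^ n * x k'.1) + N ^ n * ((α k.2 - α k'.2 : ℤ) : ℝ) := by
            push_cast; ring
          rw [e1]
          exact ((h.separated_treeNode hN e r₀ r n _ _ h1).add_int hN _).exists_digitMask hN
      obtain ⟨i, hi, h0⟩ := hex
      rw [Finset.prod_eq_zero (Finset.mem_range.2 hi) h0, mul_zero]) (fun w => g w.1)
  rw [Fintype.sum_prod_type, RootedWord.sum_succ, RootedWord.card] at key
  simp only [Finset.sum_const, Finset.card_univ, nsmul_eq_mul] at key
  rw [← Finset.mul_sum] at key
  have hin : ∀ ν a, ∑ w : RootedWord Unit (A × B) (n + 1), g w.1 *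
      cis (N ^ n * (x ν + α a) * wordPoint N (layerDigit N o F) (n + 1) w) =
      (∑ w, g w * cis (N ^ n * x ν * wordPoint N (layerDigit N o F) n w)) *
      (Fintype.card (A × B) * weightedMask o (layerMask F (x ν)) ((x ν + α a) / N)) := by
    intro ν a
    have e0 : weightedMask o (layerMask F (x ν)) ((x ν + α a) / N) =
        digitMask N o F ((x ν + α a) / N) := by
      rw [digitMask, mul_div_cancel₀ _ hN0, layerMask_add_int]
    rw [e0, ← sum_cis_layerDigit, RootedWord.sum_succ, Finset.sum_mul]
    refine Finset.sum_congr rfl fun w _ => ?_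
    rw [Finset.mul_sum]
    refine Finset.sum_congr rfl fun p _ => ?_
    rw [mul_assoc (g w), ← cis_add]
    congr 1
    obtain ⟨z, hz⟩ := exists_wordPoint_eq hN (layerDigit N o F) n w
    have e1 : (N : ℝ) ^ n * (x ν + α a) * wordPoint N (layerDigit N o F) (n + 1) (w, p) =
        (N ^ n * x ν * wordPoint N (layerDigit N o F) n w +
        (x ν + α a) / N * layerDigit N o F p) + (α a * z : ℤ) := by
      have ew : wordPoint N (layerDigit N o F) (n + 1) (w, p) =
        wordPoint N (layerDigit N o F) n w + layerDigit N o F p / (N : ℝ) ^ (n + 1) := rfl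
      rw [ew]
      push_cast
      rw [← hz, pow_succ]
      field_simp
      ring
    rw [e1, cis_add_intCast]
  simp_rw [hin] at key
  simp only [norm_mul, mul_pow, Complex.norm_natCast] at key
  simp_rw [← Finset.mul_sum, h.sum_weightedMask_fst] at key
  have hC2 : (Fintype.card (A × B) : ℝ) ^ 2 ≠ 0 := pow_ne_zero _ hC
  apply mul_left_cancel₀ hC2
  rw [Finset.mul_sum]
  simp only [Fintype.card_unit, one_mul, Nat.cast_pow] at key
  calc _ = _ := Finset.sum_congr rfl fun ν _ => by ring
    _ = _ := key
    _ = _ := by ring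

/-- There is an increasing sequence of finite orthogonal sets of frequencies such that the `n`-th
one satisfies a lower frame bound, uniform in `n`, on the functions of the first `n` digits. -/
theorem TwoLayer.exists_frequencies [Nonempty A] [Nonempty B] (h : TwoLayer N o F α β)
    (hN : 2 ≤ N) {χ : ℝ → ℂ} (hc : Continuous χ) (h0 : χ 0 = 1)
    (hχ : ∀ t, χ t = digitMask N o F (t / N) * χ (t / N)) (b₀ : B) (hb₀ : ∀ a, F a b₀ = 0)
    (hprim : ∀ y, (∀ a b, cis (y * F a b) = 1) → (∀ a a', cis (y * o a) = cis (y * o a')) →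
      ∃ z : ℤ, χ (y + z) ≠ 0) :
    ∃ c > 0, ∃ Λ : ℕ → Finset ℝ, Monotone Λ ∧
      (∀ n, ∀ s ∈ Λ n, ∀ t ∈ Λ n, s ≠ t → χ (s - t) = 0) ∧
      ∀ n, ∀ g : RootedWord Unit (A × B) n → ℂ,
        c * (Fintype.card (A × B) ^ n * ∑ w, ‖g w‖ ^ 2) ≤
          ∑ s ∈ Λ n, ‖∑ w, g w * cis (s * wordPoint N (layerDigit N o F) n w)‖ ^ 2 *
            ‖χ (s / N ^ n)‖ ^ 2 := by
  classical
  have hN0 : (N : ℝ) ≠ 0 := by positivity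
  obtain ⟨c, hc0, hl⟩ := h.exists_lower_bound hN hc h0 hχ b₀ hb₀ hprim
  choose l hl using hl
  let p₀ : A × B := Classical.arbitrary _
  -- Subtracting e makes the label of the distinguished letter p₀ zero, so p₀-children can repeat
  -- the frequency of their parent.
  let e : ℤ := α p₀.1 + β p₀.2
  -- Along p₀ the shift is 0 whenever that already meets the lower bound; otherwise the shift comes
  -- from the bound.
  let r : A × B → ℝ → ℤ := fun p x =>
    if p = p₀ ∧ c * meanSq (layerMask F x) ≤ ‖χ x‖ ^ 2 then 0 else l x
  let T : ∀ n, RootedWord B (A × B) n → ℝ × ℤ :=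
    treeNode N (fun p => α p.1 + β p.2 - e) (fun b => (β b : ℝ) / N) l r
  let f : ∀ n, RootedWord B (A × B) n → ℝ := fun n ν => N ^ n * ((T n ν).1 + (T n ν).2)
  have hdiv : ∀ n ν, f n ν / N ^ n = (T n ν).1 + (T n ν).2 := fun n ν =>
    mul_div_cancel_left₀ _ (pow_ne_zero n hN0)
  have hbound : ∀ n ν, c * meanSq (layerMask F (T n ν).1) ≤ ‖χ ((T n ν).1 + (T n ν).2)‖ ^ 2 := by
    intro n ν
    cases n with
    | zero => exact hl _
    | succ n =>
      obtain ⟨ν, p⟩ := ν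
      change c * meanSq (layerMask F (((T n ν).1 + ((T n ν).2 + (α p.1 + β p.2 - e) : ℤ)) / N)) ≤
        ‖χ ((((T n ν).1 + ((T n ν).2 + (α p.1 + β p.2 - e) : ℤ)) / N) +
        (r p (((T n ν).1 + ((T n ν).2 + (α p.1 + β p.2 - e) : ℤ)) / N) : ℤ))‖ ^ 2
      generalize ((T n ν).1 + ((T n ν).2 + (α p.1 + β p.2 - e) : ℤ)) / N = x
      simp only [r]
      split_ifs with hif
      · simpa using hif.2
      · exact hl x
  have horth : ∀ n ν ν', ν ≠ ν' → χ (f n ν - f n ν') = 0 := by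
    intro n ν ν' hν
    have := (h.separated_treeNode hN e l r n ν ν' hν).add_int hN ((T n ν).2 - (T n ν').2)
    have e1 : f n ν - f n ν' = N ^ n * (T n ν).1 - N ^ n * (T n ν').1 +
        N ^ n * (((T n ν).2 - (T n ν').2 : ℤ) : ℝ) := by simp only [f]; push_cast; ring
    rw [e1]
    exact this.eq_zero hN hχ
  have hinj : ∀ n, Function.Injective (f n) := by
    intro n ν ν' hf
    by_contra hν
    have := horth n ν ν' hν
    rw [hf, sub_self, h0] at this
    exact one_ne_zero this
  -- Frequencies at which χ (f / N ^ n) vanishes contribute nothing to the frame sum; only the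
  -- others are guaranteed to recur in the next generation.
  refine ⟨c, hc0, fun n => (Finset.univ.filter fun ν => χ (f n ν / N ^ n) ≠ 0).image (f n), ?_,
    ?_, ?_⟩
  · refine monotone_nat_of_le_succ fun n => ?_
    intro s hs
    obtain ⟨ν, hν, rfl⟩ := Finset.mem_image.1 hs
    replace hν := (Finset.mem_filter.1 hν).2
    set x := (T n ν).1 + (T n ν).2 with hx
    rw [hdiv, ← hx, hχ] at hν
    have h1 : ((T n ν).1 + ((T n ν).2 + (α p₀.1 + β p₀.2 - e) : ℤ)) / N = x / N := by
      simp only [e, sub_self, add_zero, hx]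
    -- Shift 0 works at the p₀-child: |χ(x)|² = |m(x/N)|² |χ(x/N)|² is at least c `meanSq` of the
    -- parent's layer mask, which is at least c |m(x/N)|². Cancel |m(x/N)|² and use `meanSq ≤ 1`.
    have hgood : c * meanSq (layerMask F (x / N)) ≤ ‖χ (x / N)‖ ^ 2 := by
      have hm : 0 < ‖digitMask N o F (x / N)‖ ^ 2 := by
        have := (mul_ne_zero_iff.1 hν).1
        positivity
      have h2 := hbound n ν
      have h3 : ‖digitMask N o F (x / N)‖ ^ 2 ≤ meanSq (layerMask F (T n ν).1) := by
        rw [digitMask, mul_div_cancel₀ _ hN0, hx, layerMask_add_int]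
        exact norm_weightedMask_sq_le _ _ _
      rw [← hx, hχ, norm_mul, mul_pow] at h2
      have h4 := meanSq_layerMask_le F (x / N)
      refine le_of_mul_le_mul_left ?_ hm
      calc _ ≤ ‖digitMask N o F (x / N)‖ ^ 2 * (c * 1) := by gcongr
        _ ≤ c * meanSq (layerMask F (T n ν).1) := by rw [mul_one, mul_comm]; gcongr
        _ ≤ _ := h2
    have hT : T (n + 1) (ν, p₀) = (x / N, 0) := by
      change (((T n ν).1 + ((T n ν).2 + (α p₀.1 + β p₀.2 - e) : ℤ)) / (N : ℝ),
        r p₀ (((T n ν).1 + ((T n ν).2 + (α p₀.1 + β p₀.2 - e) : ℤ)) / N)) = _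
      rw [h1]
      simp [r, hgood]
    have hf : f (n + 1) (ν, p₀) = f n ν := by
      simp only [f, hT, ← hx, Int.cast_zero, add_zero]
      rw [pow_succ]; field_simp
    refine Finset.mem_image.2 ⟨(ν, p₀), Finset.mem_filter.2 ⟨Finset.mem_univ _, ?_⟩, hf⟩
    have h5 : f (n + 1) (ν, p₀) / N ^ (n + 1) = x / N :=
      (hdiv (n + 1) (ν, p₀)).trans (by rw [hT]; simp)
    intro hcon
    refine (mul_ne_zero_iff.1 hν).2 ?_
    rw [← h5]
    exact hcon
  · intro n s hs t ht hst
    obtain ⟨ν, -, rfl⟩ := Finset.mem_image.1 hs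
    obtain ⟨ν', -, rfl⟩ := Finset.mem_image.1 ht
    exact horth n ν ν' fun he => hst (by rw [he])
  · intro n g
    rw [Finset.sum_image (hinj n).injOn, Finset.sum_filter_of_ne]
    · rw [← h.sum_treeNode hN e l r n g, Finset.mul_sum]
      refine Finset.sum_le_sum fun ν _ => ?_
      have e1 : ∀ w : RootedWord Unit (A × B) n, cis (f n ν * wordPoint N (layerDigit N o F) n w) =
          cis (N ^ n * (T n ν).1 * wordPoint N (layerDigit N o F) n w) := by
        intro w
        obtain ⟨z, hz⟩ := exists_wordPoint_eq hN (layerDigit N o F) n w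
        have : f n ν * wordPoint N (layerDigit N o F) n w =
            N ^ n * (T n ν).1 * wordPoint N (layerDigit N o F) n w + ((T n ν).2 * z : ℤ) := by
          push_cast
          rw [← hz]
          simp only [f]; ring
        rw [this, cis_add_intCast]
      simp_rw [e1]
      rw [hdiv]
      have := hbound n ν
      change c * (_ * meanSq (layerMask F (T n ν).1)) ≤ _
      rw [mul_left_comm]
      gcongr
    · intro ν _ hne
      contrapose! hne
      rw [hne, norm_zero, zero_pow two_ne_zero, mul_zero]

end Tree

/-! ### Exponentials in L² and affine invariance. -/

theorem memLp_cis (μ : Measure ℝ) [IsFiniteMeasure μ] (s : ℝ) :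
    MemLp (fun x : ℝ => cis (s * x)) 2 μ :=
  MemLp.of_bound (by fun_prop) 1 (Filter.Eventually.of_forall fun x => (norm_cis _).le)

/-- The exponential `x ↦ exp (2 π i s x)` as an element of `L²(μ)`. -/
noncomputable def expLp (μ : Measure ℝ) [IsFiniteMeasure μ] (s : ℝ) : Lp ℂ 2 μ :=
  (memLp_cis μ s).toLp _

theorem charFun_two_pi_mul (μ : Measure ℝ) (t : ℝ) :
    charFun μ (2 * Real.pi * t) = ∫ x, cis (t * x) ∂μ := by
  rw [charFun_apply_real]
  refine integral_congr_ae (Filter.Eventually.of_forall fun x => ?_)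
  simp only [cis]
  congr 1; push_cast; ring

theorem inner_expLp (μ : Measure ℝ) [IsFiniteMeasure μ] (s : ℝ) (f : Lp ℂ 2 μ) :
    inner ℂ (expLp μ s) f = ∫ x, cis (-(s * x)) * f x ∂μ := by
  rw [L2.inner_def]
  refine integral_congr_ae ?_
  filter_upwards [(memLp_cis μ s).coeFn_toLp] with x hx
  rw [expLp, hx, RCLike.inner_apply, conj_cis, mul_comm]

theorem inner_expLp_expLp (μ : Measure ℝ) [IsFiniteMeasure μ] (s t : ℝ) :
    inner ℂ (expLp μ s) (expLp μ t) = charFun μ (2 * Real.pi * (t - s)) := by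
  rw [inner_expLp, charFun_two_pi_mul]
  refine integral_congr_ae ?_
  filter_upwards [(memLp_cis μ t).coeFn_toLp] with x hx
  rw [expLp, hx, ← cis_add]
  congr 1; ring

theorem norm_expLp (μ : Measure ℝ) [IsProbabilityMeasure μ] (s : ℝ) : ‖expLp μ s‖ = 1 := by
  have h := inner_expLp_expLp μ s s
  rw [sub_self, mul_zero, charFun_zero, inner_self_eq_norm_sq_to_K] at h
  simp only [probReal_univ] at h
  have h' : ‖expLp μ s‖ ^ 2 = 1 := by
    refine Complex.ofReal_injective ?_
    simpa using h
  rwa [pow_eq_one_iff_of_nonneg (norm_nonneg _) two_ne_zero] at h'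

/-- The exponentials with frequencies in `Λ` are orthogonal and complete in `L²(μ)`. -/
def IsCompleteOrthogonal (μ : Measure ℝ) (Λ : Set ℝ) : Prop :=
  (∀ s ∈ Λ, ∀ t ∈ Λ, s ≠ t → charFun μ (2 * Real.pi * (s - t)) = 0) ∧
    ∀ f : ℝ → ℂ, MemLp f 2 μ → (∀ s ∈ Λ, ∫ x, cis (-(s * x)) * f x ∂μ = 0) → f =ᵐ[μ] 0

theorem IsCompleteOrthogonal.isSpectralMeasure {μ : Measure ℝ} [IsProbabilityMeasure μ]
    {Λ : Set ℝ} (hΛ : Λ.Countable) (h : IsCompleteOrthogonal μ Λ) : IsSpectralMeasure μ := by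
  refine ⟨inferInstance, Λ, hΛ, ?_⟩
  have ho : Orthonormal ℂ fun s : Λ => expLp μ s := by
    refine ⟨fun s => norm_expLp μ s, fun s t hst => ?_⟩
    change inner ℂ (expLp μ s) (expLp μ t) = 0
    rw [inner_expLp_expLp]
    exact h.1 _ t.2 _ s.2 fun he => hst (Subtype.ext he.symm)
  have hc : (Submodule.span ℂ (Set.range fun s : Λ => expLp μ s))ᗮ = ⊥ := by
    rw [Submodule.eq_bot_iff]
    intro f hf
    rw [Submodule.mem_orthogonal] at hf
    have := h.2 f (Lp.memLp f) fun s hs => by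
      rw [← inner_expLp]
      exact hf _ (Submodule.subset_span ⟨⟨s, hs⟩, rfl⟩)
    exact (Lp.eq_zero_iff_ae_eq_zero).2 this
  refine ⟨HilbertBasis.mkOfOrthogonalEqBot ho hc, fun t => ?_⟩
  rw [HilbertBasis.coe_mkOfOrthogonalEqBot]
  filter_upwards [(memLp_cis μ t).coeFn_toLp] with x hx
  rw [expLp, hx, cis]
  congr 1; push_cast; ring

/-- Spectrality is invariant under affine maps. -/
theorem IsCompleteOrthogonal.of_map {μ : Measure ℝ} {v : ℝ} (hv : v ≠ 0) (c : ℝ) {Λ : Set ℝ}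
    (h : IsCompleteOrthogonal (μ.map fun x => (x - c) / v) Λ) :
    IsCompleteOrthogonal μ ((· / v) '' Λ) := by
  have hm : Measurable fun x : ℝ => (x - c) / v := by fun_prop
  have hm' : Measurable fun x : ℝ => v * x + c := by fun_prop
  have hcomp' : (fun x : ℝ => v * x + c) ∘ (fun x => (x - c) / v) = id := by
    ext x; simp; field_simp; ring
  have hback : (μ.map fun x => (x - c) / v).map (fun x : ℝ => v * x + c) = μ := by
    rw [Measure.map_map hm' hm, hcomp', Measure.map_id]
  constructor
  · rintro _ ⟨s, hs, rfl⟩ _ ⟨t, ht, rfl⟩ hst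
    have := h.1 s hs t ht fun he => hst (by rw [he])
    rw [charFun_two_pi_mul, integral_map hm.aemeasurable (by fun_prop)] at this
    rw [charFun_two_pi_mul]
    have e : ∀ x, cis ((s - t) * ((x - c) / v)) = cis (-((s - t) * c / v)) *
        cis ((s / v - t / v) * x) := by
      intro x; rw [← cis_add]; congr 1; field_simp; ring
    simp_rw [e, integral_const_mul] at this
    exact (mul_eq_zero.1 this).resolve_left (cis_ne_zero _)
  · intro f hf hz
    have hf' : MemLp (fun x => f (v * x + c)) 2 (μ.map fun x => (x - c) / v) := by
      have : MemLp f 2 ((μ.map fun x => (x - c) / v).map (fun x : ℝ => v * x + c)) := by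
        rwa [hback]
      exact this.comp_of_map hm'.aemeasurable
    have key := h.2 _ hf' fun s hs => by
      have hmeas : AEStronglyMeasurable (fun x => cis (-(s * x)) * f (v * x + c))
          (μ.map fun x => (x - c) / v) :=
        (by fun_prop : AEStronglyMeasurable (fun x : ℝ => cis (-(s * x))) _).mul hf'.1
      rw [integral_map hm.aemeasurable hmeas]
      have e : ∀ x, cis (-(s * ((x - c) / v))) * f (v * ((x - c) / v) + c) =
          cis (s * c / v) * (cis (-(s / v * x)) * f x) := by
        intro x
        have : v * ((x - c) / v) + c = x := by field_simp; ring
        rw [this, ← mul_assoc, ← cis_add]; congr 2; field_simp; ring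
      simp_rw [e, integral_const_mul]
      rw [hz _ ⟨s, hs, rfl⟩, mul_zero]
    have h2 := ae_of_ae_map hm.aemeasurable key
    filter_upwards [h2] with x hx
    have : v * ((x - c) / v) + c = x := by field_simp; ring
    simpa [this] using hx

/-! ### From frame bounds to completeness. -/

section Completeness

variable {W : Type} [Fintype W] [Nonempty W] [MeasurableSpace W] [DiscreteMeasurableSpace W]

/-- The uniform probability measure on a finite type. -/
noncomputable def uniformMeasure (W : Type) [Fintype W] [MeasurableSpace W] : Measure W :=
  (Fintype.card W : ℝ≥0∞)⁻¹ • Measure.count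

instance : IsProbabilityMeasure (uniformMeasure W) :=
  ⟨by
    rw [uniformMeasure, Measure.smul_apply, Measure.count_apply_finite _ Set.finite_univ]
    simp [ENNReal.inv_mul_cancel]⟩

theorem integral_uniformMeasure {W : Type} [Fintype W] [MeasurableSpace W]
    [DiscreteMeasurableSpace W] (f : W → ℂ) :
    ∫ w, f w ∂uniformMeasure W = (Fintype.card W : ℂ)⁻¹ * ∑ w, f w := by
  rw [uniformMeasure, integral_smul_measure, integral_count]
  simp

/-- The hypothesis says that μ and the law of X w + y / M have the same characteristic function. -/
theorem measurePreserving_add_div {μ : Measure ℝ} [IsProbabilityMeasure μ] (X : W → ℝ) (M : ℝ)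
    (hX : ∀ t, charFun μ (2 * Real.pi * t) =
      (Fintype.card W : ℂ)⁻¹ * (∑ w, cis (t * X w)) * charFun μ (2 * Real.pi * (t / M))) :
    MeasurePreserving (fun p : W × ℝ => X p.1 + p.2 / M) ((uniformMeasure W).prod μ) μ := by
  have hm : Measurable fun p : W × ℝ => X p.1 + p.2 / M :=
    ((measurable_of_finite X).comp measurable_fst).add (measurable_snd.div_const M)
  refine ⟨hm, ?_⟩
  have := Measure.isProbabilityMeasure_map (μ := (uniformMeasure W).prod μ) hm.aemeasurable
  refine Measure.ext_of_charFun (funext fun t => ?_)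
  obtain ⟨t, rfl⟩ : ∃ t', t = 2 * Real.pi * t' := ⟨t / (2 * Real.pi), by field_simp⟩
  rw [hX, charFun_two_pi_mul, integral_map hm.aemeasurable (by fun_prop)]
  have e : ∀ p : W × ℝ, cis (t * (X p.1 + p.2 / M)) = cis (t * X p.1) * cis (t / M * p.2) := by
    intro p; rw [← cis_add]; congr 1; ring
  simp_rw [e]
  rw [integral_prod_mul (fun w => cis (t * X w)) (fun y => cis (t / M * y)),
    integral_uniformMeasure, charFun_two_pi_mul]

/-- If the exponentials of a finite orthogonal set `Λ` satisfy a lower frame bound on functions of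
the leading digit `w`, then a function orthogonal to all of them is far from every function of
`w`. -/
theorem norm_le_of_frame {μ : Measure ℝ} [IsProbabilityMeasure μ] (X : W → ℝ) (M : ℝ)
    (hX : ∀ t, charFun μ (2 * Real.pi * t) =
      (Fintype.card W : ℂ)⁻¹ * (∑ w, cis (t * X w)) * charFun μ (2 * Real.pi * (t / M)))
    (Λ : Finset ℝ) (hΛ : ∀ s ∈ Λ, ∀ t ∈ Λ, s ≠ t → charFun μ (2 * Real.pi * (s - t)) = 0)
    {c : ℝ} (hc : 0 < c)
    (hframe : ∀ g : W → ℂ, c * (Fintype.card W * ∑ w, ‖g w‖ ^ 2) ≤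
      ∑ s ∈ Λ, ‖∑ w, g w * cis (s * X w)‖ ^ 2 * ‖charFun μ (2 * Real.pi * (s / M))‖ ^ 2)
    (f : Lp ℂ 2 μ) (hf : ∀ s ∈ Λ, inner ℂ (expLp μ s) f = 0)
    (g : W → ℂ) (G : Lp ℂ 2 ((uniformMeasure W).prod μ))
    (hG : G =ᵐ[(uniformMeasure W).prod μ] fun p => g p.1) :
    Real.sqrt c * ‖f‖ ≤ (1 + Real.sqrt c) *
      ‖Lp.compMeasurePreserving _ (measurePreserving_add_div X M hX) f - G‖ := by
  set π := measurePreserving_add_div X M hX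
  let T := Lp.compMeasurePreservingₗᵢ (p := 2) (E := ℂ) ℂ _ π
  have hT : ∀ f, Lp.compMeasurePreserving _ π f = T f := fun _ => rfl
  rw [hT]
  have hW : (0 : ℝ) < Fintype.card W := by exact_mod_cast Fintype.card_pos
  have ho : Orthonormal ℂ fun s : Λ => T (expLp μ s) := by
    refine ⟨fun s => by rw [T.norm_map, norm_expLp], fun s t hst => ?_⟩
    change inner ℂ (T (expLp μ s)) (T (expLp μ t)) = 0
    rw [T.inner_map_map, inner_expLp_expLp]
    exact hΛ _ t.2 _ s.2 fun he => hst (Subtype.ext he.symm)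
  have hTe : ∀ s, T (expLp μ s) =ᵐ[(uniformMeasure W).prod μ]
      fun p => cis (s * (X p.1 + p.2 / M)) := by
    intro s
    refine (Lp.coeFn_compMeasurePreserving _ π).trans ?_
    exact π.quasiMeasurePreserving.ae_eq_comp (memLp_cis μ s).coeFn_toLp
  have hGinner : ∀ s, ‖(inner ℂ (T (expLp μ s)) G : ℂ)‖ = (Fintype.card W : ℝ)⁻¹ *
      ‖∑ w, (starRingEnd ℂ) (g w) * cis (s * X w)‖ * ‖charFun μ (2 * Real.pi * (s / M))‖ := by
    intro s
    have h1 : inner ℂ (T (expLp μ s)) G =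
        ∫ p : W × ℝ, (g p.1 * cis (-(s * X p.1))) * cis (-(s / M) * p.2)
          ∂(uniformMeasure W).prod μ := by
      rw [L2.inner_def]
      refine integral_congr_ae ?_
      filter_upwards [hTe s, hG] with p hp hp'
      rw [hp, hp', RCLike.inner_apply, conj_cis, mul_assoc, ← cis_add]
      congr 2; ring
    rw [h1, integral_prod_mul (fun w => g w * cis (-(s * X w))) (fun y => cis (-(s / M) * y)),
      integral_uniformMeasure, ← charFun_two_pi_mul, norm_mul, norm_mul, norm_inv,
      Complex.norm_natCast]
    congr 1
    · congr 1
      rw [← Complex.norm_conj, map_sum]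
      congr 1
      refine Finset.sum_congr rfl fun w _ => ?_
      rw [map_mul, conj_cis, neg_neg]
    · rw [mul_neg, charFun_neg, Complex.norm_conj]
  have hGnorm : ‖G‖ ^ 2 = (Fintype.card W : ℝ)⁻¹ * ∑ w, ‖g w‖ ^ 2 := by
    have h1 : inner ℂ G G = ∫ p : W × ℝ, ((‖g p.1‖ ^ 2 : ℝ) : ℂ) * 1
        ∂(uniformMeasure W).prod μ := by
      rw [L2.inner_def]
      refine integral_congr_ae ?_
      filter_upwards [hG] with p hp
      rw [hp, inner_self_eq_norm_sq_to_K]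
      simp
    rw [integral_prod_mul (fun w => ((‖g w‖ ^ 2 : ℝ) : ℂ)) (fun _ => (1 : ℂ)),
      integral_uniformMeasure, inner_self_eq_norm_sq_to_K] at h1
    simp only [integral_const, probReal_univ, one_smul, mul_one] at h1
    refine Complex.ofReal_injective ?_
    simpa using h1
  set R := T f - G with hR
  -- As f is orthogonal to Λ, the functions G and R have the same coefficients up to sign. Bessel
  -- bounds those of R above, and the frame inequality bounds those of G below.
  have hzero : ∀ s ∈ Λ, ‖(inner ℂ (T (expLp μ s)) G : ℂ)‖ = ‖(inner ℂ (T (expLp μ s)) R : ℂ)‖ := by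
    intro s hs
    rw [hR, inner_sub_right, T.inner_map_map, hf s hs, zero_sub, norm_neg]
  have hbessel : ∑ s ∈ Λ, ‖(inner ℂ (T (expLp μ s)) R : ℂ)‖ ^ 2 ≤ ‖R‖ ^ 2 := by
    have := ho.sum_inner_products_le (s := Finset.univ) R
    rwa [Finset.sum_coe_sort Λ (fun s => ‖(inner ℂ (T (expLp μ s)) R : ℂ)‖ ^ 2)] at this
  have hfr := hframe fun w => (starRingEnd ℂ) (g w)
  simp only [Complex.norm_conj] at hfr
  have h1 : c * ‖G‖ ^ 2 ≤ ‖R‖ ^ 2 := by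
    refine le_trans ?_ hbessel
    have e0 : ∑ s ∈ Λ, ‖(inner ℂ (T (expLp μ s)) R : ℂ)‖ ^ 2 =
        ∑ s ∈ Λ, ‖(inner ℂ (T (expLp μ s)) G : ℂ)‖ ^ 2 :=
      Finset.sum_congr rfl fun s hs => by rw [hzero s hs]
    rw [e0]
    simp_rw [hGinner, mul_pow]
    rw [hGnorm]
    have e : ∀ a b : ℝ, ((Fintype.card W : ℝ)⁻¹) ^ 2 * a * b =
      ((Fintype.card W : ℝ)⁻¹) ^ 2 * (a * b) := fun a b => mul_assoc _ _ _
    simp_rw [e]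
    rw [← Finset.mul_sum]
    calc c * ((Fintype.card W : ℝ)⁻¹ * ∑ w, ‖g w‖ ^ 2) =
        ((Fintype.card W : ℝ)⁻¹) ^ 2 * (c * (Fintype.card W * ∑ w, ‖g w‖ ^ 2)) := by field_simp
      _ ≤ _ := by gcongr
  have h2 : Real.sqrt c * ‖G‖ ≤ ‖R‖ := by
    refine le_of_sq_le_sq ?_ (norm_nonneg _)
    rw [mul_pow, Real.sq_sqrt hc.le]; exact h1
  have h3 : ‖f‖ ≤ ‖R‖ + ‖G‖ := by
    rw [← T.norm_map f]
    calc ‖T f‖ = ‖R + G‖ := by rw [hR, sub_add_cancel]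
      _ ≤ _ := norm_add_le _ _
  calc Real.sqrt c * ‖f‖ ≤ Real.sqrt c * (‖R‖ + ‖G‖) := by gcongr
    _ ≤ _ := by linarith

end Completeness

/-! ### Approximation by functions of the leading digits, and the primitive case. -/

section

theorem exists_measure_tail_le (μ : Measure ℝ) [IsProbabilityMeasure μ] {η : ℝ≥0∞} (hη : η ≠ 0) :
    ∃ R : ℝ, 0 < R ∧ μ {y | R ≤ |y|} ≤ η := by
  obtain ⟨K, -, hK, hlt⟩ := MeasurableSet.univ.exists_isCompact_lt_add
    (measure_ne_top μ _) hη
  obtain ⟨R, hR⟩ := hK.isBounded.exists_norm_le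
  refine ⟨max R 0 + 1, by positivity, ?_⟩
  have hsub : {y : ℝ | max R 0 + 1 ≤ |y|} ⊆ Kᶜ := by
    intro y hy hyK
    have h1 : |y| ≤ R := hR y hyK
    have h2 := le_max_left R 0
    simp only [Set.mem_ofPred_eq] at hy
    linarith
  refine (measure_mono hsub).trans ?_
  rw [measure_compl hK.measurableSet (measure_ne_top _ _)]
  exact tsub_le_iff_left.2 hlt.le

/-- Composition with the map `(w, y) ↦ X w + y / M` brings a given function close to the functions
of `w` alone, once `M` is large. -/
theorem exists_digit_approx {μ : Measure ℝ} [IsProbabilityMeasure μ] {f : ℝ → ℂ} (hf : MemLp f 2 μ)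
    {ε : ℝ} (hε : 0 < ε) : ∃ M₀ : ℝ, 0 < M₀ ∧ ∀ M : ℝ, M₀ ≤ M → ∀ (W : Type) [Fintype W] [Nonempty W]
      [MeasurableSpace W] [DiscreteMeasurableSpace W] (X : W → ℝ),
      MeasurePreserving (fun p : W × ℝ => X p.1 + p.2 / M) ((uniformMeasure W).prod μ) μ →
      ∃ g : W → ℂ, eLpNorm (fun p : W × ℝ => f (X p.1 + p.2 / M) - g p.1) 2
        ((uniformMeasure W).prod μ) ≤ ENNReal.ofReal ε := by
  obtain ⟨ψ, hψc, hψ, hψcont, -⟩ := hf.exists_hasCompactSupport_eLpNorm_sub_le (by norm_num)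
    (ε := ENNReal.ofReal (ε / 3)) (by positivity)
  obtain ⟨K, hK⟩ := hψc.exists_bound_of_continuous hψcont
  have hK0 : 0 ≤ K := (norm_nonneg _).trans (hK 0)
  have huc := hψc.uniformContinuous_of_continuous hψcont
  obtain ⟨δ, hδ, hδε⟩ := Metric.uniformContinuous_iff.1 huc (ε / 3) (by positivity)
  -- Off the tail |y| ≥ R uniform continuity applies; on it the difference is at most 2K, and this
  -- choice keeps its L² norm below ε/3. The summand 1 avoids division by zero when K = 0.
  obtain ⟨R, hR, hRtail⟩ := exists_measure_tail_le μ
    (η := ENNReal.ofReal ((ε / 3 / (2 * K + 1)) ^ 2)) (by positivity)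
  -- For M ≥ R/δ, |y| < R implies |y / M| < δ. The threshold does not depend on W or X, so the
  -- number of digits may be fixed afterwards.
  refine ⟨R / δ, by positivity, fun M hM W _ _ _ _ X hπ => ⟨fun w => ψ (X w), ?_⟩⟩
  have hM0 : 0 < M := lt_of_lt_of_le (by positivity) hM
  have hX : Measurable X := measurable_of_finite X
  have hψsm : AEStronglyMeasurable (fun p : W × ℝ => ψ (X p.1 + p.2 / M) - ψ (X p.1))
      ((uniformMeasure W).prod μ) := by
    have := hψcont.measurable
    exact Measurable.aestronglyMeasurable (by fun_prop)
  have hsplit : (fun p : W × ℝ => f (X p.1 + p.2 / M) - ψ (X p.1)) =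
      ((f - ψ) ∘ fun p : W × ℝ => X p.1 + p.2 / M) +
        fun p : W × ℝ => ψ (X p.1 + p.2 / M) - ψ (X p.1) := by
    ext p; simp
  have hfψ : AEStronglyMeasurable (f - ψ) μ := hf.1.sub hψcont.aestronglyMeasurable
  have hS : MeasurableSet {p : W × ℝ | R ≤ |p.2|} :=
    measurableSet_le measurable_const (by fun_prop)
  have hbound : ∀ p : W × ℝ, ‖ψ (X p.1 + p.2 / M) - ψ (X p.1)‖ ≤
      ‖ε / 3 + Set.indicator {p : W × ℝ | R ≤ |p.2|} (fun _ => 2 * K) p‖ := by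
    intro p
    by_cases hp : R ≤ |p.2|
    · rw [Set.indicator_of_mem (by exact hp), Real.norm_of_nonneg (by positivity)]
      calc _ ≤ K + K := (norm_sub_le _ _).trans (add_le_add (hK _) (hK _))
        _ ≤ _ := by linarith
    · rw [Set.indicator_of_notMem (by exact hp), add_zero, Real.norm_of_nonneg (by positivity),
        ← dist_eq_norm]
      refine (hδε ?_).le
      rw [dist_eq_norm, add_sub_cancel_left, norm_div, Real.norm_of_nonneg hM0.le, div_lt_iff₀ hM0]
      push Not at hp
      calc ‖p.2‖ < R := hp
        _ = δ * (R / δ) := by field_simp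
        _ ≤ δ * M := by gcongr
  have hmeas : (uniformMeasure W).prod μ {p : W × ℝ | R ≤ |p.2|} = μ {y | R ≤ |y|} := by
    have : {p : W × ℝ | R ≤ |p.2|} = Set.univ ×ˢ {y | R ≤ |y|} := by ext p; simp
    rw [this, Measure.prod_prod, measure_univ, one_mul]
  have hlast : eLpNorm (fun p : W × ℝ => ψ (X p.1 + p.2 / M) - ψ (X p.1)) 2
      ((uniformMeasure W).prod μ) ≤ ENNReal.ofReal (ε / 3) + ENNReal.ofReal (ε / 3) := by
    refine (eLpNorm_mono hbound).trans ?_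
    refine (eLpNorm_add_le (f := fun _ : W × ℝ => ε / 3)
      aestronglyMeasurable_const (aestronglyMeasurable_const.indicator hS) (by norm_num)).trans ?_
    refine add_le_add ?_ ?_
    · rw [eLpNorm_const _ (by norm_num) (NeZero.ne _), measure_univ, ENNReal.one_rpow, mul_one,
        Real.enorm_of_nonneg (by positivity)]
    · rw [eLpNorm_indicator_const hS (by norm_num) (by norm_num), hmeas,
        Real.enorm_of_nonneg (by positivity)]
      calc ENNReal.ofReal (2 * K) * μ {y | R ≤ |y|} ^ (1 / (2 : ℝ≥0∞).toReal)
          ≤ ENNReal.ofReal (2 * K) *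
            ENNReal.ofReal ((ε / 3 / (2 * K + 1)) ^ 2) ^ (1 / (2 : ℝ≥0∞).toReal) := by gcongr
        _ = ENNReal.ofReal (2 * K * (ε / 3 / (2 * K + 1))) := by
          rw [ENNReal.ofReal_mul (p := 2 * K) (by positivity), ENNReal.ofReal_rpow_of_nonneg (by positivity)
            (by positivity)]
          congr 2
          rw [ENNReal.toReal_ofNat, ← Real.sqrt_eq_rpow, Real.sqrt_sq (by positivity)]
        _ ≤ ENNReal.ofReal (ε / 3) := by
          refine ENNReal.ofReal_le_ofReal ?_
          rw [mul_div_assoc', div_le_iff₀ (by positivity)]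
          nlinarith
  rw [hsplit]
  refine (eLpNorm_add_le (hfψ.comp_measurePreserving hπ) hψsm (by norm_num)).trans ?_
  rw [eLpNorm_comp_measurePreserving hfψ hπ]
  refine (add_le_add hψ hlast).trans ?_
  rw [← ENNReal.ofReal_add (by positivity) (by positivity),
    ← ENNReal.ofReal_add (by positivity) (by positivity)]
  exact ENNReal.ofReal_le_ofReal (by linarith)

variable {A B : Type} [Fintype A] [Fintype B]

/-- The union of the increasing finite sets is orthogonal. Given f orthogonal to it, the frame
estimate at generation n bounds ‖f‖ by a fixed multiple of its distance to functions of the first n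
digits, which is arbitrarily small for large n. -/
theorem TwoLayer.exists_isCompleteOrthogonal_of_primitive [Nonempty A] [Nonempty B] {N : ℕ}
    {o : A → ℤ} {F : A → B → ℤ} {α : A → ℤ} {β : B → ℤ} (h : TwoLayer N o F α β) (hN : 2 ≤ N)
    {μ : Measure ℝ} [IsProbabilityMeasure μ]
    (hχ : ∀ t, charFun μ (2 * Real.pi * t) =
      digitMask N o F (t / N) * charFun μ (2 * Real.pi * (t / N)))
    (b₀ : B) (hb₀ : ∀ a, F a b₀ = 0)
    (hprim : ∀ y, (∀ a b, cis (y * F a b) = 1) → (∀ a a', cis (y * o a) = cis (y * o a')) →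
      ∃ z : ℤ, charFun μ (2 * Real.pi * (y + z)) ≠ 0) :
    ∃ Λ : Set ℝ, Λ.Countable ∧ IsCompleteOrthogonal μ Λ := by
  have hcont : Continuous fun t => charFun μ (2 * Real.pi * t) :=
    continuous_charFun.comp (by fun_prop)
  obtain ⟨c, hc, Λ, hmono, horth, hframe⟩ := h.exists_frequencies hN
    (χ := fun t => charFun μ (2 * Real.pi * t)) hcont (by simp) hχ b₀ hb₀ hprim
  refine ⟨⋃ n, (Λ n : Set ℝ), Set.countable_iUnion fun n => (Λ n).countable_toSet, ?_, ?_⟩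
  · intro s hs t ht hst
    obtain ⟨m, hm⟩ := Set.mem_iUnion.1 hs
    obtain ⟨n, hn⟩ := Set.mem_iUnion.1 ht
    exact horth (max m n) s (hmono (le_max_left m n) hm) t (hmono (le_max_right m n) hn) hst
  · intro f hf hz
    have hf0 : ∀ n, ∀ s ∈ Λ n, inner ℂ (expLp μ s) (hf.toLp f) = 0 := by
      intro n s hs
      rw [inner_expLp, ← hz s (Set.mem_iUnion.2 ⟨n, hs⟩)]
      refine integral_congr_ae ?_
      filter_upwards [hf.coeFn_toLp] with x hx
      rw [hx]
    have hsc : 0 < Real.sqrt c := Real.sqrt_pos.2 hc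
    have hsmall : ∀ ε > 0, Real.sqrt c * ‖hf.toLp f‖ ≤ (1 + Real.sqrt c) * ε := by
      intro ε hε
      obtain ⟨M₀, hM₀, happ⟩ := exists_digit_approx hf hε
      obtain ⟨n, hn⟩ := pow_unbounded_of_one_lt M₀ (show (1 : ℝ) < N by exact_mod_cast hN)
      let _ : MeasurableSpace (RootedWord Unit (A × B) n) := ⊤
      have : DiscreteMeasurableSpace (RootedWord Unit (A × B) n) := ⟨fun _ => trivial⟩
      have hcard : Fintype.card (RootedWord Unit (A × B) n) = Fintype.card (A × B) ^ n := by
        rw [RootedWord.card, Fintype.card_unit, one_mul]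
      have : Nonempty (RootedWord Unit (A × B) n) := by
        rw [← Fintype.card_pos_iff, hcard]
        exact pow_pos Fintype.card_pos n
      set X := fun w : RootedWord Unit (A × B) n => (wordPoint N (layerDigit N o F) n w : ℝ) with hXdef
      have hX : ∀ t, charFun μ (2 * Real.pi * t) =
          (Fintype.card (RootedWord Unit (A × B) n) : ℂ)⁻¹ * (∑ w, cis (t * X w)) *
            charFun μ (2 * Real.pi * (t / (N : ℝ) ^ n)) := by
        intro t
        have hne : ((Fintype.card (A × B) : ℂ)) ^ n ≠ 0 :=
          pow_ne_zero _ (Nat.cast_ne_zero.2 Fintype.card_ne_zero)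
        have h1 := eq_prod_digitMask_mul (χ := fun t => charFun μ (2 * Real.pi * t)) hχ n t
        have h2 := sum_cis_wordPoint (A := A) (B := B) N o F t n
        simp only [hXdef]
        rw [h2, hcard, Nat.cast_pow, inv_mul_cancel_left₀ hne]
        exact h1
      obtain ⟨g, hg⟩ := happ _ hn.le _ X (measurePreserving_add_div X _ hX)
      have hgm : MemLp (fun p : RootedWord Unit (A × B) n × ℝ => g p.1) 2
          ((uniformMeasure _).prod μ) := by
        refine (MemLp.of_discrete (f := g) (μ := uniformMeasure _)).comp_fst μ
      have := norm_le_of_frame X _ hX (Λ n) (horth n) hc (fun g => by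
        rw [hcard]
        exact_mod_cast hframe n g) (hf.toLp f) (hf0 n) g (hgm.toLp _) hgm.coeFn_toLp
      refine this.trans ?_
      gcongr
      rw [Lp.norm_def]
      refine ENNReal.toReal_le_of_le_ofReal hε.le ?_
      refine (eLpNorm_congr_ae ?_).trans_le hg
      filter_upwards [Lp.coeFn_sub (Lp.compMeasurePreserving _ (measurePreserving_add_div X _ hX)
        (hf.toLp f)) (hgm.toLp _), hgm.coeFn_toLp,
        Lp.coeFn_compMeasurePreserving (hf.toLp f) (measurePreserving_add_div X _ hX),
        (measurePreserving_add_div X _ hX).quasiMeasurePreserving.ae_eq_comp hf.coeFn_toLp]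
        with p h1 h2 h3 h4
      rw [h1, Pi.sub_apply, h2, h3, h4]
      rfl
    have hnorm : ‖hf.toLp f‖ ≤ 0 := by
      refine le_of_forall_pos_le_add fun ε hε => ?_
      have := hsmall (Real.sqrt c * ε / (1 + Real.sqrt c)) (by positivity)
      rw [mul_div_cancel₀ _ (by positivity)] at this
      rw [zero_add]
      exact le_of_mul_le_mul_left this hsc
    have h0 : hf.toLp f = 0 := norm_le_zero_iff.1 hnorm
    exact hf.coeFn_toLp.symm.trans ((Lp.eq_zero_iff_ae_eq_zero).1 h0)

end

/-! ### Affine normalisation to primitive digits. -/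

section

variable {A B : Type} [Fintype A] [Fintype B]

/-- Moving N F a b₀ into the first layer keeps the digits. At frequencies m/N it alters first-layer
phases by integers, while second-layer sums acquire a common factor. -/
theorem TwoLayer.shift {N : ℕ} (hN : 2 ≤ N) {o : A → ℤ} {F : A → B → ℤ} {α : A → ℤ} {β : B → ℤ}
    (h : TwoLayer N o F α β) (b₀ : B) :
    TwoLayer N (fun a => o a + N * F a b₀) (fun a b => F a b - F a b₀) α β := by
  have hN0 : (N : ℝ) ≠ 0 := by positivity
  have e₁ : ∀ (m : ℤ) x, cis ((m : ℝ) / N * (o x + N * F x b₀ : ℤ)) = cis ((m : ℝ) / N * o x) := by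
    intro m x
    rw [← cis_add_intCast ((m : ℝ) / N * o x) (m * F x b₀)]
    congr 1; push_cast; field_simp
  have e₂ : ∀ (m : ℤ) x y, cis ((m : ℝ) / N * (F x y - F x b₀ : ℤ)) =
      cis (-((m : ℝ) / N * F x b₀)) * cis ((m : ℝ) / N * F x y) := by
    intro m x y
    rw [← cis_add]
    congr 1; push_cast; ring
  refine ⟨fun a a' haa => ?_, fun b b' hbb x => ?_, fun p p' hpp => ?_⟩
  · simp_rw [e₁]; exact h.orth_fst a a' haa
  · simp_rw [e₂]; rw [← Finset.mul_sum, h.orth_snd b b' hbb x, mul_zero]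
  · refine (h.orth p p' hpp).imp (fun h1 => ?_) fun h1 x => ?_
    · simp_rw [e₁]; exact h1
    · simp_rw [e₂]; rw [← Finset.mul_sum, h1 x, mul_zero]

theorem digitMask_shift (N : ℕ) (o : A → ℤ) (F : A → B → ℤ) (b₀ : B) (t : ℝ) :
    digitMask N (fun a => o a + N * F a b₀) (fun a b => F a b - F a b₀) t = digitMask N o F t := by
  rw [digitMask_eq, digitMask_eq]
  congr 1
  refine Finset.sum_congr rfl fun p _ => ?_
  congr 2
  push_cast; ring

/-- The factor v taken out of the digits is put into the frequencies; the translation c only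
multiplies sums by a unimodular factor. -/
theorem TwoLayer.of_dilate {N : ℕ} {o o' : A → ℤ} {F F' : A → B → ℤ} {α : A → ℤ} {β : B → ℤ}
    (h : TwoLayer N o F α β) {c v : ℤ} (ho : ∀ a, o a = c + v * o' a)
    (hF : ∀ a b, F a b = v * F' a b) :
    TwoLayer N o' F' (fun a => v * α a) (fun b => v * β b) := by
  have e₁ : ∀ (m : ℤ) x, cis ((v * m : ℤ) / (N : ℝ) * o' x) =
      cis (-((m : ℝ) / N * c)) * cis ((m : ℝ) / N * o x) := by
    intro m x
    rw [← cis_add, ho]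
    congr 1; push_cast; ring
  have e₂ : ∀ (m : ℤ) x y, cis ((v * m : ℤ) / (N : ℝ) * F' x y) = cis ((m : ℝ) / N * F x y) := by
    intro m x y
    rw [hF]
    congr 1; push_cast; ring
  refine ⟨fun a a' haa => ?_, fun b b' hbb x => ?_, fun p p' hpp => ?_⟩
  · simp_rw [← mul_sub, e₁]; rw [← Finset.mul_sum, h.orth_fst a a' haa, mul_zero]
  · simp_rw [← mul_sub, e₂]; exact h.orth_snd b b' hbb x
  · simp_rw [← mul_add, ← mul_sub]
    refine (h.orth p p' hpp).imp (fun h1 => ?_) fun h1 x => ?_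
    · simp_rw [e₁]; rw [← Finset.mul_sum, h1, mul_zero]
    · simp_rw [e₂]; exact h1 x

theorem digitMask_of_dilate (N : ℕ) {o o' : A → ℤ} {F F' : A → B → ℤ} {c v : ℤ}
    (ho : ∀ a, o a = c + v * o' a) (hF : ∀ a b, F a b = v * F' a b) (t : ℝ) :
    digitMask N o F t = cis (t * c) * digitMask N o' F' (v * t) := by
  rw [digitMask_eq, digitMask_eq, mul_left_comm, Finset.mul_sum (a := cis (t * c))]
  congr 1
  refine Finset.sum_congr rfl fun p _ => ?_
  rw [← cis_add, ho, hF]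
  congr 1
  push_cast; ring

theorem TwoLayer.exists_isCompleteOrthogonal [Nonempty A] [Nonempty B] {N : ℕ}
    {o : A → ℤ} {F : A → B → ℤ} {α : A → ℤ} {β : B → ℤ} (h : TwoLayer N o F α β) (hN : 2 ≤ N)
    {μ : Measure ℝ} [IsProbabilityMeasure μ]
    (hχ : ∀ t, charFun μ (2 * Real.pi * t) =
      digitMask N o F (t / N) * charFun μ (2 * Real.pi * (t / N))) :
    ∃ Λ : Set ℝ, Λ.Countable ∧ IsCompleteOrthogonal μ Λ := by
  obtain ⟨a₀⟩ := ‹Nonempty A›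
  obtain ⟨b₀⟩ := ‹Nonempty B›
  have hN1 : (1 : ℝ) < N := by exact_mod_cast hN
  have hN0 : (N : ℝ) ≠ 0 := by positivity
  wlog hF0 : ∀ a, F a b₀ = 0 generalizing o F
  · refine this (h.shift hN b₀) (fun t => ?_) fun a => sub_self _
    rw [digitMask_shift, hχ]
  have : Nonempty A := ⟨a₀⟩
  have : Nonempty B := ⟨b₀⟩
  let G : AddSubgroup ℤ := AddSubgroup.closure
    ((Set.range fun p : A × B => F p.1 p.2) ∪ Set.range fun a => o a - o a₀)
  obtain ⟨v, hv⟩ : ∃ v, G = AddSubgroup.zmultiples v := by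
    obtain ⟨v, hv⟩ := Int.subgroup_cyclic G
    exact ⟨v, by rw [hv, AddSubgroup.zmultiples_eq_closure]⟩
  have hFv : ∀ a b, ∃ m, F a b = v * m := by
    intro a b
    have : F a b ∈ G := AddSubgroup.subset_closure (Or.inl ⟨(a, b), rfl⟩)
    rw [hv, Int.mem_zmultiples_iff] at this
    exact this
  have hov : ∀ a, ∃ m, o a = o a₀ + v * m := by
    intro a
    have : o a - o a₀ ∈ G := AddSubgroup.subset_closure (Or.inr ⟨a, rfl⟩)
    rw [hv, Int.mem_zmultiples_iff] at this
    obtain ⟨m, hm⟩ := this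
    exact ⟨m, by rw [← hm]; ring⟩
  choose F' hF' using hFv
  choose o' ho' using hov
  -- All digits then coincide, so |χ| is invariant under division by N and equals 1 by continuity at
  -- 0; the primitivity condition is trivial.
  by_cases hv0 : v = 0
  · refine h.exists_isCompleteOrthogonal_of_primitive hN hχ b₀ hF0 fun y _ _ => ⟨0, ?_⟩
    have hmask : ∀ t, ‖digitMask N o F t‖ = 1 := by
      intro t
      rw [digitMask_of_dilate N ho' hF', norm_mul, norm_cis, hv0, one_mul, digitMask_eq]
      have hc : (Fintype.card (A × B) : ℂ) ≠ 0 := Nat.cast_ne_zero.2 Fintype.card_ne_zero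
      simp only [Int.cast_zero, zero_mul, cis_zero, Finset.sum_const, Finset.card_univ,
        nsmul_eq_mul, mul_one]
      rw [inv_mul_cancel₀ hc, norm_one]
    have hconst : ∀ n : ℕ, ‖charFun μ (2 * Real.pi * y)‖ =
        ‖charFun μ (2 * Real.pi * (y / (N : ℝ) ^ n))‖ := by
      intro n
      have := eq_prod_digitMask_mul (χ := fun t => charFun μ (2 * Real.pi * t)) hχ n y
      beta_reduce at this
      rw [this, norm_mul, norm_prod]
      simp [hmask]
    have hlim : Filter.Tendsto (fun n : ℕ => y / (N : ℝ) ^ n) Filter.atTop (nhds 0) :=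
      Filter.Tendsto.div_atTop tendsto_const_nhds (tendsto_pow_atTop_atTop_of_one_lt hN1)
    have hcont : Continuous fun t => ‖charFun μ (2 * Real.pi * t)‖ :=
      (continuous_charFun.comp (by fun_prop)).norm
    have hl := (hcont.tendsto 0).comp hlim
    have h1 : ‖charFun μ (2 * Real.pi * y)‖ = 1 := by
      have hl' : Filter.Tendsto (fun _ : ℕ => ‖charFun μ (2 * Real.pi * y)‖) Filter.atTop
          (nhds 1) := by
        refine Filter.Tendsto.congr (fun n => (hconst n).symm) ?_
        simpa [Function.comp_def] using hl
      exact tendsto_nhds_unique tendsto_const_nhds hl'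
    rw [Int.cast_zero, add_zero, ← norm_ne_zero_iff, h1]
    exact one_ne_zero
  · have hvR : (v : ℝ) ≠ 0 := by exact_mod_cast hv0
    -- The fixed point of x ↦ (x + o a₀)/N; recentring there and dividing by v turns the digits into
    -- those of o', F'.
    set c : ℝ := o a₀ / ((N : ℝ) - 1) with hc
    have hcN : c * (N - 1) = o a₀ := by
      rw [hc]; exact div_mul_cancel₀ _ (by linarith)
    have hm : Measurable fun x : ℝ => (x - c) / v := by fun_prop
    have := Measure.isProbabilityMeasure_map (μ := μ) hm.aemeasurable
    have hmap : ∀ t, charFun (μ.map fun x => (x - c) / v) (2 * Real.pi * t) =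
        cis (-(t * c / v)) * charFun μ (2 * Real.pi * (t / v)) := by
      intro t
      rw [charFun_two_pi_mul, integral_map hm.aemeasurable (by fun_prop), charFun_two_pi_mul,
        ← integral_const_mul]
      congr 1
      ext x
      rw [← cis_add]
      congr 1
      field_simp
      ring
    have hχ' : ∀ t, charFun (μ.map fun x => (x - c) / v) (2 * Real.pi * t) =
        digitMask N o' F' (t / N) *
          charFun (μ.map fun x => (x - c) / v) (2 * Real.pi * (t / N)) := by
      intro t
      rw [hmap, hmap, hχ, digitMask_of_dilate N ho' hF']
      have e1 : (v : ℝ) * (t / v / N) = t / N := by field_simp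
      have e2 : t / v / N = t / N / v := by ring
      have e3 : cis (-(t * c / v)) * cis (t / N / v * o a₀) = cis (-(t / N * c / v)) := by
        rw [← cis_add, ← hcN]
        congr 1
        field_simp
        ring
      rw [e1, e2, ← e3]
      ring
    have ho0 : o' a₀ = 0 := by
      have := ho' a₀
      simpa [hv0] using this
    obtain ⟨Λ, hΛ, hc⟩ := (h.of_dilate ho' hF').exists_isCompleteOrthogonal_of_primitive hN hχ' b₀
      (fun a => by simpa [hv0] using (hF' a b₀).symm.trans (hF0 a)) fun y hy hy' => by
        -- The integers m with y m / v integral form a group containing the generators of G, hence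
        -- v. So y is an integer, and translating by -y reaches χ(0) = 1.
        obtain ⟨z, hz⟩ : ∃ z : ℤ, y = z := by
          let H : AddSubgroup ℤ :=
            { carrier := {m | ∃ n : ℤ, y * (m / v) = n}
              zero_mem' := ⟨0, by simp⟩
              add_mem' := by
                rintro _ _ ⟨m, hm⟩ ⟨n, hn⟩
                exact ⟨m + n, by push_cast; rw [add_div, mul_add, hm, hn]⟩
              neg_mem' := by
                rintro _ ⟨m, hm⟩
                exact ⟨-m, by push_cast; rw [neg_div, mul_neg, hm]⟩ }
          have hGH : G ≤ H := by
            rw [AddSubgroup.closure_le]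
            rintro _ (⟨p, rfl⟩ | ⟨a, rfl⟩)
            · obtain ⟨n, hn⟩ := (cis_eq_one_iff _).1 (hy p.1 p.2)
              refine ⟨n, ?_⟩
              simp only [hF', Int.cast_mul]
              rw [← hn, mul_div_cancel_left₀ _ hvR]
            · have h1 := hy' a a₀
              rw [ho0, Int.cast_zero, mul_zero, cis_zero] at h1
              obtain ⟨n, hn⟩ := (cis_eq_one_iff _).1 h1
              refine ⟨n, ?_⟩
              simp only [ho' a, add_sub_cancel_left, Int.cast_mul]
              rw [← hn, mul_div_cancel_left₀ _ hvR]
          have hvG : v ∈ G := by rw [hv]; exact AddSubgroup.mem_zmultiples v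
          obtain ⟨n, hn⟩ := hGH hvG
          exact ⟨n, by rwa [div_self hvR, mul_one] at hn⟩
        refine ⟨-z, ?_⟩
        simp [hz]
    exact ⟨_, hΛ.image _, hc.of_map hvR c⟩

end

/-! ### Stage systems and arrays of labels. -/

/-- The partial sums of `∑ N ^ s j * e j`, where the digit `e j`, labelled by `x j`, may depend on the
preceding partial sum. -/
def chainPoint (N : ℕ) (s : ℕ → ℕ) (ε : ℕ → ℤ → ℤ → ℤ) (x : ℕ → ℤ) : ℕ → ℤ
  | 0 => 0
  | j + 1 => chainPoint N s ε x j + (N : ℤ) ^ s j * ε j (chainPoint N s ε x j) (x j)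

theorem chainPoint_congr (N : ℕ) (s : ℕ → ℕ) (ε : ℕ → ℤ → ℤ → ℤ) {x y : ℕ → ℤ} {j : ℕ}
    (h : ∀ i < j, x i = y i) : chainPoint N s ε x j = chainPoint N s ε y j := by
  induction j with
  | zero => rfl
  | succ j ih =>
    rw [chainPoint, chainPoint, ih fun i hi => h i (hi.trans j.lt_succ_self), h j j.lt_succ_self]

theorem chainPoint_eq_sum (N : ℕ) (s : ℕ → ℕ) (ε : ℕ → ℤ → ℤ → ℤ) (x : ℕ → ℤ) (j : ℕ) :
    chainPoint N s ε x j =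
      ∑ i ∈ Finset.range j, (N : ℤ) ^ s i * ε i (chainPoint N s ε x i) (x i) := by
  induction j with
  | zero => rfl
  | succ j ih => rw [chainPoint, Finset.sum_range_succ, ← ih]

/-- Labels `L j`, positions `s j` and digits `ε j d l` such that differences of sums of labels over
an initial or final segment of the stages annihilate the digits of one of these stages. -/
structure StageSystem (N k : ℕ) (L : ℕ → Finset ℤ) (s : ℕ → ℕ) (ε : ℕ → ℤ → ℤ → ℤ) : Prop where
  position_lt : ∀ i j, i < j → j ≤ k → s i < s j
  exists_sum_cis_eq_zero : ∀ m n, (m = 0 ∧ n ≤ k ∨ 1 ≤ m ∧ n = k) → ∀ x y : ℕ → ℤ,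
    (∀ j ∈ Finset.Icc m n, x j ∈ L j) → (∀ j ∈ Finset.Icc m n, y j ∈ L j) →
    (∃ j ∈ Finset.Icc m n, x j ≠ y j) → ∃ j ∈ Finset.Icc m n, ∀ z : ℕ → ℤ, (∀ i ≤ k, z i ∈ L i) →
      ∑ l ∈ L j, cis (((∑ i ∈ Finset.Icc m n, (x i - y i) : ℤ) : ℝ) / N *
        ε j (chainPoint N s ε z j) l) = 0

theorem sum_pi_eq_zero_of_update {ι : Type} [Fintype ι] [DecidableEq ι] {X : ι → Type}
    [∀ i, Fintype (X i)] (i₀ : ι) (Φ : (∀ i, X i) → ℂ)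
    (h : ∀ a, ∑ x, Φ (Function.update a i₀ x) = 0) : ∑ a, Φ a = 0 := by
  rw [← (Equiv.piSplitAt i₀ X).symm.sum_comp, Fintype.sum_prod_type_right]
  refine Finset.sum_eq_zero fun c _ => ?_
  by_cases hX : Nonempty (X i₀)
  · obtain ⟨x₀⟩ := hX
    rw [← h ((Equiv.piSplitAt i₀ X).symm (x₀, c))]
    refine Finset.sum_congr rfl fun x _ => ?_
    congr 1
    ext i
    by_cases hi : i = i₀
    · subst hi; simp
    · simp [hi]
  · rw [not_nonempty_iff] at hX
    exact Finset.sum_of_isEmpty _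

section Words

variable {N k r : ℕ} {L : ℕ → Finset ℤ} {s : ℕ → ℕ} {ε : ℕ → ℤ → ℤ → ℤ}

/-- Arrays of `r` columns, each column being a sequence of labels in `L 0, …, L k`. -/
abbrev LabelArray (r k : ℕ) (L : ℕ → Finset ℤ) : Type := ∀ i : Fin r × Fin (k + 1), L i.2

/-- A column of an array of labels. -/
def LabelArray.column (w : LabelArray r k L) (p : Fin r) (j : ℕ) : ℤ :=
  if h : j < k + 1 then w (p, ⟨j, h⟩) else 0

theorem LabelArray.column_mem (w : LabelArray r k L) (p : Fin r) {j : ℕ} (hj : j ≤ k) :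
    w.column p j ∈ L j := by
  rw [LabelArray.column, dif_pos (Nat.lt_succ_of_le hj)]
  exact (w (p, ⟨j, _⟩)).2

/-- The digit at a place of an array of labels. -/
def LabelArray.digit (N : ℕ) (s : ℕ → ℕ) (ε : ℕ → ℤ → ℤ → ℤ) (w : LabelArray r k L)
    (i : Fin r × Fin (k + 1)) : ℤ :=
  ε i.2 (chainPoint N s ε (w.column i.1) i.2) (w i)

theorem LabelArray.digit_congr {w w' : LabelArray r k L} {i : Fin r × Fin (k + 1)}
    (h : ∀ j ≤ i.2, w (i.1, j) = w' (i.1, j)) :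
    w.digit N s ε i = w'.digit N s ε i := by
  unfold LabelArray.digit
  rw [show w i = w' i from h i.2 le_rfl, chainPoint_congr N s ε (y := w'.column i.1)]
  intro j hj
  have hjk : j < k + 1 := hj.trans i.2.2
  simp only [LabelArray.column, dif_pos hjk]
  rw [h ⟨j, hjk⟩ hj.le]

theorem LabelArray.chainPoint_update (w : LabelArray r k L) (i : Fin r × Fin (k + 1)) (x : L i.2) :
    chainPoint N s ε (LabelArray.column (Function.update w i x) i.1) i.2 =
      chainPoint N s ε (w.column i.1) i.2 := by
  refine chainPoint_congr N s ε fun j hj => ?_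
  have hjk : j < k + 1 := hj.trans i.2.2
  simp only [LabelArray.column, dif_pos hjk]
  rw [Function.update_of_ne]
  intro h
  have := congrArg (fun i : Fin r × Fin (k + 1) => (i.2 : ℕ)) h
  simp at this
  omega

/-- The part of the sum of digits of an array carried by the places in `Z`, with positions `κ`. -/
def LabelArray.zoneSum (N : ℕ) (s : ℕ → ℕ) (ε : ℕ → ℤ → ℤ → ℤ) (Z : Finset (Fin r × Fin (k + 1)))
    (κ : Fin r × Fin (k + 1) → ℕ) (w : LabelArray r k L) : ℤ :=
  ∑ i ∈ Z, (N : ℤ) ^ κ i * w.digit N s ε i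

/-- Changing one label can alter only its own digit and later digits of the same column. The latter
carry at least one more factor N, so against h/N^r, with h divisible by N^q, they contribute
integers. The phase thus splits into a constant and the stage sum, which vanishes for every history.
-/
theorem LabelArray.sum_cis_update_eq_zero (hN : 2 ≤ N) {Z : Finset (Fin r × Fin (k + 1))}
    {κ : Fin r × Fin (k + 1) → ℕ} {i₀ : Fin r × Fin (k + 1)} (hi₀ : i₀ ∈ Z)
    (hκ : ∀ i ∈ Z, i.1 = i₀.1 → i₀.2 < i.2 → κ i₀ < κ i) {η z h : ℤ} {q : ℕ}
    (hh : h = (N : ℤ) ^ q * η + (N : ℤ) ^ (q + 1) * z) (hq : q + κ i₀ + 1 = r)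
    (w : LabelArray r k L)
    (hzero : ∀ y : ℕ → ℤ, (∀ i ≤ k, y i ∈ L i) →
      ∑ l ∈ L i₀.2, cis ((η : ℝ) / N * ε i₀.2 (chainPoint N s ε y i₀.2) l) = 0) :
    ∑ x : L i₀.2, cis ((h : ℝ) / (N ^ r : ℕ) *
      LabelArray.zoneSum N s ε Z κ (Function.update w i₀ x)) = 0 := by
  have hN0 : (N : ℝ) ≠ 0 := by positivity
  classical
  -- The contribution of the places untouched by the update; later places of the pivot column are
  -- dropped.
  set C : ℤ := ∑ i ∈ Z.erase i₀, if i.1 = i₀.1 ∧ i₀.2 < i.2 then 0 else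
    (N : ℤ) ^ κ i * w.digit N s ε i with hC
  have hterm : ∀ x : L i₀.2, ∀ i ∈ Z.erase i₀, ∃ n : ℤ, (N : ℤ) ^ κ i *
      LabelArray.digit N s ε (Function.update w i₀ x) i =
        (if i.1 = i₀.1 ∧ i₀.2 < i.2 then 0 else (N : ℤ) ^ κ i * w.digit N s ε i) +
          (N : ℤ) ^ (κ i₀ + 1) * n := by
    intro x i hi
    obtain ⟨hne, hi⟩ := Finset.mem_erase.1 hi
    by_cases hc : i.1 = i₀.1 ∧ i₀.2 < i.2
    · obtain ⟨t, ht⟩ := Nat.exists_eq_add_of_lt (hκ i hi hc.1 hc.2)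
      refine ⟨(N : ℤ) ^ t * LabelArray.digit N s ε (Function.update w i₀ x) i, ?_⟩
      rw [if_pos hc, ht]
      ring
    · refine ⟨0, ?_⟩
      rw [if_neg hc, mul_zero, add_zero]
      congr 1
      refine LabelArray.digit_congr fun j hj => Function.update_of_ne ?_ _ _
      rintro rfl
      rcases hj.lt_or_eq with hj | hj
      · exact hc ⟨rfl, hj⟩
      · exact hne (Prod.ext rfl hj.symm)
  have hcis : ∀ x : L i₀.2, cis ((h : ℝ) / (N ^ r : ℕ) *
      LabelArray.zoneSum N s ε Z κ (Function.update w i₀ x)) = cis ((h : ℝ) / (N ^ r : ℕ) * C) *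
        cis ((η : ℝ) / N * ε i₀.2 (chainPoint N s ε (w.column i₀.1) i₀.2) x) := by
    intro x
    choose! n hn using hterm x
    set e := ε i₀.2 (chainPoint N s ε (w.column i₀.1) i₀.2) x with he
    have hdig : LabelArray.digit N s ε (Function.update w i₀ x) i₀ = e := by
      rw [LabelArray.digit, LabelArray.chainPoint_update, Function.update_self]
    have hsum : LabelArray.zoneSum N s ε Z κ (Function.update w i₀ x) =
        C + (N : ℤ) ^ κ i₀ * e + (N : ℤ) ^ (κ i₀ + 1) * ∑ i ∈ Z.erase i₀, n i := by
      rw [LabelArray.zoneSum, ← Finset.add_sum_erase _ _ hi₀, hdig, Finset.sum_congr rfl hn,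
        Finset.sum_add_distrib, ← hC, Finset.mul_sum]
      ring
    rw [hsum, ← cis_add, ← cis_add_intCast (_ + _)
      (z * e + (η + N * z) * ∑ i ∈ Z.erase i₀, n i)]
    have hNr : ((N ^ r : ℕ) : ℝ) = (N : ℝ) ^ q * (N : ℝ) ^ κ i₀ * N := by
      rw [Nat.cast_pow, ← hq]
      ring
    congr 1
    rw [hh, hNr]
    push_cast
    field_simp
    ring
  simp_rw [hcis]
  rw [← Finset.mul_sum, Finset.sum_coe_sort (L i₀.2)
    (fun l => cis ((η : ℝ) / N * ε i₀.2 (chainPoint N s ε (w.column i₀.1) i₀.2) l)),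
    hzero _ fun i hi => w.column_mem _ hi, mul_zero]

end Words

theorem exists_eq_Icc_zero {J : Finset ℕ} {k : ℕ} (hJ : J.Nonempty) (hk : ∀ j ∈ J, j ≤ k)
    (h : ∀ j ∈ J, ∀ i ≤ j, i ∈ J) : ∃ n ≤ k, J = Finset.Icc 0 n := by
  refine ⟨J.max' hJ, hk _ (J.max'_mem hJ), ?_⟩
  ext j
  rw [Finset.mem_Icc]
  exact ⟨fun hj => ⟨Nat.zero_le _, J.le_max' j hj⟩, fun hj => h _ (J.max'_mem hJ) j hj.2⟩

theorem exists_eq_Icc_last {J : Finset ℕ} {k : ℕ} (hJ : J.Nonempty) (hk : ∀ j ∈ J, j ≤ k)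
    (h0 : 0 ∉ J) (h : ∀ j ∈ J, ∀ i, j ≤ i → i ≤ k → i ∈ J) : ∃ m, 1 ≤ m ∧ J = Finset.Icc m k := by
  refine ⟨J.min' hJ, Nat.one_le_iff_ne_zero.2 fun h1 => h0 (h1 ▸ J.min'_mem hJ), ?_⟩
  ext j
  rw [Finset.mem_Icc]
  exact ⟨fun hj => ⟨J.min'_le j hj, hk j hj⟩, fun hj => h _ (J.min'_mem hJ) j hj.1 hj.2⟩

/-! ### Folding r columns into a low and a high layer. -/

section

variable {N k r : ℕ} {L : ℕ → Finset ℤ} {s : ℕ → ℕ} {ε : ℕ → ℤ → ℤ → ℤ}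

/-- The position of a place of an array: the power of `N` that multiplies its digit. -/
def placePosition (s : ℕ → ℕ) (i : Fin r × Fin (k + 1)) : ℕ := i.1 + s i.2

/-- The exponent of the label at a place of an array, dual to the position modulo `r`. -/
def placeLevel (s : ℕ → ℕ) (i : Fin r × Fin (k + 1)) : ℕ :=
  if placePosition s i < r then r - 1 - placePosition s i else 2 * r - 1 - placePosition s i

/-- The weighted sum of the labels of an array. -/
def LabelArray.frequency (N : ℕ) (s : ℕ → ℕ) (w : LabelArray r k L) : ℤ :=
  ∑ i, (N : ℤ) ^ placeLevel s i * w i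

/-- A set of places that meets each level in an initial or a final segment of the stages. -/
def IsZone (s : ℕ → ℕ) (Z : Finset (Fin r × Fin (k + 1))) : Prop :=
  (∀ i ∈ Z, ∀ i', placeLevel s i' = placeLevel s i → i'.2 ≤ i.2 → i' ∈ Z) ∨
  ((∀ i ∈ Z, i.2 ≠ 0) ∧ ∀ i ∈ Z, ∀ i', placeLevel s i' = placeLevel s i → i.2 ≤ i'.2 → i' ∈ Z)

/-- Level q means p + s j ≡ r - 1 - q modulo r, which has one solution p < r because s j < r. -/
theorem existsUnique_column {j : Fin (k + 1)} (hsr : s j < r) {q : ℕ} (hq : q < r) :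
    ∃ p : Fin r, ∀ p', placeLevel s (p', j) = q ↔ p' = p := by
  by_cases h : s j + q < r
  · refine ⟨⟨r - 1 - q - s j, by omega⟩, fun p' => ?_⟩
    have := p'.2
    unfold placeLevel
    split_ifs <;> simp only [placePosition, Fin.ext_iff] at * <;> omega
  · refine ⟨⟨2 * r - 1 - q - s j, by omega⟩, fun p' => ?_⟩
    have := p'.2
    unfold placeLevel
    split_ifs <;> simp only [placePosition, Fin.ext_iff] at * <;> omega

/-- Look at the lowest level q where the arrays differ: modulo N^(q + 1) the frequency difference is
N^q times the sum of the label differences on that level. The zone meets the level in a segment of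
stages to which the stage-system axiom applies. The pivot is the place of the stage that axiom
provides; its own labels need not differ. -/
theorem StageSystem.exists_pivot (h : StageSystem N k L s ε) (hsr : s k < r)
    {Z : Finset (Fin r × Fin (k + 1))} (hZ : IsZone s Z) {w w' : LabelArray r k L} (hne : w ≠ w')
    (heq : ∀ i ∉ Z, w i = w' i) :
    ∃ i₀ ∈ Z, ∃ η z : ℤ, w.frequency N s - w'.frequency N s =
        (N : ℤ) ^ placeLevel s i₀ * η + (N : ℤ) ^ (placeLevel s i₀ + 1) * z ∧
      ∀ y : ℕ → ℤ, (∀ i ≤ k, y i ∈ L i) →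
        ∑ l ∈ L i₀.2, cis ((η : ℝ) / N * ε i₀.2 (chainPoint N s ε y i₀.2) l) = 0 := by
  classical
  have hs : ∀ j : Fin (k + 1), s j < r := by
    intro j
    rcases (Nat.lt_succ_iff.1 j.2).lt_or_eq with hj | hj
    · exact (h.position_lt _ _ hj le_rfl).trans hsr
    · rwa [hj]
  obtain ⟨i₁, hi₁, hmin⟩ := Finset.exists_min_image (Finset.univ.filter fun i => w i ≠ w' i)
    (placeLevel s) (by
      obtain ⟨i, hi⟩ := Function.ne_iff.1 hne
      exact ⟨i, by simpa using hi⟩)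
  simp only [Finset.mem_filter, Finset.mem_univ, true_and] at hi₁ hmin
  set q := placeLevel s i₁ with hq
  have hqr : q < r := by
    have h1 := i₁.1.2
    rw [hq]
    unfold placeLevel placePosition
    split_ifs <;> omega
  have hcol : ∀ j : Fin (k + 1), ∃ p : Fin r, ∀ p', placeLevel s (p', j) = q ↔ p' = p :=
    fun j => existsUnique_column (hs j) hqr
  choose p hp using hcol
  have hplevel : ∀ j, placeLevel s (p j, j) = q := fun j => (hp j _).2 rfl
  have hi₁p : i₁ = (p i₁.2, i₁.2) := Prod.ext ((hp i₁.2 i₁.1).1 hq.symm) rfl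
  have hdvd : ∀ i, ∃ z : ℤ, (N : ℤ) ^ placeLevel s i * ((w i : ℤ) - w' i) =
      (if placeLevel s i = q then (N : ℤ) ^ q * ((w i : ℤ) - w' i) else 0) +
        (N : ℤ) ^ (q + 1) * z := by
    intro i
    by_cases hi : w i = w' i
    · exact ⟨0, by simp [hi]⟩
    · rcases (hmin i hi).eq_or_lt with hlt | hlt
      · exact ⟨0, by rw [if_pos hlt.symm, ← hlt]; ring⟩
      · obtain ⟨t, ht⟩ := Nat.exists_eq_add_of_lt hlt
        refine ⟨(N : ℤ) ^ t * ((w i : ℤ) - w' i), ?_⟩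
        rw [if_neg hlt.ne', ht]
        ring
  choose z hz using hdvd
  have hfreq : w.frequency N s - w'.frequency N s =
      (N : ℤ) ^ q * ∑ j : Fin (k + 1), ((w (p j, j) : ℤ) - w' (p j, j)) +
        (N : ℤ) ^ (q + 1) * ∑ i, z i := by
    rw [LabelArray.frequency, LabelArray.frequency, ← Finset.sum_sub_distrib]
    simp_rw [← mul_sub]
    rw [Finset.sum_congr rfl fun i _ => hz i, Finset.sum_add_distrib, ← Finset.mul_sum]
    congr 1
    rw [Fintype.sum_prod_type_right, Finset.mul_sum]
    refine Finset.sum_congr rfl fun j _ => ?_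
    rw [Finset.sum_eq_single (p j) (fun p' _ hp' => if_neg fun hl => hp' ((hp j p').1 hl))
      (fun hn => absurd (Finset.mem_univ _) hn), if_pos (hplevel j)]
  -- The stages whose place on level q lies in Z; the zone condition makes J an initial segment, or
  -- a final one avoiding 0.
  let J : Finset ℕ := (Finset.univ.filter fun j : Fin (k + 1) => (p j, j) ∈ Z).map Fin.valEmbedding
  have hJmem : ∀ j : Fin (k + 1), (j : ℕ) ∈ J ↔ (p j, j) ∈ Z := by
    intro j
    simp [J]
    constructor
    · rintro ⟨j', hj', he⟩
      obtain rfl := Fin.ext he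
      exact hj'
    · exact fun hj => ⟨j, hj, rfl⟩
  have hJk : ∀ j ∈ J, j ≤ k := by
    intro j hj
    obtain ⟨j', -, rfl⟩ := Finset.mem_map.1 hj
    exact Nat.lt_succ_iff.1 j'.2
  have hi₁J : (i₁.2 : ℕ) ∈ J := by
    rw [hJmem, ← hi₁p]
    by_contra hc
    exact hi₁ (heq _ hc)
  obtain ⟨m, n, hmn, hJI⟩ : ∃ m n, (m = 0 ∧ n ≤ k ∨ 1 ≤ m ∧ n = k) ∧ J = Finset.Icc m n := by
    rcases hZ with hZ | ⟨hZ0, hZ⟩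
    · obtain ⟨n, hn, hJI⟩ := exists_eq_Icc_zero ⟨_, hi₁J⟩ hJk fun j hj i hij => by
        have hjk := hJk j hj
        have hj' := (hJmem ⟨j, Nat.lt_succ_of_le hjk⟩).1 hj
        refine (hJmem ⟨i, by omega⟩).2 (hZ _ hj' _ ?_ ?_)
        · rw [hplevel, hplevel]
        · exact hij
      exact ⟨0, n, Or.inl ⟨rfl, hn⟩, hJI⟩
    · obtain ⟨m, hm, hJI⟩ := exists_eq_Icc_last ⟨_, hi₁J⟩ hJk
        (fun h0 => hZ0 _ ((hJmem 0).1 h0) rfl) fun j hj i hij hik => by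
        have hjk := hJk j hj
        have hj' := (hJmem ⟨j, Nat.lt_succ_of_le hjk⟩).1 hj
        refine (hJmem ⟨i, by omega⟩).2 (hZ _ hj' _ ?_ ?_)
        · rw [hplevel, hplevel]
        · exact hij
      exact ⟨m, k, Or.inr ⟨hm, rfl⟩, hJI⟩
  let x : ℕ → ℤ := fun j => if hj : j < k + 1 then w (p ⟨j, hj⟩, ⟨j, hj⟩) else 0
  let x' : ℕ → ℤ := fun j => if hj : j < k + 1 then w' (p ⟨j, hj⟩, ⟨j, hj⟩) else 0
  have hx : ∀ j : Fin (k + 1), x j = w (p j, j) := fun j => dif_pos j.2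
  have hx' : ∀ j : Fin (k + 1), x' j = w' (p j, j) := fun j => dif_pos j.2
  have hsum : ∑ j : Fin (k + 1), ((w (p j, j) : ℤ) - w' (p j, j)) =
      ∑ i ∈ Finset.Icc m n, (x i - x' i) := by
    rw [← hJI, Finset.sum_map, ← Finset.sum_subset (Finset.subset_univ
      (Finset.univ.filter fun j : Fin (k + 1) => (p j, j) ∈ Z))]
    · refine Finset.sum_congr rfl fun j _ => ?_
      rw [Fin.valEmbedding_apply, hx, hx']
    · intro j _ hj
      rw [heq _ (by simpa using hj), sub_self]
  rw [hsum] at hfreq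
  obtain ⟨j₀, hj₀, hzero⟩ := h.exists_sum_cis_eq_zero m n hmn x x'
    (fun j hj => by
      have hjk := hJk j (hJI ▸ hj)
      rw [hx ⟨j, Nat.lt_succ_of_le hjk⟩]
      exact (w (p ⟨j, Nat.lt_succ_of_le hjk⟩, ⟨j, Nat.lt_succ_of_le hjk⟩)).2)
    (fun j hj => by
      have hjk := hJk j (hJI ▸ hj)
      rw [hx' ⟨j, Nat.lt_succ_of_le hjk⟩]
      exact (w' (p ⟨j, Nat.lt_succ_of_le hjk⟩, ⟨j, Nat.lt_succ_of_le hjk⟩)).2)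
    ⟨i₁.2, hJI ▸ hi₁J, by
      rw [hx, hx', ← hi₁p]
      exact fun he => hi₁ (Subtype.ext he)⟩
  have hj₀k := hJk j₀ (hJI ▸ hj₀)
  refine ⟨(p ⟨j₀, Nat.lt_succ_of_le hj₀k⟩, ⟨j₀, Nat.lt_succ_of_le hj₀k⟩),
    (hJmem ⟨j₀, Nat.lt_succ_of_le hj₀k⟩).1 (hJI ▸ hj₀), _, ∑ i, z i, ?_, hzero⟩
  rw [hplevel]
  exact hfreq

/-- The labels at the places of position less than `r`. -/
abbrev LowLabels (r k : ℕ) (L : ℕ → Finset ℤ) (s : ℕ → ℕ) : Type :=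
  ∀ i : {i : Fin r × Fin (k + 1) // placePosition s i < r}, L i.1.2

/-- The labels at the places of position at least `r`. -/
abbrev HighLabels (r k : ℕ) (L : ℕ → Finset ℤ) (s : ℕ → ℕ) : Type :=
  ∀ i : {i : Fin r × Fin (k + 1) // ¬ placePosition s i < r}, L i.1.2

/-- An array of labels assembled from its low and its high labels. -/
def glue (a : LowLabels r k L s) (b : HighLabels r k L s) : LabelArray r k L := fun i =>
  if h : placePosition s i < r then a ⟨i, h⟩ else b ⟨i, h⟩

theorem glue_low (a : LowLabels r k L s) (b : HighLabels r k L s) {i : Fin r × Fin (k + 1)}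
    (h : placePosition s i < r) : glue a b i = a ⟨i, h⟩ := dif_pos h

theorem glue_high (a : LowLabels r k L s) (b : HighLabels r k L s) {i : Fin r × Fin (k + 1)}
    (h : ¬ placePosition s i < r) : glue a b i = b ⟨i, h⟩ := dif_neg h

theorem glue_injective {a a' : LowLabels r k L s} {b b' : HighLabels r k L s}
    (h : glue a b = glue a' b') : a = a' ∧ b = b' := by
  constructor
  · ext ⟨i, hi⟩
    have := congrFun h i
    rw [glue_low _ _ hi, glue_low _ _ hi] at this
    rw [this]
  · ext ⟨i, hi⟩
    have := congrFun h i
    rw [glue_high _ _ hi, glue_high _ _ hi] at this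
    rw [this]

theorem glue_update_low (a : LowLabels r k L s) (b : HighLabels r k L s)
    (i : {i : Fin r × Fin (k + 1) // placePosition s i < r}) (x : L i.1.2) :
    glue (Function.update a i x) b = Function.update (glue a b) i.1 x := by
  ext i'
  by_cases hi : i' = i.1
  · subst hi
    rw [glue_low _ _ i.2, Function.update_self, Function.update_self]
  · rw [Function.update_of_ne hi]
    by_cases hp : placePosition s i' < r
    · rw [glue_low _ _ hp, glue_low _ _ hp, Function.update_of_ne]
      exact fun h => hi (congrArg Subtype.val h)
    · rw [glue_high _ _ hp, glue_high _ _ hp]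

theorem glue_update_high (a : LowLabels r k L s) (b : HighLabels r k L s)
    (i : {i : Fin r × Fin (k + 1) // ¬ placePosition s i < r}) (x : L i.1.2) :
    glue a (Function.update b i x) = Function.update (glue a b) i.1 x := by
  ext i'
  by_cases hi : i' = i.1
  · subst hi
    rw [glue_high _ _ i.2, Function.update_self, Function.update_self]
  · rw [Function.update_of_ne hi]
    by_cases hp : placePosition s i' < r
    · rw [glue_low _ _ hp, glue_low _ _ hp]
    · rw [glue_high _ _ hp, glue_high _ _ hp, Function.update_of_ne]
      exact fun h => hi (congrArg Subtype.val h)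

/-- The places of position less than `r`. -/
def lowPlaces (r k : ℕ) (s : ℕ → ℕ) : Finset (Fin r × Fin (k + 1)) :=
  Finset.univ.filter fun i => placePosition s i < r

/-- The places of position at least `r`. -/
def highPlaces (r k : ℕ) (s : ℕ → ℕ) : Finset (Fin r × Fin (k + 1)) :=
  Finset.univ.filter fun i => ¬ placePosition s i < r

theorem mem_lowPlaces {i : Fin r × Fin (k + 1)} : i ∈ lowPlaces r k s ↔ placePosition s i < r := by
  simp [lowPlaces]

theorem mem_highPlaces {i : Fin r × Fin (k + 1)} :
    i ∈ highPlaces r k s ↔ ¬ placePosition s i < r := by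
  simp [highPlaces]

theorem LabelArray.column_apply (w : LabelArray r k L) (p : Fin r) (j : Fin (k + 1)) :
    w.column p j = w (p, j) := by
  rw [LabelArray.column, dif_pos j.2]

namespace StageSystem

theorem position_le (h : StageSystem N k L s ε) {i j : Fin (k + 1)} (hij : i ≤ j) : s i ≤ s j := by
  rcases hij.lt_or_eq with hij | rfl
  · exact (h.position_lt _ _ hij (Nat.lt_succ_iff.1 j.2)).le
  · exact le_rfl

theorem position_lt_of_lt (h : StageSystem N k L s ε) (hsr : s k < r) (j : Fin (k + 1)) : s j < r :=
  (h.position_le (Fin.le_last j)).trans_lt hsr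

/-- On level q the low places are those with s j < r - q, and s is increasing. -/
theorem isZone_lowPlaces (h : StageSystem N k L s ε) (hsr : s k < r) :
    IsZone s (lowPlaces r k s) := by
  refine Or.inl fun i hi i' hl hle => ?_
  rw [mem_lowPlaces] at hi ⊢
  have h1 := h.position_le hle
  have h2 := h.position_lt_of_lt hsr i.2
  have h3 := i'.1.2
  unfold placeLevel at hl
  split_ifs at hl <;> simp only [placePosition] at * <;> omega

/-- Complementary to the low case; stage 0 is never high because s 0 = 0 and p < r. -/
theorem isZone_highPlaces (h : StageSystem N k L s ε) (hsr : s k < r) (h0 : s 0 = 0) :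
    IsZone s (highPlaces r k s) := by
  refine Or.inr ⟨fun i hi hi0 => ?_, fun i hi i' hl hle => ?_⟩
  · rw [mem_highPlaces, placePosition, hi0] at hi
    have := i.1.2
    simp only [Fin.val_zero, h0] at hi
    omega
  · rw [mem_highPlaces] at hi ⊢
    have h1 := h.position_le hle
    have h2 := h.position_lt_of_lt hsr i.2
    have h3 := i'.1.2
    unfold placeLevel at hl
    split_ifs at hl <;> simp only [placePosition] at * <;> omega

/-- The part of the sum of digits determined by the low labels. -/
def low (N : ℕ) (ε : ℕ → ℤ → ℤ → ℤ) (b₀ : HighLabels r k L s) (a : LowLabels r k L s) : ℤ :=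
  (glue a b₀).zoneSum N s ε (lowPlaces r k s) (placePosition s)

/-- The part of the sum of digits at the positions at least `r`, divided by `N ^ r`. -/
def high (N : ℕ) (ε : ℕ → ℤ → ℤ → ℤ) (a : LowLabels r k L s) (b : HighLabels r k L s) : ℤ :=
  (glue a b).zoneSum N s ε (highPlaces r k s) fun i => placePosition s i - r

/-- A digit depends on earlier stages of its column, which sit at lower positions and so are low as
well; the dummy high labels b₀ play no role. -/
theorem low_eq (h : StageSystem N k L s ε) (a : LowLabels r k L s) (b b₀ : HighLabels r k L s) :
    low N ε b₀ a = (glue a b).zoneSum N s ε (lowPlaces r k s) (placePosition s) := by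
  refine Finset.sum_congr rfl fun i hi => ?_
  rw [mem_lowPlaces] at hi
  congr 1
  refine LabelArray.digit_congr fun j hj => ?_
  have h1 := h.position_le hj
  have hp : placePosition s (i.1, j) < r := by
    simp only [placePosition] at *; omega
  rw [glue_low _ _ hp, glue_low _ _ hp]

theorem low_add_high (h : StageSystem N k L s ε) (a : LowLabels r k L s) (b b₀ : HighLabels r k L s) :
    low N ε b₀ a + (N ^ r : ℕ) * high N ε a b =
      ∑ p : Fin r, (N : ℤ) ^ (p : ℕ) * chainPoint N s ε ((glue a b).column p) (k + 1) := by
  rw [h.low_eq a b b₀, high, LabelArray.zoneSum, LabelArray.zoneSum, Finset.mul_sum]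
  have e : ∑ i ∈ highPlaces r k s, ((N ^ r : ℕ) : ℤ) *
      ((N : ℤ) ^ (placePosition s i - r) * (glue a b).digit N s ε i) =
        ∑ i ∈ highPlaces r k s, (N : ℤ) ^ placePosition s i * (glue a b).digit N s ε i := by
    refine Finset.sum_congr rfl fun i hi => ?_
    rw [mem_highPlaces, not_lt] at hi
    rw [← mul_assoc, Nat.cast_pow, ← pow_add, Nat.add_sub_cancel' hi]
  rw [e, lowPlaces, highPlaces, Finset.sum_filter_add_sum_filter_not, Fintype.sum_prod_type]
  refine Finset.sum_congr rfl fun p _ => ?_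
  rw [chainPoint_eq_sum, Finset.sum_range, Finset.mul_sum]
  refine Finset.sum_congr rfl fun j _ => ?_
  rw [placePosition, pow_add, mul_assoc, LabelArray.digit]
  congr 3
  exact ((glue a b).column_apply p j).symm

/-- The frequencies attached to the low labels. -/
def lowFrequency (N : ℕ) (b₀ : HighLabels r k L s) (a : LowLabels r k L s) : ℤ :=
  ∑ i ∈ lowPlaces r k s, (N : ℤ) ^ placeLevel s i * glue a b₀ i

/-- The frequencies attached to the high labels. -/
def highFrequency (N : ℕ) (a₀ : LowLabels r k L s) (b : HighLabels r k L s) : ℤ :=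
  ∑ i ∈ highPlaces r k s, (N : ℤ) ^ placeLevel s i * glue a₀ b i

theorem lowFrequency_add_highFrequency (a a₀ : LowLabels r k L s) (b b₀ : HighLabels r k L s) :
    lowFrequency N b₀ a + highFrequency N a₀ b = (glue a b).frequency N s := by
  have e₁ : lowFrequency N b₀ a = ∑ i ∈ lowPlaces r k s, (N : ℤ) ^ placeLevel s i * glue a b i := by
    refine Finset.sum_congr rfl fun i hi => ?_
    rw [mem_lowPlaces] at hi
    rw [glue_low _ _ hi, glue_low _ _ hi]
  have e₂ : highFrequency N a₀ b =
      ∑ i ∈ highPlaces r k s, (N : ℤ) ^ placeLevel s i * glue a b i := by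
    refine Finset.sum_congr rfl fun i hi => ?_
    rw [mem_highPlaces] at hi
    rw [glue_high _ _ hi, glue_high _ _ hi]
  rw [e₁, e₂, lowPlaces, highPlaces, Finset.sum_filter_add_sum_filter_not, LabelArray.frequency]

theorem sum_low_eq_zero (h : StageSystem N k L s ε) (hN : 2 ≤ N) (b₀ : HighLabels r k L s)
    {i₀ : Fin r × Fin (k + 1)} (hi₀ : placePosition s i₀ < r) {H η z : ℤ}
    (hH : H = (N : ℤ) ^ placeLevel s i₀ * η + (N : ℤ) ^ (placeLevel s i₀ + 1) * z)
    (hzero : ∀ y : ℕ → ℤ, (∀ i ≤ k, y i ∈ L i) →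
      ∑ l ∈ L i₀.2, cis ((η : ℝ) / N * ε i₀.2 (chainPoint N s ε y i₀.2) l) = 0) :
    ∑ a : LowLabels r k L s, cis ((H : ℝ) / (N ^ r : ℕ) * low N ε b₀ a) = 0 := by
  refine sum_pi_eq_zero_of_update (X := fun i : {i : Fin r × Fin (k + 1) // placePosition s i < r} =>
    (L i.1.2 : Type)) ⟨i₀, hi₀⟩ _ fun a => ?_
  simp only [low, glue_update_low]
  refine LabelArray.sum_cis_update_eq_zero hN (mem_lowPlaces.2 hi₀) ?_ hH ?_ _ hzero
  · intro i _ hi hlt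
    have := h.position_lt _ _ hlt (Nat.lt_succ_iff.1 i.2.2)
    simp only [placePosition, hi]
    omega
  · rw [placeLevel, if_pos hi₀]
    omega

theorem sum_high_eq_zero (h : StageSystem N k L s ε) (hN : 2 ≤ N) (hsr : s k < r)
    (a : LowLabels r k L s)
    {i₀ : Fin r × Fin (k + 1)} (hi₀ : ¬ placePosition s i₀ < r) {H η z : ℤ}
    (hH : H = (N : ℤ) ^ placeLevel s i₀ * η + (N : ℤ) ^ (placeLevel s i₀ + 1) * z)
    (hzero : ∀ y : ℕ → ℤ, (∀ i ≤ k, y i ∈ L i) →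
      ∑ l ∈ L i₀.2, cis ((η : ℝ) / N * ε i₀.2 (chainPoint N s ε y i₀.2) l) = 0) :
    ∑ b : HighLabels r k L s, cis ((H : ℝ) / (N ^ r : ℕ) * high N ε a b) = 0 := by
  refine sum_pi_eq_zero_of_update
    (X := fun i : {i : Fin r × Fin (k + 1) // ¬ placePosition s i < r} =>
    (L i.1.2 : Type)) ⟨i₀, hi₀⟩ _ fun b => ?_
  simp only [high, glue_update_high]
  refine LabelArray.sum_cis_update_eq_zero hN (mem_highPlaces.2 hi₀) ?_ hH ?_ _ hzero
  · intro i _ hi hlt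
    have := h.position_lt _ _ hlt (Nat.lt_succ_iff.1 i.2.2)
    simp only [placePosition, hi] at *
    omega
  -- Positions are below 2r, so no subtraction truncates and (2r - 1 - position) + (position - r) +
  -- 1 = r.
  · have h1 := h.position_lt_of_lt hsr i₀.2
    have h2 := i₀.1.2
    rw [placeLevel, if_neg hi₀]
    simp only [placePosition] at *
    omega

/-- Each condition is a pivot argument: for the low zone, the high zone, and all places. In the last
case the layer of the pivot decides which alternative of `orth` holds. -/
theorem twoLayer (h : StageSystem N k L s ε) (hN : 2 ≤ N) (hsr : s k < r) (h0 : s 0 = 0)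
    (a₀ : LowLabels r k L s) (b₀ : HighLabels r k L s) :
    TwoLayer (N ^ r) (low N ε b₀) (high N ε) (lowFrequency N b₀) (highFrequency N a₀) := by
  refine ⟨fun a a' haa => ?_, fun b b' hbb x => ?_, fun p p' hpp => ?_⟩
  · obtain ⟨i₀, hi₀, η, z, hH, hzero⟩ := h.exists_pivot hsr (h.isZone_lowPlaces hsr)
      (w := glue a b₀) (w' := glue a' b₀) (fun he => haa (glue_injective he).1) fun i hi => by
        rw [mem_lowPlaces] at hi
        rw [glue_high _ _ hi, glue_high _ _ hi]
    refine h.sum_low_eq_zero hN b₀ (mem_lowPlaces.1 hi₀) (z := z) ?_ hzero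
    rw [← hH, ← lowFrequency_add_highFrequency a a₀ b₀ b₀,
      ← lowFrequency_add_highFrequency a' a₀ b₀ b₀]
    ring
  · obtain ⟨i₀, hi₀, η, z, hH, hzero⟩ := h.exists_pivot hsr (h.isZone_highPlaces hsr h0)
      (w := glue a₀ b) (w' := glue a₀ b') (fun he => hbb (glue_injective he).2) fun i hi => by
        rw [mem_highPlaces, not_not] at hi
        rw [glue_low _ _ hi, glue_low _ _ hi]
    refine h.sum_high_eq_zero hN hsr x (mem_highPlaces.1 hi₀) (z := z) ?_ hzero
    rw [← hH, ← lowFrequency_add_highFrequency a₀ a₀ b b₀,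
      ← lowFrequency_add_highFrequency a₀ a₀ b' b₀]
    ring
  · obtain ⟨i₀, -, η, z, hH, hzero⟩ := h.exists_pivot hsr (Z := Finset.univ)
      (Or.inl fun _ _ _ _ _ => Finset.mem_univ _)
      (w := glue p.1 p.2) (w' := glue p'.1 p'.2)
      (fun he => hpp (Prod.ext (glue_injective he).1 (glue_injective he).2))
      fun i hi => absurd (Finset.mem_univ i) hi
    rw [← lowFrequency_add_highFrequency p.1 a₀ p.2 b₀,
      ← lowFrequency_add_highFrequency p'.1 a₀ p'.2 b₀] at hH
    by_cases hi₀ : placePosition s i₀ < r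
    · exact Or.inl (h.sum_low_eq_zero hN b₀ hi₀ hH hzero)
    · exact Or.inr fun x => h.sum_high_eq_zero hN hsr x hi₀ hH hzero

end StageSystem

/-- A sequence of labels in `L 0, …, L k`, extended by zeros. -/
def extendLabels (x : ∀ j : Fin (k + 1), L j) (j : ℕ) : ℤ :=
  if h : j < k + 1 then x ⟨j, h⟩ else 0

theorem extendLabels_mem (x : ∀ j : Fin (k + 1), L j) {j : ℕ} (hj : j ≤ k) :
    extendLabels x j ∈ L j := by
  rw [extendLabels, dif_pos (Nat.lt_succ_of_le hj)]
  exact (x ⟨j, _⟩).2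

/-- An array of labels as a sequence of columns. -/
def columnsEquiv : (Fin r → ∀ j : Fin (k + 1), L j) ≃ LabelArray r k L where
  toFun c i := c i.1 i.2
  invFun w p j := w (p, j)
  left_inv _ := rfl
  right_inv _ := rfl

/-- Arrays of labels correspond to pairs of low and high labels. -/
def glueEquiv : LowLabels r k L s × HighLabels r k L s ≃ LabelArray r k L :=
  (Equiv.piEquivPiSubtypeProd (fun i : Fin r × Fin (k + 1) => placePosition s i < r)
    fun i => (L i.2 : Type)).symm

/-- Pairs of low and high labels are the same as r independent columns, and the digit is ∑ N^p times
the p-th column sum, so the mask factors. The single digit set is viewed as a system with trivial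
second layer. -/
theorem StageSystem.digitMask_low_high (h : StageSystem N k L s ε) (hN : 2 ≤ N)
    (b₀ : HighLabels r k L s) (t : ℝ) :
    digitMask (N ^ r) (low N ε b₀) (high N ε) (t / (N ^ r : ℕ)) =
      ∏ i ∈ Finset.range r, digitMask N
        (fun x : ∀ j : Fin (k + 1), L j => chainPoint N s ε (extendLabels x) (k + 1))
        (fun _ (_ : Unit) => 0) (t / N ^ (i + 1)) := by
  have hN0 : (N : ℝ) ≠ 0 := by positivity
  have hcard : Fintype.card (LowLabels r k L s × HighLabels r k L s) =
      Fintype.card ((∀ j : Fin (k + 1), L j) × Unit) ^ r := by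
    rw [Fintype.card_congr (glueEquiv.trans columnsEquiv.symm), Fintype.card_fun, Fintype.card_fin,
      Fintype.card_prod, Fintype.card_unit, mul_one]
  rw [digitMask_eq, hcard]
  simp_rw [digitMask_eq]
  rw [Finset.prod_mul_distrib, Finset.prod_const, Finset.card_range, Nat.cast_pow, inv_pow]
  congr 1
  have e₁ : ∀ p : LowLabels r k L s × HighLabels r k L s,
      cis (t / (N ^ r : ℕ) * (low N ε b₀ p.1 + (N ^ r : ℕ) * high N ε p.1 p.2 : ℤ)) =
      ∏ q : Fin r, cis (t / (N : ℝ) ^ (r - 1 - q + 1) * chainPoint N s ε (extendLabels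
        (columnsEquiv.symm (glueEquiv p) q)) (k + 1)) := by
    intro p
    rw [h.low_add_high]
    rw [← cis_sum, Int.cast_sum, Finset.mul_sum]
    congr 1
    refine Finset.sum_congr rfl fun q _ => ?_
    have hq : (N : ℝ) ^ r = (N : ℝ) ^ (r - 1 - q + 1) * (N : ℝ) ^ (q : ℕ) := by
      rw [← pow_add]
      congr 1
      have := q.2
      omega
    have hc : LabelArray.column (glue p.1 p.2) q = extendLabels (columnsEquiv.symm (glueEquiv p) q) :=
      rfl
    rw [hc]
    push_cast
    rw [hq]
    field_simp
  rw [Finset.sum_congr rfl fun p _ => e₁ p]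
  refine ((glueEquiv.trans columnsEquiv.symm).sum_comp (fun c => ∏ q : Fin r,
    cis (t / (N : ℝ) ^ (r - 1 - q + 1) * chainPoint N s ε (extendLabels (c q)) (k + 1)))).trans ?_
  rw [← Finset.prod_range_reflect, Finset.prod_range]
  have e₂ : ∀ q : Fin r, ∑ p : (∀ j : Fin (k + 1), L j) × Unit,
      cis (t / (N : ℝ) ^ (r - 1 - q + 1) *
        (chainPoint N s ε (extendLabels p.1) (k + 1) + N * 0 : ℤ)) =
      ∑ x : ∀ j : Fin (k + 1), L j,
        cis (t / (N : ℝ) ^ (r - 1 - q + 1) * chainPoint N s ε (extendLabels x) (k + 1)) := by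
    intro q
    rw [Fintype.sum_prod_type]
    simp
  rw [Finset.prod_congr rfl fun q _ => e₂ q, Finset.prod_univ_sum, Fintype.piFinset_univ]

theorem StageSystem.exists_isCompleteOrthogonal (h : StageSystem N k L s ε) (hN : 2 ≤ N)
    (h0 : s 0 = 0) (hL : ∀ j ≤ k, (L j).Nonempty) {μ : Measure ℝ} [IsProbabilityMeasure μ]
    (hμ : ∀ t, charFun μ (2 * Real.pi * t) =
      ((Fintype.card (∀ j : Fin (k + 1), L j) : ℂ)⁻¹ * ∑ x : ∀ j : Fin (k + 1), L j,
        cis (t / N * chainPoint N s ε (extendLabels x) (k + 1))) *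
        charFun μ (2 * Real.pi * (t / N))) :
    ∃ Λ : Set ℝ, Λ.Countable ∧ IsCompleteOrthogonal μ Λ := by
  have hne : ∀ j : Fin (k + 1), Nonempty (L j) := fun j =>
    (hL j (Nat.lt_succ_iff.1 j.2)).to_subtype
  -- With r > s k all positions lie below 2r, so two layers suffice.
  let r := s k + 1
  have hsr : s k < r := Nat.lt_succ_self _
  let a₀ : LowLabels r k L s := fun i => Classical.choice (hne i.1.2)
  let b₀ : HighLabels r k L s := fun i => Classical.choice (hne i.1.2)
  have : Nonempty (LowLabels r k L s) := ⟨a₀⟩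
  have : Nonempty (HighLabels r k L s) := ⟨b₀⟩
  have hNr : 2 ≤ N ^ r := hN.trans (Nat.le_self_pow (Nat.succ_ne_zero _) N)
  refine (h.twoLayer hN hsr h0 a₀ b₀).exists_isCompleteOrthogonal hNr fun t => ?_
  rw [h.digitMask_low_high hN b₀ t, Nat.cast_pow]
  refine eq_prod_digitMask_mul (χ := fun t => charFun μ (2 * Real.pi * t)) (fun t => ?_) r t
  rw [digitMask_eq]
  rw [hμ, Fintype.sum_prod_type, Fintype.card_prod, Fintype.card_unit, mul_one]
  simp

end

/-! ### Exponential sums of Hadamard triples and of direct sums. -/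

namespace IsHadamardTriple

variable {N : ℕ} {D L : Finset ℤ}

theorem hadamardMatrix_apply (N : ℕ) (D L : Finset ℤ) (d : D) (l : L) :
    hadamardMatrix N D L d l = ((Real.sqrt (D.card : ℝ))⁻¹ : ℝ) * cis ((l : ℤ) / N * (d : ℤ)) := by
  rw [hadamardMatrix, Matrix.of_apply, cis]
  congr 2
  push_cast
  ring

/-- Compare the traces of the two unitarity identities. -/
theorem card_eq (h : IsHadamardTriple N D L) : D.card = L.card := by
  have h1 := Matrix.trace_mul_comm (hadamardMatrix N D L) (hadamardMatrix N D L)ᴴ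
  rw [h.mul_conjTranspose, h.conjTranspose_mul, Matrix.trace_one, Matrix.trace_one,
    Fintype.card_coe, Fintype.card_coe] at h1
  exact_mod_cast h1

theorem sqrt_ne_zero (h : IsHadamardTriple N D L) :
    (((Real.sqrt (D.card : ℝ))⁻¹ : ℝ) : ℂ) ≠ 0 := by
  have : 0 < Real.sqrt (D.card : ℝ) := Real.sqrt_pos.2 (by exact_mod_cast h.nonempty.card_pos)
  exact_mod_cast (inv_pos.2 this).ne'

theorem sum_cis_eq_zero (h : IsHadamardTriple N D L) {l l' : ℤ} (hl : l ∈ L) (hl' : l' ∈ L)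
    (hne : l ≠ l') : ∑ d ∈ D, cis (((l - l' : ℤ) : ℝ) / N * d) = 0 := by
  have h1 := congrFun (congrFun h.conjTranspose_mul ⟨l', hl'⟩) ⟨l, hl⟩
  rw [Matrix.one_apply_ne (by simpa using hne.symm), Matrix.mul_apply] at h1
  rw [← Finset.sum_coe_sort D (fun d => cis (((l - l' : ℤ) : ℝ) / N * d))]
  have e : ∀ d : D, (hadamardMatrix N D L)ᴴ ⟨l', hl'⟩ d * hadamardMatrix N D L d ⟨l, hl⟩ =
      (((Real.sqrt (D.card : ℝ))⁻¹ : ℝ) : ℂ) ^ 2 * cis (((l - l' : ℤ) : ℝ) / N * (d : ℤ)) := by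
    intro d
    have e1 : ((l - l' : ℤ) : ℝ) / N * (d : ℤ) = (l : ℝ) / N * (d : ℤ) - (l' : ℝ) / N * (d : ℤ) := by
      push_cast; ring
    rw [Matrix.conjTranspose_apply, hadamardMatrix_apply, hadamardMatrix_apply, e1, cis_sub]
    simp only [star_mul', RCLike.star_def, Complex.conj_ofReal]
    ring
  rw [Finset.sum_congr rfl fun d _ => e d, ← Finset.mul_sum] at h1
  exact (mul_eq_zero.1 h1).resolve_left (pow_ne_zero _ h.sqrt_ne_zero)

/-- Digits congruent modulo N give equal rows, whose inner product cannot vanish, whereas distinct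
rows are orthogonal. -/
theorem eq_of_dvd (h : IsHadamardTriple N D L) (hN : N ≠ 0) {d d' : ℤ} (hd : d ∈ D) (hd' : d' ∈ D)
    (hdvd : (N : ℤ) ∣ d - d') : d = d' := by
  by_contra hne
  have h1 := congrFun (congrFun h.mul_conjTranspose ⟨d, hd⟩) ⟨d', hd'⟩
  rw [Matrix.one_apply_ne (by simpa using hne), Matrix.mul_apply] at h1
  obtain ⟨m, hm⟩ := hdvd
  have hN0 : (N : ℝ) ≠ 0 := by exact_mod_cast hN
  have e : ∀ l : L, hadamardMatrix N D L ⟨d, hd⟩ l * (hadamardMatrix N D L)ᴴ l ⟨d', hd'⟩ =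
      (((Real.sqrt (D.card : ℝ))⁻¹ : ℝ) : ℂ) ^ 2 := by
    intro l
    have e1 : (l : ℤ) / (N : ℝ) * d = (l : ℤ) / (N : ℝ) * d' + (l * m : ℤ) := by
      have : (d : ℝ) = d' + N * m := by
        have : d = d' + N * m := by linarith
        exact_mod_cast this
      rw [this]
      push_cast
      field_simp
    have e2 : cis ((l : ℤ) / (N : ℝ) * d') * (starRingEnd ℂ) (cis ((l : ℤ) / (N : ℝ) * d')) = 1 := by
      rw [conj_cis, cis_mul_cis_neg]
    rw [Matrix.conjTranspose_apply, hadamardMatrix_apply, hadamardMatrix_apply, e1,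
      cis_add_intCast]
    simp only [star_mul', RCLike.star_def, Complex.conj_ofReal]
    linear_combination (((Real.sqrt (D.card : ℝ))⁻¹ : ℝ) : ℂ) ^ 2 * e2
  rw [Finset.sum_congr rfl fun l _ => e l, Finset.sum_const, Finset.card_univ, Fintype.card_coe,
    ← h.card_eq, nsmul_eq_mul] at h1
  exact (mul_ne_zero (Nat.cast_ne_zero.2 h.nonempty.card_pos.ne')
    (pow_ne_zero _ h.sqrt_ne_zero)) h1

end IsHadamardTriple

theorem mem_sum_iff_exists {s : Finset ℕ} {A : ℕ → Finset ℤ} {a : ℤ} :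
    a ∈ ∑ j ∈ s, A j ↔ ∃ x : ℕ → ℤ, (∀ j ∈ s, x j ∈ A j) ∧ ∑ j ∈ s, x j = a := by
  classical
  induction s using Finset.induction_on generalizing a with
  | empty => simp [eq_comm]
  | insert i s hi ih =>
    rw [Finset.sum_insert hi, Finset.mem_add]
    constructor
    · rintro ⟨b, hb, c, hc, rfl⟩
      obtain ⟨x, hx, rfl⟩ := ih.1 hc
      refine ⟨Function.update x i b, fun j hj => ?_, ?_⟩
      · by_cases hji : j = i
        · subst hji; rwa [Function.update_self]
        · rw [Function.update_of_ne hji]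
          exact hx j ((Finset.mem_insert.1 hj).resolve_left hji)
      · rw [Finset.sum_insert hi, Function.update_self]
        congr 1
        refine Finset.sum_congr rfl fun j hj => Function.update_of_ne ?_ _ _
        rintro rfl
        exact hi hj
    · rintro ⟨x, hx, rfl⟩
      refine ⟨x i, hx i (Finset.mem_insert_self _ _), ∑ j ∈ s, x j,
        ih.2 ⟨x, fun j hj => hx j (Finset.mem_insert_of_mem hj), rfl⟩, ?_⟩
      rw [Finset.sum_insert hi]

theorem IsDirectSum.sum_cis {s : Finset ℕ} {A : ℕ → Finset ℤ} (h : IsDirectSum s A) (t : ℝ) :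
    ∑ e ∈ ∑ j ∈ s, A j, cis (t * e) = ∏ j ∈ s, ∑ e ∈ A j, cis (t * e) := by
  classical
  let ext : (∀ j ∈ s, ℤ) → ℕ → ℤ := fun p j => if hj : j ∈ s then p j hj else 0
  have hext : ∀ (p : ∀ j ∈ s, ℤ) j (hj : j ∈ s), ext p j = p j hj := fun p j hj => dif_pos hj
  have hsum : ∀ p : ∀ j ∈ s, ℤ, ∑ x ∈ s.attach, p x.1 x.2 = ∑ j ∈ s, ext p j := by
    intro p
    rw [← Finset.sum_attach s (ext p)]
    exact Finset.sum_congr rfl fun x _ => (hext p x.1 x.2).symm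
  rw [Finset.prod_sum]
  symm
  refine Finset.sum_bij (fun p _ => ∑ x ∈ s.attach, p x.1 x.2) ?_ ?_ ?_ ?_
  · intro p hp
    rw [Finset.mem_pi] at hp
    rw [mem_sum_iff_exists]
    exact ⟨ext p, fun j hj => by rw [hext p j hj]; exact hp j hj, (hsum p).symm⟩
  · intro p hp p' hp' he
    rw [Finset.mem_pi] at hp hp'
    rw [hsum, hsum] at he
    have := h (ext p) (ext p') (fun j hj => by rw [hext p j hj]; exact hp j hj)
      (fun j hj => by rw [hext p' j hj]; exact hp' j hj) he
    funext j hj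
    rw [← hext p j hj, ← hext p' j hj]
    exact this j hj
  · intro a ha
    obtain ⟨x, hx, rfl⟩ := mem_sum_iff_exists.1 ha
    exact ⟨fun j _ => x j, Finset.mem_pi.2 hx, Finset.sum_attach s x⟩
  · intro p _
    rw [← cis_sum, Int.cast_sum, Finset.mul_sum]

/-- Directness of the labels keeps the two frequencies distinct; directness of the digits factors
the vanishing sum, so one factor is zero. -/
theorem IsDirectSumHadamardTriple.exists_sum_cis_eq_zero {N : ℕ} {s : Finset ℕ}
    {A L : ℕ → Finset ℤ} (h : IsDirectSumHadamardTriple N s A L) {x y : ℕ → ℤ}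
    (hx : ∀ j ∈ s, x j ∈ L j) (hy : ∀ j ∈ s, y j ∈ L j) (hne : ∃ j ∈ s, x j ≠ y j) :
    ∃ j ∈ s, ∑ e ∈ A j, cis (((∑ i ∈ s, (x i - y i) : ℤ) : ℝ) / N * e) = 0 := by
  obtain ⟨hA, hL, hH⟩ := h
  obtain ⟨j, hj, hxy⟩ := hne
  have h1 := hH.sum_cis_eq_zero (mem_sum_iff_exists.2 ⟨x, hx, rfl⟩)
    (mem_sum_iff_exists.2 ⟨y, hy, rfl⟩) fun he => hxy (hL x y hx hy he j hj)
  rw [← Finset.sum_sub_distrib, hA.sum_cis] at h1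
  exact Finset.prod_eq_zero_iff.1 h1

/-! ### Labelling the digits and producing the stage system. -/

/-- The possible values of the partial sums of digits preceding stage `j`. -/
def precedingDigits (N : ℕ) (ℓ : ℕ → ℕ) (E₀ : Finset ℤ) (E : ℕ → ℤ → Finset ℤ) : ℕ → Finset ℤ
  | 0 => {0}
  | j + 1 => stageDigits N ℓ E₀ E j

/-- The digits of stage `j` that may follow the partial sum `d`. -/
def followingDigits (E₀ : Finset ℤ) (E : ℕ → ℤ → Finset ℤ) (j : ℕ) (d : ℤ) : Finset ℤ :=
  stageSummand E₀ E (fun _ => d) j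

theorem precedingDigits_succ (N : ℕ) (ℓ : ℕ → ℕ) (E₀ : Finset ℤ) (E : ℕ → ℤ → Finset ℤ) (j : ℕ) :
    precedingDigits N ℓ E₀ E (j + 1) = (precedingDigits N ℓ E₀ E j).biUnion fun d =>
      (followingDigits E₀ E j d).image fun e => d + (N : ℤ) ^ (∑ i ∈ Finset.Icc 1 j, ℓ i) * e := by
  cases j with
  | zero =>
    ext e
    simp [precedingDigits, followingDigits, stageSummand, stageDigits]
  | succ j => rfl

/-- `ε j d` maps the labels `L j` bijectively to the digits of stage `j` following `d`, and distinct
such digits are incongruent modulo `N`. -/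
structure IsDigitLabelling (N k : ℕ) (L : ℕ → Finset ℤ) (ℓ : ℕ → ℕ) (E₀ : Finset ℤ)
    (E : ℕ → ℤ → Finset ℤ) (ε : ℕ → ℤ → ℤ → ℤ) : Prop where
  bijOn : ∀ j ≤ k, ∀ d ∈ precedingDigits N ℓ E₀ E j,
    Set.BijOn (ε j d) (L j) (followingDigits E₀ E j d)
  eq_of_dvd : ∀ j ≤ k, ∀ d ∈ precedingDigits N ℓ E₀ E j, ∀ e ∈ followingDigits E₀ E j d,
    ∀ e' ∈ followingDigits E₀ E j d, (N : ℤ) ∣ e - e' → e = e'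

namespace IsDigitLabelling

variable {N k : ℕ} {L : ℕ → Finset ℤ} {ℓ : ℕ → ℕ} {E₀ : Finset ℤ} {E : ℕ → ℤ → Finset ℤ}
  {ε : ℕ → ℤ → ℤ → ℤ} {s : ℕ → ℕ}

theorem chainPoint_mem (h : IsDigitLabelling N k L ℓ E₀ E ε)
    (hs : ∀ j, s j = ∑ i ∈ Finset.Icc 1 j, ℓ i) {x : ℕ → ℤ} {j : ℕ} (hj : j ≤ k + 1)
    (hx : ∀ i < j, x i ∈ L i) : chainPoint N s ε x j ∈ precedingDigits N ℓ E₀ E j := by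
  induction j with
  | zero => exact Finset.mem_singleton_self 0
  | succ j ih =>
    have hc := ih (by omega) fun i hi => hx i (by omega)
    rw [precedingDigits_succ, Finset.mem_biUnion]
    refine ⟨_, hc, Finset.mem_image.2 ⟨_, (h.bijOn j (by omega) _ hc).mapsTo (hx j (by omega)), ?_⟩⟩
    rw [chainPoint, hs]

theorem exists_chainPoint_eq (h : IsDigitLabelling N k L ℓ E₀ E ε)
    (hs : ∀ j, s j = ∑ i ∈ Finset.Icc 1 j, ℓ i) {j : ℕ} (hj : j ≤ k + 1) {d : ℤ}
    (hd : d ∈ precedingDigits N ℓ E₀ E j) :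
    ∃ x : ℕ → ℤ, (∀ i < j, x i ∈ L i) ∧ chainPoint N s ε x j = d := by
  induction j generalizing d with
  | zero => exact ⟨0, by simp, (Finset.mem_singleton.1 hd).symm⟩
  | succ j ih =>
    rw [precedingDigits_succ, Finset.mem_biUnion] at hd
    obtain ⟨c, hc, hd⟩ := hd
    obtain ⟨e, he, rfl⟩ := Finset.mem_image.1 hd
    obtain ⟨x, hx, rfl⟩ := ih (by omega) hc
    obtain ⟨l, hl, rfl⟩ := (h.bijOn j (by omega) _ hc).surjOn he
    have hagree : ∀ i < j, Function.update x j l i = x i := fun i hi =>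
      Function.update_of_ne hi.ne _ _
    refine ⟨Function.update x j l, fun i hi => ?_, ?_⟩
    · rcases Nat.lt_succ_iff_lt_or_eq.1 hi with hi | rfl
      · rw [hagree i hi]; exact hx i hi
      · rw [Function.update_self]; exact hl
    · rw [chainPoint, chainPoint_congr N s ε hagree, Function.update_self, hs]

/-- Reducing modulo smaller powers of N recovers the labels stage by stage: positions increase
strictly, and digits following a given partial sum are distinct modulo N. -/
theorem eq_of_dvd_chainPoint (h : IsDigitLabelling N k L ℓ E₀ E ε)
    (hs : ∀ j, s j = ∑ i ∈ Finset.Icc 1 j, ℓ i) (hN : N ≠ 0)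
    (hlt : ∀ i j, i < j → j ≤ k → s i < s j) {x y : ℕ → ℤ} {j : ℕ} (hj : j ≤ k)
    (hx : ∀ i ≤ j, x i ∈ L i) (hy : ∀ i ≤ j, y i ∈ L i)
    (hdvd : (N : ℤ) ^ (s j + 1) ∣ chainPoint N s ε x (j + 1) - chainPoint N s ε y (j + 1)) :
    ∀ i ≤ j, x i = y i := by
  have hlast : ∀ j ≤ k, (∀ i ≤ j, x i ∈ L i) → (∀ i ≤ j, y i ∈ L i) → (∀ i < j, x i = y i) →
      (N : ℤ) ^ (s j + 1) ∣ chainPoint N s ε x (j + 1) - chainPoint N s ε y (j + 1) →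
      x j = y j := by
    intro j hj hx hy hxy hdvd
    have hc := h.chainPoint_mem hs (by omega : j ≤ k + 1) fun i hi => hx i hi.le
    have hb := h.bijOn j hj _ hc
    refine hb.injOn (hx j le_rfl) (hy j le_rfl) (h.eq_of_dvd j hj _ hc _
      (hb.mapsTo (hx j le_rfl)) _ (hb.mapsTo (hy j le_rfl)) ?_)
    rw [chainPoint, chainPoint, ← chainPoint_congr N s ε hxy, add_sub_add_left_eq_sub, ← mul_sub,
      pow_succ] at hdvd
    exact Int.dvd_of_mul_dvd_mul_left (pow_ne_zero _ (by exact_mod_cast hN)) hdvd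
  induction j with
  | zero =>
    intro i hi
    obtain rfl := Nat.le_zero.1 hi
    exact hlast 0 hj hx hy (by simp) hdvd
  | succ j ih =>
    have hpow : (N : ℤ) ^ (s j + 1) ∣ (N : ℤ) ^ s (j + 1) :=
      pow_dvd_pow _ (hlt j (j + 1) j.lt_succ_self hj)
    have hprev := ih (by omega) (fun i hi => hx i (by omega)) (fun i hi => hy i (by omega)) (by
      have h1 := (hpow.trans (pow_dvd_pow _ (Nat.le_succ _))).trans hdvd
      have h2 : ∀ x, chainPoint N s ε x (j + 1 + 1) = chainPoint N s ε x (j + 1) +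
        (N : ℤ) ^ s (j + 1) * ε (j + 1) (chainPoint N s ε x (j + 1)) (x (j + 1)) := fun _ => rfl
      rw [h2, h2, add_sub_add_comm, ← mul_sub] at h1
      exact (Int.dvd_add_left (hpow.trans (dvd_mul_right _ _))).1 h1)
    intro i hi
    rcases hi.lt_or_eq with hi | rfl
    · exact hprev i (by omega)
    · exact hlast _ hj hx hy (fun i hi => hprev i (by omega)) hdvd

theorem precedingDigits_eq_image (h : IsDigitLabelling N k L ℓ E₀ E ε)
    (hs : ∀ j, s j = ∑ i ∈ Finset.Icc 1 j, ℓ i) :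
    precedingDigits N ℓ E₀ E (k + 1) = Finset.univ.image fun x : ∀ j : Fin (k + 1), L j =>
      chainPoint N s ε (extendLabels x) (k + 1) := by
  ext d
  rw [Finset.mem_image]
  constructor
  · intro hd
    obtain ⟨x, hx, rfl⟩ := h.exists_chainPoint_eq hs le_rfl hd
    refine ⟨fun j => ⟨x j, hx j j.2⟩, Finset.mem_univ _, chainPoint_congr N s ε fun i hi => ?_⟩
    exact dif_pos hi
  · rintro ⟨x, -, rfl⟩
    exact h.chainPoint_mem hs le_rfl fun i hi => extendLabels_mem x (Nat.lt_succ_iff.1 hi)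

theorem chainPoint_injective (h : IsDigitLabelling N k L ℓ E₀ E ε)
    (hs : ∀ j, s j = ∑ i ∈ Finset.Icc 1 j, ℓ i) (hN : N ≠ 0)
    (hlt : ∀ i j, i < j → j ≤ k → s i < s j) :
    Function.Injective fun x : ∀ j : Fin (k + 1), L j =>
      chainPoint N s ε (extendLabels x) (k + 1) := by
  intro x y hxy
  have h1 := h.eq_of_dvd_chainPoint hs hN hlt le_rfl (fun i hi => extendLabels_mem x hi)
    (fun i hi => extendLabels_mem y hi) (by
      rw [show chainPoint N s ε (extendLabels x) (k + 1) =
        chainPoint N s ε (extendLabels y) (k + 1) from hxy, sub_self]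
      exact dvd_zero _)
  ext j
  have h2 := h1 j (Nat.lt_succ_iff.1 j.2)
  rwa [extendLabels, extendLabels, dif_pos j.2, dif_pos j.2] at h2

theorem stageSystem (h : IsDigitLabelling N k L ℓ E₀ E ε)
    (hs : ∀ j, s j = ∑ i ∈ Finset.Icc 1 j, ℓ i) (hlt : ∀ i j, i < j → j ≤ k → s i < s j)
    (hL : ∀ j ≤ k, (L j).Nonempty)
    (hdirect : ∀ m n, (m = 0 ∧ n ≤ k ∨ 1 ≤ m ∧ m ≤ k ∧ n = k) → ∀ d : ℕ → ℤ,
      (∀ j < k, d j ∈ stageDigits N ℓ E₀ E j) →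
        IsDirectSumHadamardTriple N (Finset.Icc m n) (stageSummand E₀ E d) L) :
    StageSystem N k L s ε := by
  classical
  refine ⟨hlt, fun m n hmn x y hx hy hne => ?_⟩
  -- If every stage j had a history z j with nonzero sum, these histories could be used
  -- simultaneously, because the digits d j are chosen independently. The resulting Hadamard triple
  -- has a vanishing factor, a contradiction.
  by_contra! hcon
  choose! z hz hsum using hcon
  choose! z₀ hz₀ using hL
  -- Stages outside the segment receive an arbitrary admissible history z₀.
  let z' : ℕ → ℕ → ℤ := fun j => if j ∈ Finset.Icc m n then z j else z₀
  have hz' : ∀ j, ∀ i ≤ k, z' j i ∈ L i := by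
    intro j i hi
    simp only [z']
    split_ifs with hj
    · exact hz j hj i hi
    · exact hz₀ i hi
  -- The digit with index j is the history of stage j + 1, hence the shift in z' (j + 1).
  have hdir := hdirect m n (by
    obtain ⟨j, hj, -⟩ := hne
    rw [Finset.mem_Icc] at hj
    omega) (fun j => chainPoint N s ε (z' (j + 1)) (j + 1)) fun j hj =>
      h.chainPoint_mem (j := j + 1) hs (by omega) fun i hi => hz' _ i (by omega)
  obtain ⟨j, hj, h0⟩ := hdir.exists_sum_cis_eq_zero hx hy hne
  have hjk : j ≤ k := by
    rw [Finset.mem_Icc] at hj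
    omega
  have hsummand : stageSummand E₀ E (fun j => chainPoint N s ε (z' (j + 1)) (j + 1)) j =
      followingDigits E₀ E j (chainPoint N s ε (z j) j) := by
    have : z' j = z j := if_pos hj
    rw [← this]
    cases j <;> rfl
  rw [hsummand] at h0
  have hb := h.bijOn j hjk _ (h.chainPoint_mem (x := z j) hs (by omega)
    fun i hi => hz j hj i (by omega))
  refine hsum j hj ((Finset.sum_nbij _ hb.mapsTo hb.injOn hb.surjOn fun l _ => rfl).trans h0)

end IsDigitLabelling

theorem exists_isDigitLabelling {N k : ℕ} {L : ℕ → Finset ℤ} {ℓ : ℕ → ℕ}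
    {E₀ : Finset ℤ} {E : ℕ → ℤ → Finset ℤ} (hN : N ≠ 0)
    (h : ∀ j ≤ k, ∀ d ∈ precedingDigits N ℓ E₀ E j,
      IsHadamardTriple N (followingDigits E₀ E j d) (L j)) :
    ∃ ε, IsDigitLabelling N k L ℓ E₀ E ε := by
  have hε : ∀ j d, ∃ f : ℤ → ℤ, j ≤ k → d ∈ precedingDigits N ℓ E₀ E j →
      Set.BijOn f (L j) (followingDigits E₀ E j d) := by
    intro j d
    by_cases hjd : j ≤ k ∧ d ∈ precedingDigits N ℓ E₀ E j
    · obtain ⟨f, hf⟩ := (L j).finite_toSet.exists_bijOn_of_encard_eq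
        (t := (followingDigits E₀ E j d : Set ℤ)) (by
          rw [Set.encard_coe_eq_coe_finsetCard, Set.encard_coe_eq_coe_finsetCard,
            (h j hjd.1 d hjd.2).card_eq])
      exact ⟨f, fun _ _ => hf⟩
    · exact ⟨id, fun h1 h2 => absurd ⟨h1, h2⟩ hjd⟩
  choose ε hε using hε
  exact ⟨ε, fun j hj d => hε j d hj, fun j hj d hd e he e' he' => (h j hj d hd).eq_of_dvd hN he he'⟩

theorem isDirectSumHadamardTriple_singleton {N : ℕ} {A L : ℕ → Finset ℤ} {j : ℕ}
    (h : IsHadamardTriple N (A j) (L j)) : IsDirectSumHadamardTriple N {j} A L := by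
  have hdir : ∀ A : ℕ → Finset ℤ, IsDirectSum {j} A := by
    intro A x y _ _ hxy i hi
    rw [Finset.sum_singleton, Finset.sum_singleton] at hxy
    rwa [Finset.mem_singleton.1 hi]
  refine ⟨hdir A, hdir L, ?_⟩
  rwa [Finset.sum_singleton, Finset.sum_singleton]

theorem theorem2p2 (N : ℕ) (hN : 2 ≤ N) (k : ℕ) (D : Finset ℤ) (L : ℕ → Finset ℤ)
    (h : IsProductFormHadamardTriple N k D L) (μ : Measure ℝ) (hμ : IsSelfSimilarMeasure N D μ) :
    IsSpectralMeasure μ := by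
  obtain ⟨ℓ, E₀, E, hℓ, rfl, hH₀, hH, hdirect⟩ := h
  have hprob := hμ.isProbabilityMeasure
  have hN0 : N ≠ 0 := by omega
  have hH' : ∀ j ≤ k, ∀ d ∈ precedingDigits N ℓ E₀ E j,
      IsHadamardTriple N (followingDigits E₀ E j d) (L j) := by
    intro j hj d hd
    cases j with
    | zero => exact hH₀
    | succ j => exact hH j hj d hd
  obtain ⟨ε, hε⟩ := exists_isDigitLabelling hN0 hH'
  let s : ℕ → ℕ := fun j => ∑ i ∈ Finset.Icc 1 j, ℓ i
  have hs : ∀ j, s j = ∑ i ∈ Finset.Icc 1 j, ℓ i := fun _ => rfl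
  have hlt : ∀ i j, i < j → j ≤ k → s i < s j := by
    intro i j hij hjk
    refine Finset.sum_lt_sum_of_subset (Finset.Icc_subset_Icc_right hij.le)
      (i := j) (Finset.mem_Icc.2 ⟨by omega, le_rfl⟩) (by simp [hij])
      (hℓ j (Finset.mem_Icc.2 ⟨by omega, hjk⟩)) fun _ _ _ => Nat.zero_le _
  have hL : ∀ j ≤ k, (L j).Nonempty := by
    have hboth : ∀ j ≤ k, (precedingDigits N ℓ E₀ E j).Nonempty ∧ (L j).Nonempty := by
      intro j
      induction j with
      | zero =>
        intro _
        refine ⟨⟨0, Finset.mem_singleton_self 0⟩, ?_⟩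
        rw [← Finset.card_pos, ← hH₀.card_eq]
        exact hH₀.nonempty.card_pos
      | succ j ih =>
        intro hj
        obtain ⟨⟨d, hd⟩, -⟩ := ih (by omega)
        obtain ⟨e, he⟩ := (hH' j (by omega) d hd).nonempty
        have hnext : (precedingDigits N ℓ E₀ E (j + 1)).Nonempty := by
          rw [precedingDigits_succ]
          exact ⟨_, Finset.mem_biUnion.2 ⟨d, hd, Finset.mem_image_of_mem _ he⟩⟩
        refine ⟨hnext, ?_⟩
        obtain ⟨d', hd'⟩ := hnext
        have := hH' (j + 1) hj d' hd'
        rw [← Finset.card_pos, ← this.card_eq]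
        exact this.nonempty.card_pos
    exact fun j hj => (hboth j hj).2
  have hsys : StageSystem N k L s ε := by
    refine hε.stageSystem hs hlt hL fun m n hmn d hd => ?_
    rcases hmn with ⟨rfl, hn⟩ | ⟨hm, hmk, rfl⟩
    · rcases Nat.eq_zero_or_pos n with rfl | hn0
      -- The segment {0} is not among the direct-sum hypotheses; it is the triple for E₀.
      · rw [Finset.Icc_self]
        exact isDirectSumHadamardTriple_singleton hH₀
      · exact (hdirect d hd n (Finset.mem_Icc.2 ⟨hn0, hn⟩)).1
    · exact (hdirect d hd m (Finset.mem_Icc.2 ⟨hm, hmk⟩)).2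
  have himage := hε.precedingDigits_eq_image hs
  have hinj := hε.chainPoint_injective hs hN0 hlt
  -- Injectivity of the labelling makes the uniform weights on the digits agree with those on label
  -- sequences.
  obtain ⟨Λ, hΛ, hc⟩ := hsys.exists_isCompleteOrthogonal hN (by simp [hs]) hL (μ := μ) fun t => by
    have e1 : 2 * Real.pi * t / N = 2 * Real.pi * (t / N) := by ring
    have e2 : stageDigits N ℓ E₀ E k = precedingDigits N ℓ E₀ E (k + 1) := rfl
    rw [hμ.charFun_eq, e1, e2, himage, Finset.card_image_of_injective _ hinj, Finset.card_univ,
      Finset.sum_image fun x _ y _ hxy => hinj hxy]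
    congr 2
    refine Finset.sum_congr rfl fun x _ => ?_
    rw [cis]
    congr 2
    push_cast
    ring
  exact hc.isSpectralMeasure hΛ
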